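/- **Setting.** Let $V_1,\dots,V_N\subset\mathbb{R}^3$ be bounded open sets (the scatterers) with pairwise disjoint closures and $C^1$ boundaries $S_n=\partial V_n$, let $\hat{\mathbf n}$ be the unit normal on $S_n$ pointing out of $V_n$, and let $V_0=\mathbb{R}^3\setminus\overline{\bigcup_{n\ge1} V_n}$. Let $\omega>0$. For $n=0,\dots,N$ let $\rho_n,\gamma_n>0$ (mass density, mean compressibility) and $\delta_n\ge0$ (compressional viscosity), with $\delta_0=0$, and put $$\nu_n=\omega\gamma_n\delta_n,\quad \beta_n=\rho_n\frac{1+\mathrm{i}\nu_n}{1+\nu_n^2},\quad k_n=\omega\sqrt{\gamma_n\beta_n}\ (\mathrm{Im}\,k_n\ge0),\quad \zeta_0=\sqrt{\rho_0/\gamma_0},$$ so that $\beta_0=\rho_0$. A point source of strength $A\in\mathbb{C}$ lies at a point $\mathbf a$ of the host scatterer $V_h$, $h\in\{1,\dots,N\}$; its primary field is $u_h^{\mathrm{pr}}(\mathbf r)=A\,e^{\mathrm{i}k_h|\mathbf r-\mathbf a|}/|\mathbf r-\mathbf a|$. The field in $V_n$ is the sum $u^n=\sum_{j=1}^N u_j^n$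 of single-scatterer fields, $n=0,\dots,N$. For each $j$: $u_j^n$ is of class $C^2$ with $\nabla^2u_j^n+k_n^2u_j^n=0$ in $V_n$, and of class $C^1$ up to the boundary of $V_n$ (with the point $\mathbf a$ removed if $n=h$); on $S_n$, $n=1,\dots,N$, one has $u_j^0=u_j^n$ and $\frac{\beta_n}{\rho_0}\,\partial u_j^0/\partial n=\partial u_j^n/\partial n$; and $r(\partial u_j^0/\partial r-\mathrm{i}k_0u_j^0)\to0$ as $r=|\mathbf r|\to\infty$, uniformly in all directions. In $V_h\setminus\{\mathbf a\}$, $u^h=u_h^{\mathrm{pr}}+u_h^{\mathrm{sc}}$ with a $C^2$ solution $u_h^{\mathrm{sc}}$ of the Helmholtz equation with wavenumber $k_h$ in all of $V_h$. The far-field pattern $g_j$ of $u_j^0$ is defined by $u_j^0(\mathbf r)=g_j(\hat{\mathbf r})h_0(k_0r)+\mathcal O(r^{-2})$ as $r\to\infty$, where $h_0(z)=e^{\mathrm{i}z}/(\mathrm{i}z)$, and the cluster-interaction cross section is $$\sigma_{\mathrm c}=\frac1{k_0^2}\sum_{k=1}^N\sum_{\substack{m=1\\ m\ne k}}^N\int_{S^2}g_k(\hat{\mathbf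 r})\overline{g_m(\hat{\mathbf r})}\,\mathrm ds(\hat{\mathbf r}).$$ The interaction intensity, interaction kinetic and potential energy densities and interaction Lagrangian density in $V_n$ are $$\mathbf I_{\mathrm R}^n=\frac{\mathrm i}{\omega\overline{\beta_n}}\sum_{1\le k<m\le N}\bigl(u_k^n\nabla\overline{u_m^n}+u_m^n\nabla\overline{u_k^n}\bigr),\qquad \mathcal K_{\mathrm R}^n=\frac{\rho_n}{2\omega^2|\beta_n|^2}\sum_{1\le k<m\le N}\bigl(\nabla u_k^n\cdot\nabla\overline{u_m^n}+\nabla u_m^n\cdot\nabla\overline{u_k^n}\bigr),$$ $$\mathcal U_{\mathrm R}^n=\frac{\gamma_n}{2}\sum_{1\le k<m\le N}\bigl(u_k^n\overline{u_m^n}+u_m^n\overline{u_k^n}\bigr),\qquad \mathcal L_{\mathrm R}^n=\mathcal K_{\mathrm R}^n-\mathcal U_{\mathrm R}^n .$$ **Theorem 2.** The far-field patterns $g_j$ exist, all the integrals below and in the definition of $\sigma_{\mathrm c}$ converge absolutely, and $$\frac{\sigma_{\mathrm c}}{\zeta_0}=\mathrm{Re}\left[\int_{S_h}\hat{\mathbf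 n}\cdot\mathbf I_{\mathrm R}^h\,\mathrm ds\right]-2\omega\sum_{\substack{n=1\\n\ne h}}^N\int_{V_n}\mathrm{Im}\left[\frac{\beta_n}{\rho_n}-1\right]\mathcal K_{\mathrm R}^n\,\mathrm dv,$$ $$\sum_{\substack{n=0\\n\ne h}}^N\int_{V_n}\mathcal L_{\mathrm R}^n\,\mathrm dv=-\frac1{2\omega}\mathrm{Im}\left[\int_{S_h}\hat{\mathbf n}\cdot\mathbf I_{\mathrm R}^h\,\mathrm ds\right]-\sum_{\substack{n=1\\n\ne h}}^N\int_{V_n}\mathrm{Re}\left[\frac{\beta_n}{\rho_n}-1\right]\mathcal K_{\mathrm R}^n\,\mathrm dv.$$ -/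

import Mathlib

open MeasureTheory Filter Topology

/-- Euclidean three-space. -/
abbrev E3 : Type := EuclideanSpace ℝ (Fin 3)

/-- Classical solutions of the Helmholtz equation `Δ u + κ² u = 0` on the (open) set `Ω`. -/
def IsHelmholtzSolution (κ : ℂ) (u : E3 → ℂ) (Ω : Set E3) : Prop :=
  ContDiffOn ℝ 2 u Ω ∧ ∀ x ∈ Ω, Laplacian.laplacian u x + κ ^ 2 * u x = 0

/-- The boundary of the open set `V` is a `C¹` surface and `ν` is its unit normal field pointing out
of `V`: near each boundary point, `V` is the sublevel set `{φ < 0}` of a `C¹` function `φ` without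
critical points, and `ν = ∇φ / |∇φ|` on the boundary. -/
def HasOutwardUnitNormal (V : Set E3) (ν : E3 → E3) : Prop :=
  ∀ x ∈ frontier V, ∃ (U : Set E3) (φ : E3 → ℝ), IsOpen U ∧ x ∈ U ∧ ContDiffOn ℝ 1 φ U ∧
    (∀ y ∈ U, gradient φ y ≠ 0) ∧ V ∩ U = {y ∈ U | φ y < 0} ∧
    ∀ y ∈ frontier V ∩ U, ν y = ‖gradient φ y‖⁻¹ • gradient φ y

/-- The partial derivative `∂u/∂xᵢ` at a point of the closure of the region `V`. On the open set `V`
it is the ordinary partial derivative; on the boundary it is the one-sided one, from inside `V`. -/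
noncomputable def partialDeriv (V : Set E3) (u : E3 → ℂ) (i : Fin 3) (x : E3) : ℂ :=
  fderivWithin ℝ u (closure V) x (EuclideanSpace.single i 1)

/-- The derivative of `u` in direction `ν` at a point of the closure of the region `V`
(on the boundary: one-sided, from inside `V`). -/
noncomputable def dirDeriv (V : Set E3) (u : E3 → ℂ) (ν : E3) (x : E3) : ℂ :=
  fderivWithin ℝ u (closure V) x ν

/-- The complex conjugate of a field. -/
noncomputable def conjField (u : E3 → ℂ) : E3 → ℂ := fun x => starRingEnd ℂ (u x)

/-- The spherical Hankel function of the first kind and order zero, `h₀(z) = e^{iz} / (iz)`. -/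
noncomputable def sphericalHankelZero (z : ℂ) : ℂ := Complex.exp (Complex.I * z) / (Complex.I * z)

/-- The Sommerfeld radiation condition `r (∂u/∂r - iκu) → 0` as `r = |x| → ∞`, uniformly in all
directions. -/
def SommerfeldRadiation (κ : ℂ) (u : E3 → ℂ) : Prop :=
  Tendsto (fun x : E3 => (‖x‖ : ℂ) * (fderiv ℝ u x (‖x‖⁻¹ • x) - Complex.I * κ * u x))
    (Bornology.cobounded E3) (𝓝 0)

/-- The function `g` of directions is the far-field pattern of `u`:
`u(x) = g(x/|x|) h₀(κ|x|) + O(|x|⁻²)` as `|x| → ∞`. -/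
def IsFarFieldPattern (κ : ℂ) (u g : E3 → ℂ) : Prop :=
  (fun x : E3 => u x - g (‖x‖⁻¹ • x) * sphericalHankelZero (κ * ‖x‖))
    =O[Bornology.cobounded E3] fun x : E3 => (‖x‖ ^ 2)⁻¹

/-- The far-field pattern of `u` in the direction `θ`, the limit of `u(rθ) / h₀(κr)` as `r → ∞`. -/
noncomputable def farFieldPattern (κ : ℂ) (u : E3 → ℂ) (θ : E3) : ℂ :=
  limUnder atTop fun r : ℝ => u (r • θ) / sphericalHankelZero (κ * r)

/-- The geometry and the materials of a cluster of `N` homogeneous penetrable scatterers in a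
homogeneous lossless medium, together with a point source in one of them. Index `0` stands for the
surrounding medium, the indices `n ≠ 0` for the scatterers. -/
structure Cluster (N : ℕ) where
  /-- angular frequency -/
  ω : ℝ
  /-- mass densities -/
  ρ : Fin (N + 1) → ℝ
  /-- mean compressibilities -/
  γ : Fin (N + 1) → ℝ
  /-- compressional viscosities, responsible for the losses -/
  δ : Fin (N + 1) → ℝ
  /-- the regions: `V 0` is the exterior, the other ones are the scatterers -/
  V : Fin (N + 1) → Set E3
  /-- `ν n` is the unit normal on the boundary of the scatterer `V n`, pointing out of `V n` -/
  ν : Fin (N + 1) → E3 → E3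
  /-- index of the host of the source -/
  h : Fin (N + 1)
  /-- location of the source -/
  a : E3
  /-- strength of the source -/
  A : ℂ
  ω_pos : 0 < ω
  ρ_pos : ∀ n, 0 < ρ n
  γ_pos : ∀ n, 0 < γ n
  δ_nonneg : ∀ n, 0 ≤ δ n
  δ_zero : δ 0 = 0
  isOpen_V : ∀ n ≠ 0, IsOpen (V n)
  isBounded_V : ∀ n ≠ 0, Bornology.IsBounded (V n)
  disjoint_V : ∀ j ≠ 0, ∀ n ≠ 0, j ≠ n → Disjoint (closure (V j)) (closure (V n))
  normal_V : ∀ n ≠ 0, HasOutwardUnitNormal (V n) (ν n)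
  V_zero : V 0 = (closure (⋃ n ∈ {n : Fin (N + 1) | n ≠ 0}, V n))ᶜ
  h_ne_zero : h ≠ 0
  a_mem : a ∈ V h

namespace Cluster

variable {N : ℕ} (C : Cluster N)

/-- `β_n = ρ_n (1 + iν_n) / (1 + ν_n²)` with `ν_n = ω γ_n δ_n`; in particular `β_0 = ρ_0`. -/
noncomputable def β (n : Fin (N + 1)) : ℂ :=
  C.ρ n * (1 + Complex.I * (C.ω * C.γ n * C.δ n : ℝ)) / (1 + (C.ω * C.γ n * C.δ n : ℝ) ^ 2)

/-- The wavenumber `k_n = ω √(γ_n β_n)`. As `γ_n β_n` lies in the closed first quadrant, so does its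
principal square root; in particular `Im k_n ≥ 0`. -/
noncomputable def k (n : Fin (N + 1)) : ℂ := C.ω * Complex.sqrt (C.γ n * C.β n)

/-- The impedance `ζ_0 = √(ρ_0 / γ_0)` of the surrounding medium. -/
noncomputable def ζ₀ : ℝ := Real.sqrt (C.ρ 0 / C.γ 0)

/-- The primary field of the point source, `A exp(i k_h |x - a|) / |x - a|`. -/
noncomputable def uPrimary (x : E3) : ℂ :=
  C.A * Complex.exp (Complex.I * C.k C.h * ‖x - C.a‖) / ‖x - C.a‖

/-- The singular set of the fields in the region `V n`: the source point if `n = h`, else empty. -/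
def singularSet (n : Fin (N + 1)) : Set E3 := {x | n = C.h ∧ x = C.a}

end Cluster

/-- The time-harmonic acoustic fields in a cluster that is excited by the point source, decomposed
into single-scatterer fields `u j n`: the contribution of the `j`-th scatterer to the field in the
region `V n`. The overall field in `V n` is `∑ j, u j n`. -/
structure ClusterFields {N : ℕ} (C : Cluster N) where
  /-- single-scatterer fields -/
  u : Fin N → Fin (N + 1) → E3 → ℂ
  /-- secondary part of the overall field in the host -/
  uSecondary : E3 → ℂ
  helmholtz : ∀ j n, IsHelmholtzSolution (C.k n) (u j n) (C.V n \ C.singularSet n)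
  contDiffOn_closure : ∀ j n, ContDiffOn ℝ 1 (u j n) (closure (C.V n) \ C.singularSet n)
  transmission : ∀ j, ∀ n ≠ 0, ∀ x ∈ frontier (C.V n), u j 0 x = u j n x
  transmission_deriv : ∀ j, ∀ n ≠ 0, ∀ x ∈ frontier (C.V n),
    C.β n / C.ρ 0 * dirDeriv (C.V 0) (u j 0) (C.ν n x) x
      = dirDeriv (C.V n) (u j n) (C.ν n x) x
  radiation : ∀ j, SommerfeldRadiation (C.k 0) (u j 0)
  helmholtz_secondary : IsHelmholtzSolution (C.k C.h) uSecondary (C.V C.h)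
  host_decomposition : ∀ x ∈ C.V C.h \ {C.a}, ∑ j, u j C.h x = C.uPrimary x + uSecondary x

namespace ClusterFields

variable {N : ℕ} {C : Cluster N} (F : ClusterFields C)

/-- The pairs `k < m`: every pair of different scatterers once. -/
def pairs (N : ℕ) : Finset (Fin N × Fin N) := Finset.univ.filter fun p => p.1 < p.2

/-- The far-field pattern of the `j`-th single-scatterer field. -/
noncomputable def g (j : Fin N) : E3 → ℂ := farFieldPattern (C.k 0) (F.u j 0)

/-- The cluster interaction cross section
`σ_c = k_0⁻² ∑_{k ≠ m} ∫_{S²} g_k conj(g_m) ds` (sum over all ordered pairs `k ≠ m`). -/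
noncomputable def σc : ℂ :=
  1 / C.k 0 ^ 2 * ∑ p : Fin N × Fin N with p.1 ≠ p.2,
    ∫ θ : Metric.sphere (0 : E3) 1, F.g p.1 θ * starRingEnd ℂ (F.g p.2 θ)
      ∂(volume : Measure E3).toSphere

/-- The `i`-th component of the interaction intensity in `V n`,
`I_R = i / (ω conj(β_n)) ∑_{pairs} (u_k ∇conj(u_m) + u_m ∇conj(u_k))`. -/
noncomputable def interactionIntensity (n : Fin (N + 1)) (x : E3) (i : Fin 3) : ℂ :=
  Complex.I / (C.ω * starRingEnd ℂ (C.β n)) * ∑ p ∈ pairs N,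
    (F.u p.1 n x * partialDeriv (C.V n) (conjField (F.u p.2 n)) i x
      + F.u p.2 n x * partialDeriv (C.V n) (conjField (F.u p.1 n)) i x)

/-- The normal component `ν · I_R` on the boundary of the scatterer `V n`. -/
noncomputable def normalInteractionIntensity (n : Fin (N + 1)) (x : E3) : ℂ :=
  ∑ i, (C.ν n x i : ℂ) * F.interactionIntensity n x i

/-- The flux of the interaction intensity `I_R` out of the scatterer `V n`. The surface measure is
the two-dimensional Hausdorff measure, normalized to be the area on planes. -/
noncomputable def interactionFlux (n : Fin (N + 1)) : ℂ :=
  ∫ x in frontier (C.V n), F.normalInteractionIntensity n x ∂(μHE[2] : Measure E3)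

/-- The interaction potential energy density
`U_R = γ_n/2 ∑_{pairs} (u_k conj(u_m) + u_m conj(u_k))` in `V n`. -/
noncomputable def interactionPotential (n : Fin (N + 1)) (x : E3) : ℂ :=
  C.γ n / 2 * ∑ p ∈ pairs N,
    (F.u p.1 n x * starRingEnd ℂ (F.u p.2 n x) + F.u p.2 n x * starRingEnd ℂ (F.u p.1 n x))

/-- The interaction kinetic energy density
`K_R = ρ_n/(2ω²|β_n|²) ∑_{pairs} (∇u_k · ∇conj(u_m) + ∇u_m · ∇conj(u_k))` in `V n`. -/
noncomputable def interactionKinetic (n : Fin (N + 1)) (x : E3) : ℂ :=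
  C.ρ n / (2 * C.ω ^ 2 * ‖C.β n‖ ^ 2) * ∑ p ∈ pairs N, ∑ i,
    (partialDeriv (C.V n) (F.u p.1 n) i x * partialDeriv (C.V n) (conjField (F.u p.2 n)) i x
      + partialDeriv (C.V n) (F.u p.2 n) i x * partialDeriv (C.V n) (conjField (F.u p.1 n)) i x)

/-- The interaction Lagrangian density `L_R = K_R - U_R` in `V n`. -/
noncomputable def interactionLagrangian (n : Fin (N + 1)) (x : E3) : ℂ :=
  F.interactionKinetic n x - F.interactionPotential n x

end ClusterFields

/-!
Each field `u j n` solves a Helmholtz equation, so the vector field `u ∇v̄` built from two of them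
has divergence `∇u · ∇v̄ - κ̄² u v̄`. Divided by `β̄_n` and symmetrized over the pairs, this
density is `2ω²` times `L + (β_n/ρ_n - 1) K`, the interaction Lagrangian density plus a loss term.
Green's identity, in every scatterer except the host and in the exterior region, turns its
integrals into fluxes through the surfaces; by the transmission conditions the normal flux is
continuous across each surface, so that in the sum over all the regions only the flux out of the
host and the flux at infinity survive (`ClusterFields.balance`). As `K`, `L` and the cross section
are real, the real and the imaginary part of this complex energy balance are the two identities of
the theorem.

Two analytic facts carry the argument.

The divergence theorem for a region with `C¹` boundary and its Hausdorff surface measure, for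
fields that are only continuous up to the boundary (`HasOutwardUnitNormal.divergence_theorem`).
Near a boundary point the region is almost a half-space. Integrals over the lines parallel to the
normal compare the volume integral of a derivative with the integral over the boundary, with an
error that is controlled by the oscillation of the normal; a fine partition of unity makes this
error vanish. Fields that are not smooth up to the boundary are handled by shifting them along the
normal.

The asymptotics of radiating solutions (`SommerfeldRadiation.exists_asymptotics`). Green's formula
with smooth cutoffs, together with the radiation condition, represents a solution, modified near
the scatterers, as the volume potential of a compactly supported density (`representation`).
Expanding the kernel gives the far-field pattern, the radial derivative `(ik - 1/r) u` up to
`O(r⁻³)` and tangential derivatives of order `r⁻²`. Hence `∇u · ∇v̄ - k² u v̄ = O(r⁻⁴)`, which is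
why the Lagrangian density is integrable in the exterior region although the kinetic and potential
energy densities need not be, and the flux through large spheres tends to the integral of the
far-field patterns over the unit sphere.
-/

/-! ### Local flatness of a `C¹` domain -/

section Flat

open Metric InnerProductSpace

/-- On the ball `B(x₀, δ)` the set `V` is a sublevel set `{φ < 0}` of a function that differs from
the linear function `⟪ν x₀, ·⟫` by a Lipschitz function with constant `ε < 1`, and the normal `ν`
varies by at most `ε` on the frontier. -/
structure IsFlatAt (V : Set E3) (ν : E3 → E3) (x₀ : E3) (ε δ : ℝ) (φ : E3 → ℝ) : Prop where
  pos : 0 < δ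
  eps_lt : ε < 1
  norm_normal : ‖ν x₀‖ = 1
  cone : ∀ y ∈ ball x₀ δ, ∀ z ∈ ball x₀ δ, |φ y - φ z - ⟪ν x₀, y - z⟫_ℝ| ≤ ε * ‖y - z‖
  mem_iff : ∀ y ∈ ball x₀ δ, (y ∈ V ↔ φ y < 0)
  normal_close : ∀ y ∈ ball x₀ δ, y ∈ frontier V → ‖ν y - ν x₀‖ ≤ ε

lemma IsFlatAt.eps_nonneg {V ν x₀ ε δ φ} (h : IsFlatAt V ν x₀ ε δ φ) : 0 ≤ ε := by
  have h0 : ν x₀ ≠ 0 := by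
    intro h0
    have := h.norm_normal
    rw [h0, norm_zero] at this
    exact zero_ne_one this
  have hd := h.pos
  have hz : x₀ + (δ / 2) • ν x₀ ∈ ball x₀ δ := by
    rw [mem_ball, dist_eq_norm, add_sub_cancel_left, norm_smul, h.norm_normal, Real.norm_eq_abs,
      abs_of_pos (by positivity)]
    linarith
  have := (abs_nonneg _).trans (h.cone _ hz _ (mem_ball_self hd))
  rw [add_sub_cancel_left, norm_smul, h.norm_normal, Real.norm_eq_abs,
      abs_of_pos (by positivity)] at this
  nlinarith

lemma IsFlatAt.continuousOn {V ν x₀ ε δ φ} (h : IsFlatAt V ν x₀ ε δ φ) :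
    ContinuousOn φ (ball x₀ δ) := by
  have hL : LipschitzOnWith 2 φ (ball x₀ δ) := by
    refine LipschitzOnWith.of_dist_le_mul fun y hy z hz => ?_
    have h1 := h.cone y hy z hz
    have h2 := abs_real_inner_le_norm (ν x₀) (y - z)
    rw [h.norm_normal, one_mul] at h2
    rw [Real.dist_eq, dist_eq_norm]
    have h3 := h.eps_lt
    have h4 := norm_nonneg (y - z)
    push_cast
    rw [abs_le] at *
    constructor <;> nlinarith
  exact hL.continuousOn

/-- Moving from a point of the ball in a direction that makes an acute enough angle with the normal
increases the defining function. -/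
lemma IsFlatAt.lt_of_inner {V ν x₀ ε δ φ} (h : IsFlatAt V ν x₀ ε δ φ) {y z : E3}
    (hy : y ∈ ball x₀ δ) (hz : z ∈ ball x₀ δ) (hyz : ε * ‖z - y‖ < ⟪ν x₀, z - y⟫_ℝ) :
    φ y < φ z := by
  have := (abs_le.1 (h.cone z hz y hy)).1
  linarith

lemma IsFlatAt.sub_smul_mem {V ν x₀ ε δ φ} (h : IsFlatAt V ν x₀ ε δ φ) {y : E3} {t : ℝ}
    (ht : 0 < t) (hy : y ∈ ball x₀ δ) (hyt : y - t • ν x₀ ∈ ball x₀ δ) (hφ : φ y ≤ 0) :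
    y - t • ν x₀ ∈ V := by
  rw [h.mem_iff _ hyt]
  refine (h.lt_of_inner hyt hy ?_).trans_le hφ
  rw [sub_sub_cancel, norm_smul, inner_smul_right, real_inner_self_eq_norm_sq, h.norm_normal,
    Real.norm_eq_abs, abs_of_pos ht]
  have := h.eps_lt
  nlinarith

lemma IsFlatAt.closure_iff {V ν x₀ ε δ φ} (h : IsFlatAt V ν x₀ ε δ φ)
    {y : E3} (hy : y ∈ ball x₀ δ) : y ∈ closure V ↔ φ y ≤ 0 := by
  have hB := isOpen_ball.mem_nhds hy
  constructor
  · intro hyV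
    by_contra! hpos
    have h1 : ∀ᶠ z in 𝓝 y, 0 < φ z :=
      (h.continuousOn.continuousAt hB).eventually (lt_mem_nhds hpos)
    obtain ⟨z, ⟨hz1, hz2⟩, hz3⟩ :=
      mem_closure_iff_nhds.1 hyV _ (Filter.inter_mem h1 hB)
    have := (h.mem_iff z hz2).1 hz3
    simp only [Set.mem_ofPred_eq] at hz1
    linarith
  · intro hφ
    have hlim : Tendsto (fun t : ℝ => y - t • ν x₀) (𝓝[>] 0) (𝓝 y) := by
      have : Continuous fun t : ℝ => y - t • ν x₀ := by fun_prop
      simpa using (this.tendsto 0).mono_left nhdsWithin_le_nhds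
    refine mem_closure_of_tendsto hlim ?_
    filter_upwards [hlim hB, self_mem_nhdsWithin] with t ht1 ht2
    exact h.sub_smul_mem ht2 hy ht1 hφ

lemma IsFlatAt.frontier_iff {V ν x₀ ε δ φ} (h : IsFlatAt V ν x₀ ε δ φ) (hV : IsOpen V)
    {y : E3} (hy : y ∈ ball x₀ δ) : y ∈ frontier V ↔ φ y = 0 := by
  rw [hV.frontier_eq, Set.mem_sdiff, h.closure_iff hy, h.mem_iff y hy]
  constructor
  · rintro ⟨h1, h2⟩; linarith
  · intro h0; constructor <;> linarith

lemma HasOutwardUnitNormal.norm_eq_one {V : Set E3} {ν : E3 → E3} (h : HasOutwardUnitNormal V ν)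
    {x : E3} (hx : x ∈ frontier V) : ‖ν x‖ = 1 := by
  obtain ⟨U, φ, -, hxU, -, hφ0, -, hν⟩ := h x hx
  rw [hν x ⟨hx, hxU⟩, norm_smul, norm_inv, norm_norm, inv_mul_cancel₀]
  exact norm_ne_zero_iff.2 (hφ0 x hxU)

lemma HasOutwardUnitNormal.continuousOn {V : Set E3} {ν : E3 → E3}
    (h : HasOutwardUnitNormal V ν) : ContinuousOn ν (frontier V) := by
  intro x hx
  obtain ⟨U, φ, hU, hxU, hφ, hφ0, -, hν⟩ := h x hx
  have hc : ContinuousOn (fun y => gradient φ y) U := by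
    have h1 := hφ.continuousOn_fderiv_of_isOpen hU le_rfl
    exact (InnerProductSpace.toDual ℝ E3).symm.continuous.comp_continuousOn h1
  have h2 : ContinuousAt (fun y => ‖gradient φ y‖⁻¹ • gradient φ y) x := by
    have h3 := hc.continuousAt (hU.mem_nhds hxU)
    exact (h3.norm.inv₀ (norm_ne_zero_iff.2 (hφ0 x hxU))).smul h3
  refine (h2.continuousWithinAt (s := frontier V)).congr_of_eventuallyEq ?_ (hν x ⟨hx, hxU⟩)
  filter_upwards [self_mem_nhdsWithin, mem_nhdsWithin_of_mem_nhds (hU.mem_nhds hxU)] with y hy1 hy2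
  exact hν y ⟨hy1, hy2⟩

lemma HasOutwardUnitNormal.exists_isFlatAt {V : Set E3} {ν : E3 → E3}
    (h : HasOutwardUnitNormal V ν) {x₀ : E3} (hx₀ : x₀ ∈ frontier V) {ε : ℝ} (hε : 0 < ε)
    (hε1 : ε < 1) : ∃ δ φ, IsFlatAt V ν x₀ ε δ φ := by
  obtain ⟨U, φ, hU, hxU, hφ, hφ0, hVU, hν⟩ := h x₀ hx₀
  set c := ‖gradient φ x₀‖ with hc
  have hcpos : 0 < c := norm_pos_iff.2 (hφ0 x₀ hxU)
  have hstrict : HasStrictFDerivAt φ (fderiv ℝ φ x₀) x₀ :=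
    (hφ.contDiffAt (hU.mem_nhds hxU)).hasStrictFDerivAt one_ne_zero
  have hin : ∀ v, fderiv ℝ φ x₀ v = c * ⟪ν x₀, v⟫_ℝ := by
    intro v
    rw [hν x₀ ⟨hx₀, hxU⟩, inner_smul_left, ← hc]
    simp only [conj_trivial]
    rw [mul_inv_cancel_left₀ hcpos.ne', gradient, InnerProductSpace.toDual_symm_apply]
  have h1 := hstrict.isLittleO.def (c := c * ε) (by positivity)
  have h2 : ∀ᶠ y in 𝓝 x₀, y ∈ frontier V → ‖ν y - ν x₀‖ ≤ ε := by
    have := (h.continuousOn x₀ hx₀)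
    have h3 := this.eventually (closedBall_mem_nhds _ hε)
    rw [eventually_nhdsWithin_iff] at h3
    filter_upwards [h3] with y hy hyV
    simpa [dist_eq_norm] using hy hyV
  rw [nhds_prod_eq] at h1
  obtain ⟨s, hs, hs2⟩ := Filter.eventually_prod_self_iff'.1 h1
  obtain ⟨δ, hδ, hδs⟩ := Metric.mem_nhds_iff.1
    (Filter.inter_mem (Filter.inter_mem hs h2) (hU.mem_nhds hxU))
  refine ⟨δ, fun y => c⁻¹ * φ y, hδ, hε1, h.norm_eq_one hx₀, ?_, ?_, ?_⟩
  · intro y hy z hz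
    have h4 := hs2 y (hδs hy).1.1 z (hδs hz).1.1
    simp only [Real.norm_eq_abs, hin] at h4
    have h5 : c⁻¹ * φ y - c⁻¹ * φ z - ⟪ν x₀, y - z⟫_ℝ
        = c⁻¹ * (φ y - φ z - c * ⟪ν x₀, y - z⟫_ℝ) := by
      field_simp
    rw [h5, abs_mul, abs_of_pos (inv_pos.2 hcpos), inv_mul_le_iff₀ hcpos, ← mul_assoc]
    exact h4
  · intro y hy
    have : y ∈ V ∩ U ↔ y ∈ {y ∈ U | φ y < 0} := by rw [hVU]
    have hyU := (hδs hy).2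
    simp only [Set.mem_inter_iff, hyU, and_true, Set.mem_ofPred_eq, true_and] at this
    rw [this]
    constructor
    · intro h; exact mul_neg_of_pos_of_neg (inv_pos.2 hcpos) h
    · intro h; by_contra! h'; have := mul_nonneg (inv_pos.2 hcpos).le h'; linarith
  · intro y hy
    exact (hδs hy).1.2

end Flat

/-! ### Integration along lines that cross the boundary -/

section Lines

open Metric InnerProductSpace

/-- The fundamental theorem of calculus on the part `{ψ < 0}` of a line: it picks up the value of
the function at the point where the increasing function `ψ` changes its sign. -/
lemma integral_indicator_deriv_eq_of_zero {f ψ : ℝ → ℝ} {I A : Set ℝ} (hf : ContDiff ℝ 1 f)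
    (hc : HasCompactSupport f) (hψ : StrictMonoOn ψ I) (hA : ∀ t ∈ I, (t ∈ A ↔ ψ t < 0))
    (hf' : ∀ t ∉ I, deriv f t = 0) {t₀ : ℝ} (ht₀ : t₀ ∈ I) (h0 : ψ t₀ = 0) :
    ∫ t, A.indicator (deriv f) t = f t₀ := by
  have h1 : A.indicator (deriv f) = (Set.Iio t₀).indicator (deriv f) := by
    funext t
    by_cases ht : t ∈ I
    · have : t ∈ A ↔ t ∈ Set.Iio t₀ := by
        rw [hA t ht, ← h0, hψ.lt_iff_lt ht ht₀, Set.mem_Iio]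
      by_cases htA : t ∈ A
      · rw [Set.indicator_of_mem htA, Set.indicator_of_mem (this.1 htA)]
      · rw [Set.indicator_of_notMem htA, Set.indicator_of_notMem (mt this.2 htA)]
    · simp [Set.indicator, hf' t ht]
  rw [h1, integral_indicator measurableSet_Iio, ← integral_Iic_eq_integral_Iio,
    hc.integral_Iic_deriv_eq hf]

lemma integral_indicator_deriv_eq_zero {f ψ : ℝ → ℝ} {I A : Set ℝ} (hf : ContDiff ℝ 1 f)
    (hc : HasCompactSupport f) (hI : IsPreconnected I) (hψ : ContinuousOn ψ I)
    (hA : ∀ t ∈ I, (t ∈ A ↔ ψ t < 0)) (hf' : ∀ t ∉ I, deriv f t = 0)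
    (h0 : ∀ t ∈ I, ψ t ≠ 0) : ∫ t, A.indicator (deriv f) t = 0 := by
  by_cases hneg : ∃ s ∈ I, ψ s < 0
  · obtain ⟨s, hs, hs0⟩ := hneg
    have h1 : A.indicator (deriv f) = deriv f := by
      funext t
      by_cases ht : t ∈ I
      · have : t ∈ A := by
          rw [hA t ht]
          by_contra! hpos
          obtain ⟨r, hr, hr0⟩ := hI.intermediate_value hs ht hψ ⟨hs0.le, hpos⟩
          exact h0 r hr hr0
        simp [this]
      · simp [Set.indicator, hf' t ht]
    rw [h1]
    have hd : Differentiable ℝ f := hf.differentiable one_ne_zero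
    refine integral_eq_zero_of_hasDerivAt_of_integrable (fun x => (hd x).hasDerivAt) ?_
      (hf.continuous.integrable_of_hasCompactSupport hc)
    exact (hf.continuous_deriv le_rfl).integrable_of_hasCompactSupport hc.deriv
  · have h1 : A.indicator (deriv f) = fun _ => 0 := by
      funext t
      by_cases ht : t ∈ I
      · have : t ∉ A := by
          rw [hA t ht]
          exact fun h => hneg ⟨t, ht, h⟩
        simp [this]
      · simp [Set.indicator, hf' t ht]
    rw [h1, integral_zero]

/-- The decomposition of space into lines parallel to the unit vector `e`. -/
lemma measurePreserving_lines {e : E3} (he : ‖e‖ = 1) :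
    MeasurePreserving (fun q : (ℝ ∙ e)ᗮ × ℝ => (q.1 : E3) + q.2 • e)
      (volume.prod volume) volume := by
  have h1 := ((ℝ ∙ e).measurePreserving_measurableEquivProd (0 : E3)).symm
  rw [InnerProductSpace.euclideanHausdorffMeasure_eq_volume] at h1
  have h2 := (LinearIsometryEquiv.toSpanUnitSingleton (𝕜 := ℝ) e he).measurePreserving
  have h3 := (h2.prod (MeasurePreserving.id (volume : Measure (ℝ ∙ e)ᗮ)))
  have h4 := (h1.comp h3).comp
    (Measure.measurePreserving_swap (μ := (volume : Measure (ℝ ∙ e)ᗮ)) (ν := (volume : Measure ℝ)))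
  have h5 : (fun q : (ℝ ∙ e)ᗮ × ℝ => (q.1 : E3) + q.2 • e) =
      ((⇑((ℝ ∙ e).measurableEquivProd (0 : E3)).symm ∘
        Prod.map (⇑(LinearIsometryEquiv.toSpanUnitSingleton (𝕜 := ℝ) e he)) id) ∘ Prod.swap) := by
    funext q
    simp [add_comm]
  rw [h5]
  exact h4

lemma measurableEmbedding_lines {e : E3} (he : ‖e‖ = 1) :
    MeasurableEmbedding (fun q : (ℝ ∙ e)ᗮ × ℝ => (q.1 : E3) + q.2 • e) := by
  refine Continuous.measurableEmbedding (by fun_prop) ?_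
  rintro ⟨x, s⟩ ⟨y, t⟩ hxy
  simp only at hxy
  have hx := Submodule.mem_orthogonal_singleton_iff_inner_right.1 x.2
  have hy := Submodule.mem_orthogonal_singleton_iff_inner_right.1 y.2
  have h1 := congrArg (fun z => ⟪e, z⟫_ℝ) hxy
  simp only [inner_add_right, inner_smul_right, hx, hy, real_inner_self_eq_norm_sq, he] at h1
  have hst : s = t := by linarith
  subst hst
  simpa using hxy

/-- The integral of `∂F/∂e` over the part of the line `x + ℝe` inside `V`. -/
noncomputable def lineIntegral (V : Set E3) (F : E3 → ℝ) (e x : E3) : ℝ :=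
  ∫ t : ℝ, V.indicator (fun y => fderiv ℝ F y e) (x + t • e)

lemma integrable_fderiv_apply {F : E3 → ℝ} (hF : ContDiff ℝ 1 F) (hc : HasCompactSupport F)
    (e : E3) : Integrable (fun y => fderiv ℝ F y e) :=
  ((hF.continuous_fderiv one_ne_zero).clm_apply continuous_const).integrable_of_hasCompactSupport
    (hc.fderiv_apply (𝕜 := ℝ) e)

lemma integrable_lineIntegral {V : Set E3} (hV : IsOpen V) {F : E3 → ℝ} (hF : ContDiff ℝ 1 F)
    (hc : HasCompactSupport F) {e : E3} (he : ‖e‖ = 1) :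
    Integrable (fun x : (ℝ ∙ e)ᗮ => lineIntegral V F e x) := by
  have h1 : Integrable (V.indicator (fun y => fderiv ℝ F y e)) :=
    (integrable_fderiv_apply hF hc e).indicator hV.measurableSet
  exact ((measurePreserving_lines he).integrable_comp_emb
    (measurableEmbedding_lines he)).2 h1 |>.integral_prod_left

lemma integral_lineIntegral {V : Set E3} (hV : IsOpen V) {F : E3 → ℝ} (hF : ContDiff ℝ 1 F)
    (hc : HasCompactSupport F) {e : E3} (he : ‖e‖ = 1) :
    ∫ y in V, fderiv ℝ F y e = ∫ x : (ℝ ∙ e)ᗮ, lineIntegral V F e x := by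
  have h1 : Integrable (V.indicator (fun y => fderiv ℝ F y e)) :=
    (integrable_fderiv_apply hF hc e).indicator hV.measurableSet
  have h2 := ((measurePreserving_lines he).integrable_comp_emb
    (measurableEmbedding_lines he)).2 h1
  rw [← integral_indicator hV.measurableSet, ← (measurePreserving_lines he).integral_comp
    (measurableEmbedding_lines he)]
  exact integral_prod _ h2

section

variable {V : Set E3} {ν : E3 → E3} {x₀ : E3} {ε δ : ℝ} {φ : E3 → ℝ}

lemma IsFlatAt.line_aux (h : IsFlatAt V ν x₀ ε δ φ) {e : E3} (he : ‖e‖ = 1)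
    (heν : ε < ⟪ν x₀, e⟫_ℝ) (x : E3) :
    StrictMonoOn (fun t : ℝ => φ (x + t • e)) {t | x + t • e ∈ ball x₀ δ} := by
  intro s hs t ht hst
  refine h.lt_of_inner hs ht ?_
  rw [add_sub_add_left_eq_sub, ← sub_smul, norm_smul, he, inner_smul_right, Real.norm_eq_abs,
    abs_of_pos (by linarith)]
  have : 0 < t - s := by linarith
  nlinarith

lemma contDiff_line {F : E3 → ℝ} (hF : ContDiff ℝ 1 F) (e x : E3) :
    ContDiff ℝ 1 (fun t : ℝ => F (x + t • e)) := by fun_prop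

lemma deriv_line {F : E3 → ℝ} (hF : ContDiff ℝ 1 F) (e x : E3) (t : ℝ) :
    deriv (fun t : ℝ => F (x + t • e)) t = fderiv ℝ F (x + t • e) e := by
  have h1 : HasDerivAt (fun t : ℝ => x + t • e) e t := by
    simpa using ((hasDerivAt_id t).smul_const e).const_add x
  exact ((hF.differentiable one_ne_zero _).hasFDerivAt.comp_hasDerivAt t h1).deriv

lemma hasCompactSupport_line {F : E3 → ℝ} (hc : HasCompactSupport F) {e : E3} (he : ‖e‖ = 1)
    (x : E3) : HasCompactSupport (fun t : ℝ => F (x + t • e)) := by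
  have hiso : Isometry fun t : ℝ => x + t • e := by
    refine Isometry.of_dist_eq fun s t => ?_
    rw [dist_add_left, dist_eq_norm, ← sub_smul, norm_smul, he, mul_one, dist_eq_norm]
  exact hc.comp_isClosedEmbedding hiso.isClosedEmbedding

lemma fderiv_eq_zero_of_notMem {F : E3 → ℝ} {B : Set E3} (hFB : tsupport F ⊆ B) {y : E3}
    (hy : y ∉ B) : fderiv ℝ F y = 0 :=
  image_eq_zero_of_notMem_tsupport fun h => hy (hFB (tsupport_fderiv_subset ℝ h))

lemma lineIntegral_eq (V : Set E3) {F : E3 → ℝ} (hF : ContDiff ℝ 1 F) (e x : E3) :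
    lineIntegral V F e x = ∫ t, {t : ℝ | x + t • e ∈ V}.indicator
      (deriv fun t : ℝ => F (x + t • e)) t := by
  refine integral_congr_ae (Eventually.of_forall fun t => ?_)
  simp only [Set.indicator, deriv_line hF]
  rfl

lemma IsFlatAt.lineIntegral_of_mem (h : IsFlatAt V ν x₀ ε δ φ) (hV : IsOpen V) {e : E3}
    (he : ‖e‖ = 1) (heν : ε < ⟪ν x₀, e⟫_ℝ) {F : E3 → ℝ} (hF : ContDiff ℝ 1 F)
    (hc : HasCompactSupport F) (hFB : tsupport F ⊆ ball x₀ δ) {x : E3} {t₀ : ℝ}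
    (hy : x + t₀ • e ∈ ball x₀ δ) (hyV : x + t₀ • e ∈ frontier V) :
    lineIntegral V F e x = F (x + t₀ • e) := by
  rw [lineIntegral_eq V hF]
  refine integral_indicator_deriv_eq_of_zero (contDiff_line hF e x) (hasCompactSupport_line hc he x)
    (h.line_aux he heν x) (fun t ht => h.mem_iff _ ht) (fun t ht => ?_) hy
    ((h.frontier_iff hV hy).1 hyV)
  rw [deriv_line hF, fderiv_eq_zero_of_notMem hFB ht, zero_apply]

lemma IsFlatAt.lineIntegral_of_notMem (h : IsFlatAt V ν x₀ ε δ φ) (hV : IsOpen V) {e : E3}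
    (he : ‖e‖ = 1) {F : E3 → ℝ} (hF : ContDiff ℝ 1 F)
    (hc : HasCompactSupport F) (hFB : tsupport F ⊆ ball x₀ δ) {x : E3}
    (hx : ∀ t : ℝ, x + t • e ∈ ball x₀ δ → x + t • e ∉ frontier V) :
    lineIntegral V F e x = 0 := by
  rw [lineIntegral_eq V hF]
  have hcont : Continuous fun t : ℝ => x + t • e := by fun_prop
  have hconv : Convex ℝ {t : ℝ | x + t • e ∈ ball x₀ δ} := by
    intro s hs t ht a b ha hb hab
    have h1 : x + (a • s + b • t) • e = a • (x + s • e) + b • (x + t • e) := by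
      have h2 : x = a • x + b • x := by rw [← add_smul, hab, one_smul]
      nth_rewrite 1 [h2]
      simp only [smul_eq_mul]
      module
    change x + (a • s + b • t) • e ∈ ball x₀ δ
    rw [h1]
    exact convex_ball x₀ δ hs ht ha hb hab
  refine integral_indicator_deriv_eq_zero (contDiff_line hF e x) (hasCompactSupport_line hc he x)
    hconv.isPreconnected (ψ := fun t : ℝ => φ (x + t • e))
    (h.continuousOn.comp hcont.continuousOn fun t ht => ht) (fun t ht => h.mem_iff _ ht)
    (fun t ht => ?_) (fun t ht h0 => hx t ht ((h.frontier_iff hV ht).2 h0))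
  rw [deriv_line hF, fderiv_eq_zero_of_notMem hFB ht, zero_apply]

lemma IsFlatAt.lineIntegral_nonneg (h : IsFlatAt V ν x₀ ε δ φ) (hV : IsOpen V) {e : E3}
    (he : ‖e‖ = 1) (heν : ε < ⟪ν x₀, e⟫_ℝ) {F : E3 → ℝ} (hF : ContDiff ℝ 1 F)
    (hc : HasCompactSupport F) (hFB : tsupport F ⊆ ball x₀ δ) (hF0 : ∀ y, 0 ≤ F y) (x : E3) :
    0 ≤ lineIntegral V F e x := by
  by_cases hx : ∃ t : ℝ, x + t • e ∈ ball x₀ δ ∧ x + t • e ∈ frontier V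
  · obtain ⟨t, ht1, ht2⟩ := hx
    rw [h.lineIntegral_of_mem hV he heν hF hc hFB ht1 ht2]
    exact hF0 _
  · push Not at hx
    rw [h.lineIntegral_of_notMem hV he hF hc hFB hx]

/-- The distributional derivative of the indicator function of `V` is nonpositive in directions
that are close enough to the outward normal. -/
lemma IsFlatAt.integral_fderiv_nonneg (h : IsFlatAt V ν x₀ ε δ φ) (hV : IsOpen V) {e : E3}
    (heν : ε * ‖e‖ < ⟪ν x₀, e⟫_ℝ) {F : E3 → ℝ} (hF : ContDiff ℝ 1 F)
    (hc : HasCompactSupport F) (hFB : tsupport F ⊆ ball x₀ δ) (hF0 : ∀ y, 0 ≤ F y) :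
    0 ≤ ∫ y in V, fderiv ℝ F y e := by
  have he : 0 < ‖e‖ := by
    rw [norm_pos_iff]
    rintro rfl
    simp at heν
  have he1 : ‖‖e‖⁻¹ • e‖ = 1 := norm_smul_inv_norm (𝕜 := ℝ) (norm_pos_iff.1 he)
  have h1 : ∫ y in V, fderiv ℝ F y e = ‖e‖ * ∫ y in V, fderiv ℝ F y (‖e‖⁻¹ • e) := by
    rw [← integral_const_mul]
    congr 1
    funext y
    rw [map_smul, smul_eq_mul, mul_inv_cancel_left₀ he.ne']
  rw [h1, integral_lineIntegral hV hF hc he1]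
  refine mul_nonneg he.le (integral_nonneg fun x => ?_)
  refine h.lineIntegral_nonneg hV he1 ?_ hF hc hFB hF0 x
  rw [inner_smul_right, lt_inv_mul_iff₀ he, mul_comm]
  exact heν

end

end Lines

/-! ### Surface measure of a nearly flat surface -/

section Surface

open Metric InnerProductSpace

lemma LipschitzWith.euclideanHausdorffMeasure_image_le {X Y : Type*} [EMetricSpace X]
    [EMetricSpace Y] [MeasurableSpace X] [BorelSpace X] [MeasurableSpace Y] [BorelSpace Y]
    {f : X → Y} (hf : LipschitzWith 1 f) (d : ℕ) (s : Set X) :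
    (μHE[d] : Measure Y) (f '' s) ≤ (μHE[d] : Measure X) s := by
  have := hf.hausdorffMeasure_image_le (d := d) (Nat.cast_nonneg d) s
  rw [ENNReal.coe_one, ENNReal.one_rpow, one_mul] at this
  rw [Measure.euclideanHausdorffMeasure_def, Measure.euclideanHausdorffMeasure_def,
    Measure.smul_apply, Measure.smul_apply]
  gcongr

lemma euclideanHausdorffMeasure_le_image {X Y : Type*} [MetricSpace X]
    [MetricSpace Y] [MeasurableSpace X] [BorelSpace X] [MeasurableSpace Y] [BorelSpace Y]
    {f : X → Y} {s : Set X} {K : NNReal} (hf : ∀ x ∈ s, ∀ y ∈ s, dist x y ≤ K * dist (f x) (f y))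
    (d : ℕ) : (μHE[d] : Measure X) s ≤ K ^ d * (μHE[d] : Measure Y) (f '' s) := by
  have hanti : AntilipschitzWith K (fun x : s => f x) :=
    AntilipschitzWith.of_le_mul_dist fun x y => hf x x.2 y y.2
  have h1 := hanti.le_hausdorffMeasure_image (d := d) (Nat.cast_nonneg d) Set.univ
  have h2 := (isometry_subtype_coe (s := s)).hausdorffMeasure_image (d := d)
    (Or.inl (Nat.cast_nonneg d)) Set.univ
  have h3 : (fun x : s => f x) '' Set.univ = f '' s := by
    rw [Set.image_univ]
    ext; simp
  rw [Subtype.coe_image_univ] at h2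
  rw [← h2, h3, ENNReal.rpow_natCast] at h1
  rw [Measure.euclideanHausdorffMeasure_def, Measure.euclideanHausdorffMeasure_def,
    Measure.smul_apply, Measure.smul_apply, mul_smul_comm]
  gcongr

variable {V : Set E3} {ν : E3 → E3} {x₀ : E3} {ε δ : ℝ} {φ : E3 → ℝ}

lemma finrank_orthogonal_unit {e : E3} (he : ‖e‖ = 1) : Module.finrank ℝ (ℝ ∙ e)ᗮ = 2 := by
  have : Fact (Module.finrank ℝ E3 = 2 + 1) := ⟨by simp⟩
  exact Submodule.finrank_orthogonal_span_singleton (by rintro rfl; simp at he)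

lemma euclideanHausdorffMeasure_orthogonal {e : E3} (he : ‖e‖ = 1) :
    (μHE[2] : Measure (ℝ ∙ e)ᗮ) = volume := by
  rw [← InnerProductSpace.euclideanHausdorffMeasure_eq_volume, finrank_orthogonal_unit he]

/-- The projection of the frontier to the tangent plane at the base point expands by the factor
`(1 - ε²)^(1/2)` at least. -/
lemma IsFlatAt.dist_le (h : IsFlatAt V ν x₀ ε δ φ) (hV : IsOpen V) {y z : E3}
    (hy : y ∈ frontier V ∩ ball x₀ δ) (hz : z ∈ frontier V ∩ ball x₀ δ) :
    (1 - ε ^ 2) * ‖y - z‖ ^ 2 ≤ ‖(ℝ ∙ ν x₀)ᗮ.orthogonalProjectionOnto (y - z)‖ ^ 2 := by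
  have h1 := h.cone y hy.2 z hz.2
  rw [(h.frontier_iff hV hy.2).1 hy.1, (h.frontier_iff hV hz.2).1 hz.1, sub_zero, zero_sub,
    abs_neg] at h1
  have h2 := Submodule.norm_sq_eq_add_norm_sq_projection (y - z) (ℝ ∙ ν x₀)
  have h3 : ‖(ℝ ∙ ν x₀).orthogonalProjectionOnto (y - z)‖ = |⟪ν x₀, y - z⟫_ℝ| := by
    change ‖((ℝ ∙ ν x₀).orthogonalProjectionOnto (y - z) : E3)‖ = _
    rw [Submodule.coe_orthogonalProjectionOnto_apply,
      Submodule.starProjection_unit_singleton ℝ h.norm_normal, norm_smul, h.norm_normal, mul_one,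
      Real.norm_eq_abs]
  rw [h3] at h2
  have h4 : |⟪ν x₀, y - z⟫_ℝ| ^ 2 ≤ (ε * ‖y - z‖) ^ 2 := by gcongr
  nlinarith

lemma IsFlatAt.measure_le (h : IsFlatAt V ν x₀ ε δ φ) (hV : IsOpen V) {s : Set E3}
    (hs : s ⊆ frontier V ∩ ball x₀ δ) :
    (μHE[2] : Measure E3) s ≤ ENNReal.ofReal (1 - ε ^ 2)⁻¹ *
      volume ((ℝ ∙ ν x₀)ᗮ.orthogonalProjectionOnto '' s) := by
  have hε : 0 < 1 - ε ^ 2 := by nlinarith [h.eps_nonneg, h.eps_lt]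
  have hK : ∀ y ∈ s, ∀ z ∈ s, dist y z ≤ (Real.toNNReal (√(1 - ε ^ 2))⁻¹ : NNReal) *
      dist ((ℝ ∙ ν x₀)ᗮ.orthogonalProjectionOnto y) ((ℝ ∙ ν x₀)ᗮ.orthogonalProjectionOnto z) := by
    intro y hy z hz
    have h1 := h.dist_le hV (hs hy) (hs hz)
    rw [Real.coe_toNNReal _ (by positivity), le_inv_mul_iff₀ (by positivity), dist_eq_norm,
      dist_eq_norm, ← map_sub]
    refine le_of_sq_le_sq ?_ (norm_nonneg _)
    rw [mul_pow, Real.sq_sqrt hε.le]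
    exact h1
  have h2 := euclideanHausdorffMeasure_le_image hK 2
  rw [euclideanHausdorffMeasure_orthogonal h.norm_normal] at h2
  convert h2 using 2
  change _ = ENNReal.ofReal _ ^ 2
  rw [← ENNReal.ofReal_pow (by positivity)]
  congr 1
  rw [inv_pow, Real.sq_sqrt hε.le]

lemma IsFlatAt.le_measure (h : IsFlatAt V ν x₀ ε δ φ) (s : Set E3) :
    volume ((ℝ ∙ ν x₀)ᗮ.orthogonalProjectionOnto '' s) ≤ (μHE[2] : Measure E3) s := by
  rw [← euclideanHausdorffMeasure_orthogonal h.norm_normal]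
  exact (Submodule.lipschitzWith_orthogonalProjectionOnto _).euclideanHausdorffMeasure_image_le 2 s

lemma IsFlatAt.measure_lt_top (h : IsFlatAt V ν x₀ ε δ φ) (hV : IsOpen V) :
    (μHE[2] : Measure E3) (frontier V ∩ ball x₀ δ) < ⊤ := by
  refine (h.measure_le hV subset_rfl).trans_lt (ENNReal.mul_lt_top ENNReal.ofReal_lt_top ?_)
  refine Bornology.IsBounded.measure_lt_top ?_
  exact (ℝ ∙ ν x₀)ᗮ.lipschitzWith_orthogonalProjectionOnto.isBounded_image
    (isBounded_ball.subset Set.inter_subset_right)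

/-- Comparison of the surface integral with the integral of the derivative along the normal at the
base point. -/
lemma IsFlatAt.integral_compare (h : IsFlatAt V ν x₀ ε δ φ) (hV : IsOpen V) {F : E3 → ℝ}
    (hF : ContDiff ℝ 1 F) (hc : HasCompactSupport F) (hFB : tsupport F ⊆ ball x₀ δ)
    (hF0 : ∀ y, 0 ≤ F y) :
    ∫ y in V, fderiv ℝ F y (ν x₀) ≤ ∫ y in frontier V, F y ∂(μHE[2] : Measure E3) ∧
    ∫ y in frontier V, F y ∂(μHE[2] : Measure E3)
      ≤ (1 - ε ^ 2)⁻¹ * ∫ y in V, fderiv ℝ F y (ν x₀) := by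
  have hε : 0 < 1 - ε ^ 2 := by nlinarith [h.eps_nonneg, h.eps_lt]
  have he := h.norm_normal
  have heν : ε < ⟪ν x₀, ν x₀⟫_ℝ := by
    rw [real_inner_self_eq_norm_sq, he]; simpa using h.eps_lt
  set p := (ℝ ∙ ν x₀)ᗮ.orthogonalProjectionOnto with hp
  set S := frontier V ∩ ball x₀ δ with hS
  have hSm : MeasurableSet S := isClosed_frontier.measurableSet.inter measurableSet_ball
  have hpm : Measurable p := p.continuous.measurable
  set m := ((μHE[2] : Measure E3).restrict S).map p with hm
  set G : (ℝ ∙ ν x₀)ᗮ → ℝ := fun x => lineIntegral V F (ν x₀) x with hG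
  have hdecomp : ∀ y : E3, y = (p y : E3) + ⟪ν x₀, y⟫_ℝ • ν x₀ := by
    intro y
    have h1 := (ℝ ∙ ν x₀).starProjection_add_starProjection_orthogonal y
    rw [Submodule.starProjection_unit_singleton ℝ he] at h1
    rw [hp, Submodule.coe_orthogonalProjectionOnto_apply, add_comm]
    exact h1.symm
  have hGp : ∀ y ∈ S, G (p y) = F y := by
    intro y hy
    have hy2 := hdecomp y
    have := h.lineIntegral_of_mem hV he heν hF hc hFB (x := p y) (t₀ := ⟪ν x₀, y⟫_ℝ)
      (by rw [← hy2]; exact hy.2) (by rw [← hy2]; exact hy.1)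
    rw [hG]
    simp only
    rw [this, ← hy2]
  have hG0 : ∀ x ∉ p '' S, G x = 0 := by
    intro x hx
    refine h.lineIntegral_of_notMem hV he hF hc hFB fun t ht htV => hx ⟨x + t • ν x₀, ⟨htV, ht⟩, ?_⟩
    rw [map_add, hp, Submodule.orthogonalProjectionOnto_mem_subspace_eq_self, map_smul,
      Submodule.orthogonalProjectionOnto_orthogonalComplement_singleton_eq_zero, smul_zero, add_zero]
  have hGnn : ∀ x, 0 ≤ G x := fun x => h.lineIntegral_nonneg hV he heν hF hc hFB hF0 x
  have hGint : Integrable G := integrable_lineIntegral hV hF hc he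
  have hm_le : m ≤ ENNReal.ofReal (1 - ε ^ 2)⁻¹ • volume := by
    refine Measure.le_iff.2 fun A hA => ?_
    rw [hm, Measure.map_apply hpm hA, Measure.restrict_apply (hpm hA), Measure.smul_apply]
    refine (h.measure_le hV Set.inter_subset_right).trans ?_
    rw [smul_eq_mul]
    gcongr
    rintro _ ⟨y, hy, rfl⟩
    exact hy.1
  have hle_m : (volume : Measure (ℝ ∙ ν x₀)ᗮ).restrict (p '' S) ≤ m := by
    refine Measure.le_iff.2 fun A hA => ?_
    rw [hm, Measure.map_apply hpm hA, Measure.restrict_apply (hpm hA), Measure.restrict_apply hA]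
    refine le_trans (measure_mono ?_) (h.le_measure _)
    rintro _ ⟨hA, y, hy, rfl⟩
    exact ⟨y, ⟨hA, hy⟩, rfl⟩
  have hGm : Integrable G m := hGint.of_measure_le_smul ENNReal.ofReal_ne_top hm_le
  have hFG : ∫ y in frontier V, F y ∂(μHE[2] : Measure E3) = ∫ x, G x ∂m := by
    rw [hm, integral_map hpm.aemeasurable hGm.aestronglyMeasurable]
    rw [setIntegral_congr_fun hSm hGp]
    refine setIntegral_eq_of_subset_of_forall_sdiff_eq_zero
      (isClosed_frontier (s := V)).measurableSet Set.inter_subset_left fun y hy => ?_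
    refine image_eq_zero_of_notMem_tsupport fun hyF => hy.2 ⟨hy.1, hFB hyF⟩
  have hVG : ∫ y in V, fderiv ℝ F y (ν x₀) = ∫ x, G x := integral_lineIntegral hV hF hc he
  rw [hFG, hVG]
  constructor
  · rw [← setIntegral_eq_integral_of_forall_compl_eq_zero hG0]
    exact integral_mono_measure hle_m (Eventually.of_forall hGnn) hGm
  · refine (integral_mono_measure hm_le (Eventually.of_forall hGnn)
      (hGint.smul_measure ENNReal.ofReal_ne_top)).trans_eq ?_
    rw [integral_smul_measure, ENNReal.toReal_ofReal (by positivity), smul_eq_mul]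

end Surface

/-! ### The divergence theorem for smooth compactly supported fields -/

section SmoothDivergence

open Metric InnerProductSpace
open scoped ContDiff Manifold

lemma exists_finite_smooth_partition {ι : Type} {K : Set E3} (hK : IsCompact K) (U : ι → Set E3)
    (hU : ∀ i, IsOpen (U i)) (hKU : K ⊆ ⋃ i, U i) :
    ∃ (t : Finset ι) (ρ : ι → E3 → ℝ), (∀ i, ContDiff ℝ ∞ (ρ i)) ∧ (∀ i, tsupport (ρ i) ⊆ U i) ∧
      (∀ i y, 0 ≤ ρ i y) ∧ ∀ y ∈ K, ∑ i ∈ t, ρ i y = 1 := by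
  obtain ⟨f, hf⟩ := SmoothPartitionOfUnity.exists_isSubordinate 𝓘(ℝ, E3) hK.isClosed U hU hKU
  have hfin := f.locallyFinite.finite_nonempty_inter_compact hK
  refine ⟨hfin.toFinset, fun i => f i, fun i => (f i).contMDiff.contDiff, hf, f.nonneg,
    fun y hy => ?_⟩
  rw [← f.sum_eq_one hy]
  refine (finsum_eq_sum_of_support_subset _ fun i hi => ?_).symm
  rw [Set.Finite.coe_toFinset]
  exact ⟨y, hi, hy⟩

variable {V : Set E3} {ν : E3 → E3} {x₀ : E3} {ε δ : ℝ} {φ : E3 → ℝ}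

/-- The area of a `C¹` surface is locally finite. -/
lemma HasOutwardUnitNormal.isLocallyFiniteMeasure (h : HasOutwardUnitNormal V ν) (hV : IsOpen V) :
    IsLocallyFiniteMeasure ((μHE[2] : Measure E3).restrict (frontier V)) := by
  refine ⟨fun x => ?_⟩
  by_cases hx : x ∈ frontier V
  · obtain ⟨δ, φ, hflat⟩ := h.exists_isFlatAt hx (ε := 1 / 2) (by norm_num) (by norm_num)
    refine ⟨ball x δ, ball_mem_nhds x hflat.pos, ?_⟩
    rw [Measure.restrict_apply measurableSet_ball, Set.inter_comm]
    exact hflat.measure_lt_top hV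
  · refine ⟨(frontier V)ᶜ, isClosed_frontier.isOpen_compl.mem_nhds hx, ?_⟩
    rw [Measure.restrict_apply isClosed_frontier.measurableSet.compl, Set.compl_inter_self,
      measure_empty]
    exact ENNReal.zero_lt_top

lemma integral_fderiv_linear {F : E3 → ℝ} (hF : ContDiff ℝ 1 F) (hc : HasCompactSupport F)
    (V : Set E3) (a b : ℝ) (v w : E3) :
    ∫ y in V, fderiv ℝ F y (a • v + b • w)
      = a * (∫ y in V, fderiv ℝ F y v) + b * ∫ y in V, fderiv ℝ F y w := by
  rw [← integral_const_mul, ← integral_const_mul, ← integral_add]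
  · simp only [map_add, map_smul, smul_eq_mul]
  · exact ((integrable_fderiv_apply hF hc v).const_mul a).integrableOn
  · exact ((integrable_fderiv_apply hF hc w).const_mul b).integrableOn

lemma HasOutwardUnitNormal.integrable_inner_mul (h : HasOutwardUnitNormal V ν) (hV : IsOpen V)
    {F : E3 → ℝ} (hF : Continuous F) (hc : HasCompactSupport F) (e : E3) :
    IntegrableOn (fun y => ⟪ν y, e⟫_ℝ * F y) (frontier V) (μHE[2] : Measure E3) := by
  have := h.isLocallyFiniteMeasure hV
  have hFint : Integrable F ((μHE[2] : Measure E3).restrict (frontier V)) :=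
    hF.integrable_of_hasCompactSupport hc
  refine hFint.bdd_mul (c := ‖e‖) ?_ ?_
  · exact (h.continuousOn.inner continuousOn_const).aestronglyMeasurable
      isClosed_frontier.measurableSet
  · refine (ae_restrict_mem isClosed_frontier.measurableSet).mono fun y hy => ?_
    refine (norm_inner_le_norm _ _).trans ?_
    rw [h.norm_eq_one hy, one_mul]

/-- Near every boundary point the divergence theorem holds for nonnegative functions up to a small
relative error. The tangential derivatives are controlled by positivity: the derivative of the
indicator function of `V` has a sign in all directions `ν x₀ ± M τ`, where `M` is large. -/
lemma IsFlatAt.divergence_error (hf : IsFlatAt V ν x₀ ε δ φ) (hε0 : 0 < ε) (hε : ε ≤ 1 / 5)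
    (h : HasOutwardUnitNormal V ν) (hV : IsOpen V)
    {F : E3 → ℝ} (hF : ContDiff ℝ 1 F) (hc : HasCompactSupport F)
    (hFB : tsupport F ⊆ ball x₀ δ) (hF0 : ∀ y, 0 ≤ F y) {e : E3} (he : ‖e‖ = 1) :
    |(∫ y in V, fderiv ℝ F y e) - ∫ y in frontier V, ⟪ν y, e⟫_ℝ * F y ∂(μHE[2] : Measure E3)|
      ≤ 4 * ε * ∫ y in frontier V, F y ∂(μHE[2] : Measure E3) := by
  have := h.isLocallyFiniteMeasure hV
  have hFint : Integrable F ((μHE[2] : Measure E3).restrict (frontier V)) :=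
    hF.continuous.integrable_of_hasCompactSupport hc
  set H := ∫ y in frontier V, F y ∂(μHE[2] : Measure E3) with hH
  set D : E3 → ℝ := fun v => ∫ y in V, fderiv ℝ F y v with hD
  have hH0 : 0 ≤ H := integral_nonneg hF0
  set c := ⟪ν x₀, e⟫_ℝ with hcdef
  set τ := e - c • ν x₀ with hτ
  have hn := hf.norm_normal
  have hnn : ⟪ν x₀, ν x₀⟫_ℝ = 1 := by rw [real_inner_self_eq_norm_sq, hn]; norm_num
  have hντ : ⟪ν x₀, τ⟫_ℝ = 0 := by
    rw [hτ, inner_sub_right, inner_smul_right, hnn, ← hcdef]; ring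
  have hc1 : |c| ≤ 1 := by
    have := abs_real_inner_le_norm (ν x₀) e
    rwa [hn, he, one_mul] at this
  have hτ1 : ‖τ‖ ≤ 1 := by
    have h1 : ‖e‖ ^ 2 = c ^ 2 + ‖τ‖ ^ 2 := by
      have h2 : e = c • ν x₀ + τ := by rw [hτ]; abel
      rw [h2, norm_add_sq_real, inner_smul_left, hντ, norm_smul, hn, Real.norm_eq_abs, mul_one,
        sq_abs]
      simp
    rw [he] at h1
    nlinarith [norm_nonneg τ, sq_nonneg c]
  have hcmp := hf.integral_compare hV hF hc hFB hF0
  set d := D (ν x₀) with hd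
  have hd1 : d ≤ H := hcmp.1
  have hε2 : 0 < 1 - ε ^ 2 := by nlinarith
  have hd2 : (1 - ε ^ 2) * H ≤ d := by
    have := hcmp.2
    rwa [le_inv_mul_iff₀ hε2] at this
  have hpos : ∀ s : ℝ, |s| = 1 → 0 ≤ 2 * ε * d + s * D τ := by
    intro s hs
    have h1 : 0 ≤ D ((2 * ε) • ν x₀ + s • τ) := by
      refine hf.integral_fderiv_nonneg hV ?_ hF hc hFB hF0
      rw [inner_add_right, inner_smul_right, inner_smul_right, hντ, hnn]
      have h2 := norm_add_le ((2 * ε) • ν x₀) (s • τ)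
      rw [norm_smul, norm_smul, hn, Real.norm_eq_abs, Real.norm_eq_abs, hs,
        abs_of_pos (by positivity)] at h2
      nlinarith
    rw [hD] at h1
    simp only at h1
    rwa [integral_fderiv_linear hF hc] at h1
  have hp1 := hpos 1 (by norm_num)
  have hp2 := hpos (-1) (by norm_num)
  have hDe : D e = c * d + D τ := by
    have h2 : e = c • ν x₀ + (1 : ℝ) • τ := by rw [hτ]; module
    have h3 := integral_fderiv_linear hF hc V c 1 (ν x₀) τ
    rw [← h2, one_mul] at h3
    exact h3
  have hsurf : |(∫ y in frontier V, ⟪ν y, e⟫_ℝ * F y ∂(μHE[2] : Measure E3)) - c * H| ≤ ε * H := by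
    rw [hH, ← integral_const_mul, ← integral_sub (h.integrable_inner_mul hV hF.continuous hc e)
      (hFint.const_mul c), ← integral_const_mul, ← Real.norm_eq_abs]
    refine (norm_integral_le_integral_norm _).trans ?_
    refine integral_mono_ae (Integrable.norm ?_) (hFint.const_mul ε) ?_
    · exact (h.integrable_inner_mul hV hF.continuous hc e).sub (hFint.const_mul c)
    · refine (ae_restrict_mem isClosed_frontier.measurableSet).mono fun y hy => ?_
      simp only
      rw [← sub_mul, hcdef, ← inner_sub_left, norm_mul, Real.norm_of_nonneg (hF0 y)]
      by_cases hyB : y ∈ ball x₀ δ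
      · refine mul_le_mul_of_nonneg_right ?_ (hF0 y)
        refine (norm_inner_le_norm _ _).trans ?_
        rw [he, mul_one]
        exact hf.normal_close y hyB hy
      · rw [image_eq_zero_of_notMem_tsupport fun hy => hyB (hFB hy)]
        simp
  change |D e - _| ≤ _
  rw [hDe]
  have hcd : |c * d - c * H| ≤ ε ^ 2 * H := by
    rw [← mul_sub, abs_mul, abs_sub_comm, abs_of_nonneg (sub_nonneg.2 hd1)]
    have : H - d ≤ ε ^ 2 * H := by linarith
    nlinarith [abs_nonneg c]
  rw [abs_le] at *
  have h5 : ε * d ≤ ε * H := mul_le_mul_of_nonneg_left hd1 hε0.le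
  have h6 : ε ^ 2 * H ≤ ε * H := by
    refine mul_le_mul_of_nonneg_right ?_ hH0
    nlinarith
  constructor <;> linarith [hsurf.1, hsurf.2, hcd.1, hcd.2]

lemma HasOutwardUnitNormal.exists_divergence_error (h : HasOutwardUnitNormal V ν) (hV : IsOpen V)
    {η : ℝ} (hη : 0 < η) (x₀ : E3) : ∃ U : Set E3, IsOpen U ∧ x₀ ∈ U ∧
      ∀ F : E3 → ℝ, ContDiff ℝ 1 F → HasCompactSupport F → tsupport F ⊆ U → (∀ y, 0 ≤ F y) →
      ∀ e : E3, ‖e‖ = 1 →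
      |(∫ y in V, fderiv ℝ F y e) - ∫ y in frontier V, ⟪ν y, e⟫_ℝ * F y ∂(μHE[2] : Measure E3)|
      ≤ η * ∫ y in frontier V, F y ∂(μHE[2] : Measure E3) := by
  by_cases hx : x₀ ∈ frontier V
  · have hε0 : 0 < min (1 / 5) (η / 4) := by positivity
    obtain ⟨δ, φ, hf⟩ := h.exists_isFlatAt hx hε0
      ((min_le_left _ _).trans_lt (by norm_num))
    refine ⟨ball x₀ δ, isOpen_ball, mem_ball_self hf.pos, fun F hF hc hFB hF0 e he => ?_⟩
    refine (hf.divergence_error hε0 (min_le_left _ _) h hV hF hc hFB hF0 he).trans ?_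
    refine mul_le_mul_of_nonneg_right ?_ (integral_nonneg hF0)
    linarith [min_le_right (1 / 5) (η / 4)]
  · -- away from the frontier both sides vanish
    have hU : ∃ U : Set E3, IsOpen U ∧ x₀ ∈ U ∧ (U ⊆ V ∨ U ⊆ Vᶜ) ∧ Disjoint U (frontier V) := by
      by_cases hxV : x₀ ∈ V
      · refine ⟨V, hV, hxV, Or.inl subset_rfl, ?_⟩
        rw [hV.frontier_eq]
        exact Set.disjoint_sdiff_right
      · refine ⟨(closure V)ᶜ, isClosed_closure.isOpen_compl, ?_,
          Or.inr (Set.compl_subset_compl.2 subset_closure), ?_⟩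
        · intro hcl
          rw [hV.frontier_eq] at hx
          exact hx ⟨hcl, hxV⟩
        · exact Set.disjoint_compl_left_iff_subset.2 frontier_subset_closure
    obtain ⟨U, hUo, hxU, hUV, hUS⟩ := hU
    refine ⟨U, hUo, hxU, fun F hF hc hFU hF0 e he => ?_⟩
    have h1 : ∀ y ∈ frontier V, ⟪ν y, e⟫_ℝ * F y = 0 := fun y hy => by
      rw [image_eq_zero_of_notMem_tsupport fun hyF => Set.disjoint_left.1 hUS (hFU hyF) hy, mul_zero]
    have h2 : ∫ y in V, fderiv ℝ F y e = 0 := by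
      rcases hUV with hUV | hUV
      · rw [setIntegral_eq_integral_of_forall_compl_eq_zero fun y hy => ?_]
        · have := integral_mul_fderiv_eq_neg_fderiv_mul_of_integrable (μ := (volume : Measure E3))
            (f := fun _ => (1 : ℝ)) (g := F) (v := e) (by simp)
            (by simpa using integrable_fderiv_apply hF hc e)
            (by simpa using hF.continuous.integrable_of_hasCompactSupport hc)
            (fun _ _ => differentiableAt_const _)
            (fun y _ => hF.differentiable one_ne_zero y)
          simpa using this
        · rw [fderiv_eq_zero_of_notMem hFU fun hyU => hy (hUV hyU), zero_apply]
      · refine setIntegral_eq_zero_of_forall_eq_zero fun y hy => ?_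
        rw [fderiv_eq_zero_of_notMem hFU fun hyU => hUV hyU hy, zero_apply]
    rw [h2, setIntegral_eq_zero_of_forall_eq_zero h1, sub_self, abs_zero]
    exact mul_nonneg hη.le (integral_nonneg hF0)

lemma HasOutwardUnitNormal.integral_fderiv_of_nonneg (h : HasOutwardUnitNormal V ν) (hV : IsOpen V)
    {F : E3 → ℝ} (hF : ContDiff ℝ 1 F) (hc : HasCompactSupport F) (hF0 : ∀ y, 0 ≤ F y) {e : E3}
    (he : ‖e‖ = 1) :
    ∫ y in V, fderiv ℝ F y e = ∫ y in frontier V, ⟪ν y, e⟫_ℝ * F y ∂(μHE[2] : Measure E3) := by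
  have := h.isLocallyFiniteMeasure hV
  have hFint : Integrable F ((μHE[2] : Measure E3).restrict (frontier V)) :=
    hF.continuous.integrable_of_hasCompactSupport hc
  set H := ∫ y in frontier V, F y ∂(μHE[2] : Measure E3) with hH
  have key : ∀ η : ℝ, 0 < η → |(∫ y in V, fderiv ℝ F y e) -
      ∫ y in frontier V, ⟪ν y, e⟫_ℝ * F y ∂(μHE[2] : Measure E3)| ≤ η * H := by
    intro η hη
    choose U hUo hxU hU using h.exists_divergence_error hV hη
    obtain ⟨t, ρ, hρ, hρU, hρ0, hρ1⟩ := exists_finite_smooth_partition hc U hUo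
      (fun x _ => Set.mem_iUnion.2 ⟨x, hxU x⟩)
    have hG : ∀ i, ContDiff ℝ 1 (fun y => ρ i y * F y) := fun i =>
      ((hρ i).of_le (by exact_mod_cast le_top)).mul hF
    have hGc : ∀ i, HasCompactSupport (fun y => ρ i y * F y) := fun i => hc.mul_left
    have hsum : ∀ y, F y = ∑ i ∈ t, ρ i y * F y := by
      intro y
      by_cases hy : y ∈ tsupport F
      · rw [← Finset.sum_mul, hρ1 y hy, one_mul]
      · simp [image_eq_zero_of_notMem_tsupport hy]
    have hsum' : F = fun y => ∑ i ∈ t, ρ i y * F y := funext hsum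
    have h1 : ∫ y in V, fderiv ℝ F y e
        = ∑ i ∈ t, ∫ y in V, fderiv ℝ (fun y => ρ i y * F y) y e := by
      rw [← integral_finsetSum _ fun i _ =>
        (integrable_fderiv_apply (hG i) (hGc i) e).integrableOn]
      congr 1
      funext y
      conv_lhs => rw [hsum']
      rw [fderiv_fun_sum fun i _ => (hG i).differentiable one_ne_zero y]
      simp
    have h2 : ∫ y in frontier V, ⟪ν y, e⟫_ℝ * F y ∂(μHE[2] : Measure E3)
        = ∑ i ∈ t, ∫ y in frontier V, ⟪ν y, e⟫_ℝ * (ρ i y * F y) ∂(μHE[2] : Measure E3) := by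
      rw [← integral_finsetSum _ fun i _ =>
        h.integrable_inner_mul hV (hG i).continuous (hGc i) e]
      congr 1
      funext y
      rw [← Finset.mul_sum, ← hsum]
    have h3 : H = ∑ i ∈ t, ∫ y in frontier V, ρ i y * F y ∂(μHE[2] : Measure E3) := by
      rw [← integral_finsetSum _ fun i _ =>
        (hG i).continuous.integrable_of_hasCompactSupport (hGc i)]
      exact integral_congr_ae (Eventually.of_forall hsum)
    rw [h1, h2, h3, ← Finset.sum_sub_distrib, Finset.mul_sum]
    refine (Finset.abs_sum_le_sum_abs _ _).trans (Finset.sum_le_sum fun i _ => ?_)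
    exact hU i _ (hG i) (hGc i) ((tsupport_mul_subset_left).trans (hρU i))
      (fun y => mul_nonneg (hρ0 i y) (hF0 y)) e he
  have hle : |(∫ y in V, fderiv ℝ F y e) -
      ∫ y in frontier V, ⟪ν y, e⟫_ℝ * F y ∂(μHE[2] : Measure E3)| ≤ 0 := by
    have hlim : Tendsto (fun η : ℝ => η * H) (𝓝[>] 0) (𝓝 0) := by
      have : Continuous fun η : ℝ => η * H := by fun_prop
      simpa using (this.tendsto 0).mono_left nhdsWithin_le_nhds
    refine ge_of_tendsto hlim ?_
    filter_upwards [self_mem_nhdsWithin] with η hη using key η hη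
  exact sub_eq_zero.1 (abs_nonpos_iff.1 hle)

lemma HasOutwardUnitNormal.integral_fderiv_real (h : HasOutwardUnitNormal V ν) (hV : IsOpen V)
    {F : E3 → ℝ} (hF : ContDiff ℝ 1 F) (hc : HasCompactSupport F) {e : E3} (he : ‖e‖ = 1) :
    ∫ y in V, fderiv ℝ F y e = ∫ y in frontier V, ⟪ν y, e⟫_ℝ * F y ∂(μHE[2] : Measure E3) := by
  obtain ⟨M, hM⟩ := hF.continuous.bounded_above_of_compact_support hc
  obtain ⟨r, hr, hFr⟩ := hc.isBounded.subset_ball_lt 0 0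
  have hM0 : 0 ≤ M := (norm_nonneg _).trans (hM 0)
  let χ : ContDiffBump (0 : E3) := ⟨r, r + 1, hr, by linarith⟩
  have hGs : ContDiff ℝ 1 (fun y => M * χ y) := contDiff_const.mul χ.contDiff
  have hGc : HasCompactSupport (fun y => M * χ y) := χ.hasCompactSupport.mul_left
  have hG0 : ∀ y, 0 ≤ M * χ y := fun y => mul_nonneg hM0 χ.nonneg
  have hFG : ∀ y, 0 ≤ F y + M * χ y := by
    intro y
    by_cases hy : y ∈ tsupport F
    · rw [χ.one_of_mem_closedBall (ball_subset_closedBall (hFr hy)), mul_one]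
      have := neg_le_of_abs_le (hM y)
      linarith
    · rw [image_eq_zero_of_notMem_tsupport hy, zero_add]; exact hG0 y
  have h1 := h.integral_fderiv_of_nonneg hV hGs hGc hG0 he
  have h2 := h.integral_fderiv_of_nonneg hV (hF.add hGs) (hc.add hGc) hFG he
  have h3 : ∀ y, fderiv ℝ (fun y => F y + M * χ y) y e
      = fderiv ℝ F y e + fderiv ℝ (fun y => M * χ y) y e := by
    intro y
    rw [fderiv_fun_add (hF.differentiable one_ne_zero y) (hGs.differentiable one_ne_zero y),
      add_apply]
  simp only [h3] at h2
  rw [integral_add (integrable_fderiv_apply hF hc e).integrableOn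
    (integrable_fderiv_apply hGs hGc e).integrableOn] at h2
  simp only [mul_add] at h2
  rw [integral_add (h.integrable_inner_mul hV hF.continuous hc e)
    (h.integrable_inner_mul hV hGs.continuous hGc e)] at h2
  linarith

end SmoothDivergence

/-! ### The divergence theorem -/

section Divergence

open Metric InnerProductSpace
open scoped ContDiff

/-- The partial derivative `∂u/∂xᵢ`. -/
noncomputable abbrev pderiv (i : Fin 3) (u : E3 → ℂ) (x : E3) : ℂ :=
  fderiv ℝ u x (EuclideanSpace.single i 1)

/-- The divergence of a complex vector field with components `X i`. -/
noncomputable def divField (X : Fin 3 → E3 → ℂ) (x : E3) : ℂ := ∑ i, pderiv i (X i) x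

variable {V : Set E3} {ν : E3 → E3} {x₀ : E3} {ε δ : ℝ} {φ : E3 → ℝ}

/-- The flux density of a complex vector field through a surface with normal `ν`. -/
noncomputable def normalComp (ν : E3 → E3) (X : Fin 3 → E3 → ℂ) (x : E3) : ℂ :=
  ∑ i, (ν x i : ℂ) * X i x

lemma integrable_pderiv {F : E3 → ℂ} (hF : ContDiff ℝ 1 F) (hc : HasCompactSupport F)
    (i : Fin 3) : Integrable (pderiv i F) :=
  ((hF.continuous_fderiv one_ne_zero).clm_apply continuous_const).integrable_of_hasCompactSupport
    (hc.fderiv_apply (𝕜 := ℝ) _)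

lemma HasOutwardUnitNormal.norm_apply_le (h : HasOutwardUnitNormal V ν) {x : E3}
    (hx : x ∈ frontier V) (i : Fin 3) : ‖(ν x i : ℂ)‖ ≤ 1 := by
  rw [Complex.norm_real, ← h.norm_eq_one hx]
  exact PiLp.norm_apply_le (ν x) i

lemma HasOutwardUnitNormal.continuousOn_apply (h : HasOutwardUnitNormal V ν) (i : Fin 3) :
    ContinuousOn (fun x => (ν x i : ℂ)) (frontier V) :=
  Complex.continuous_ofReal.comp_continuousOn
    ((EuclideanSpace.proj (𝕜 := ℝ) i).continuous.comp_continuousOn h.continuousOn)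

/-- A continuous function that vanishes off a compact set is integrable on a `C¹` surface. -/
lemma HasOutwardUnitNormal.integrableOn_frontier (h : HasOutwardUnitNormal V ν) (hV : IsOpen V)
    {F : E3 → ℂ} {K : Set E3} (hK : IsCompact K) (hF : ContinuousOn F (frontier V))
    (hFK : ∀ y ∈ frontier V, y ∉ K → F y = 0) :
    IntegrableOn F (frontier V) (μHE[2] : Measure E3) := by
  have := h.isLocallyFiniteMeasure hV
  have hKS : IsCompact (frontier V ∩ K) := hK.inter_left isClosed_frontier
  have h1 : IntegrableOn F (frontier V ∩ K) ((μHE[2] : Measure E3).restrict (frontier V)) :=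
    (hF.mono Set.inter_subset_left).integrableOn_compact hKS
  rw [IntegrableOn, Measure.restrict_restrict hKS.measurableSet,
    Set.inter_eq_left.2 Set.inter_subset_left] at h1
  refine IntegrableOn.of_forall_sdiff_eq_zero h1 isClosed_frontier.measurableSet fun y hy => ?_
  exact hFK y hy.1 fun hyK => hy.2 ⟨hy.1, hyK⟩

lemma HasOutwardUnitNormal.integral_pderiv (h : HasOutwardUnitNormal V ν) (hV : IsOpen V)
    {F : E3 → ℂ} (hF : ContDiff ℝ 1 F) (hc : HasCompactSupport F) (i : Fin 3) :
    ∫ y in V, pderiv i F y = ∫ y in frontier V, (ν y i : ℂ) * F y ∂(μHE[2] : Measure E3) := by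
  have he : ‖(EuclideanSpace.single i (1 : ℝ) : E3)‖ = 1 := by simp
  have hI : IntegrableOn (fun y => (ν y i : ℂ) * F y) (frontier V) (μHE[2] : Measure E3) := by
    refine h.integrableOn_frontier hV hc ((h.continuousOn_apply i).mul hF.continuous.continuousOn)
      fun y _ hy => ?_
    rw [image_eq_zero_of_notMem_tsupport hy, mul_zero]
  have hin : ∀ y, ⟪ν y, (EuclideanSpace.single i (1 : ℝ) : E3)⟫_ℝ = ν y i := fun y => by
    simp [EuclideanSpace.inner_single_right]
  have hre : ∀ L : ℂ →L[ℝ] ℝ, ∀ y, fderiv ℝ (L ∘ F) y (EuclideanSpace.single i 1)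
      = L (pderiv i F y) := fun L y => by
    rw [fderiv_comp y L.differentiableAt (hF.differentiable one_ne_zero y), L.fderiv]; rfl
  have key : ∀ L : ℂ →L[ℝ] ℝ, (∀ (a : ℝ) z, L (a * z) = a * L z) →
      L (∫ y in V, pderiv i F y)
        = L (∫ y in frontier V, (ν y i : ℂ) * F y ∂(μHE[2] : Measure E3)) := by
    intro L hL
    rw [← L.integral_comp_comm (integrable_pderiv hF hc i).integrableOn,
      ← L.integral_comp_comm hI]
    have := h.integral_fderiv_real hV (L.contDiff.comp hF) (hc.comp_left (map_zero L)) he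
    simpa only [hre, hin, hL, Function.comp_apply] using this
  refine Complex.ext (key Complex.reCLM fun a z => ?_) (key Complex.imCLM fun a z => ?_) <;> simp

lemma HasOutwardUnitNormal.integral_divField (h : HasOutwardUnitNormal V ν) (hV : IsOpen V)
    {X : Fin 3 → E3 → ℂ} (hX : ∀ i, ContDiff ℝ 1 (X i)) (hc : ∀ i, HasCompactSupport (X i)) :
    ∫ y in V, divField X y = ∫ y in frontier V, normalComp ν X y ∂(μHE[2] : Measure E3) := by
  simp only [divField, normalComp]
  rw [integral_finsetSum _ fun i _ => (integrable_pderiv (hX i) (hc i) i).integrableOn,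
    integral_finsetSum]
  · exact Finset.sum_congr rfl fun i _ => h.integral_pderiv hV (hX i) (hc i) i
  · intro i _
    refine h.integrableOn_frontier hV (hc i)
      ((h.continuousOn_apply i).mul (hX i).continuous.continuousOn) fun y _ hy => ?_
    rw [image_eq_zero_of_notMem_tsupport hy, mul_zero]

lemma pderiv_congr {u v : E3 → ℂ} {x : E3} (h : u =ᶠ[𝓝 x] v) (i : Fin 3) :
    pderiv i u x = pderiv i v x := by
  rw [pderiv, h.fderiv_eq]

lemma divField_congr {X Y : Fin 3 → E3 → ℂ} {x : E3} (h : ∀ i, X i =ᶠ[𝓝 x] Y i) :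
    divField X x = divField Y x :=
  Finset.sum_congr rfl fun i _ => pderiv_congr (h i) i

lemma divField_eq_zero {X : Fin 3 → E3 → ℂ} {x : E3} (h : ∀ i, X i =ᶠ[𝓝 x] 0) :
    divField X x = 0 := by
  rw [divField_congr (Y := 0) h]
  simp [divField, pderiv]

/-- The field `X`, cut off outside `V` and shifted by a short vector `t ν x₀` to the outside,
coincides on `closure V` with a smooth field. -/
lemma IsFlatAt.exists_shift (hf : IsFlatAt V ν x₀ ε δ φ) (hV : IsOpen V) {X : Fin 3 → E3 → ℂ}
    {K : Set E3} (hK : IsCompact K) (hKB : K ⊆ ball x₀ δ)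
    (hXK : ∀ i, ∀ y ∈ closure V, y ∉ K → X i y = 0)
    (hX1 : ∀ i, ContDiffOn ℝ 1 (X i) V) {t : ℝ} (ht : 0 < t)
    (htK : ∀ y ∈ K, y + t • ν x₀ ∈ ball x₀ δ) :
    ∃ Z : Fin 3 → E3 → ℂ, (∀ i, ContDiff ℝ 1 (Z i)) ∧ (∀ i, HasCompactSupport (Z i)) ∧
      (∀ i, ∀ y ∈ closure V, Z i y = V.indicator (X i) (y - t • ν x₀)) ∧
      (∀ y ∈ V, divField Z y = V.indicator (divField X) (y - t • ν x₀)) := by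
  set v := t • ν x₀ with hv
  set W : Set E3 := {y | y - v ∈ V} with hW
  have hWo : IsOpen W := hV.preimage (continuous_id.sub continuous_const)
  set Kt : Set E3 := (fun y => y + v) '' K with hKt
  have hKtc : IsCompact Kt := hK.image (continuous_id.add continuous_const)
  have hmem : ∀ y, y ∈ Kt ↔ y - v ∈ K := fun y =>
    ⟨by rintro ⟨z, hz, rfl⟩; simpa using hz, fun h => ⟨_, h, by simp⟩⟩
  have hsub : closure V ∩ Kt ⊆ W := by
    rintro y ⟨hyV, hyK⟩
    have h1 := (hmem y).1 hyK
    have h2 : y ∈ ball x₀ δ := by simpa using htK _ h1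
    exact hf.sub_smul_mem ht h2 (hKB h1) ((hf.closure_iff h2).1 hyV)
  obtain ⟨s, ρ, hρ, hρW, -, hρ1⟩ := exists_finite_smooth_partition (ι := Unit)
    (hKtc.inter_left (isClosed_closure (s := V))) (fun _ => W) (fun _ => hWo)
    (fun y hy => Set.mem_iUnion.2 ⟨(), hsub hy⟩)
  set χ : E3 → ℝ := fun y => ∑ i ∈ s, ρ i y with hχ
  have hχs : ContDiff ℝ 1 χ := ContDiff.sum fun i _ => (hρ i).of_le (by exact_mod_cast le_top)
  have hχ0 : ∀ y ∉ W, χ =ᶠ[𝓝 y] 0 := by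
    intro y hy
    have h1 : y ∉ tsupport (ρ ()) := fun h => hy (hρW () h)
    filter_upwards [(isClosed_tsupport (ρ ())).isOpen_compl.mem_nhds h1] with z hz
    exact Finset.sum_eq_zero fun i _ => image_eq_zero_of_notMem_tsupport hz
  set Z : Fin 3 → E3 → ℂ := fun i y => (χ y : ℂ) * X i (y - v) with hZ
  have hZs : ∀ i, ContDiff ℝ 1 (Z i) := by
    intro i
    rw [contDiff_iff_contDiffAt]
    intro y
    by_cases hy : y ∈ W
    · have h1 : ContDiffAt ℝ 1 (fun y => X i (y - v)) y := by
        refine ContDiffAt.comp y (g := X i) (f := fun y => y - v)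
          ((hX1 i).contDiffAt (hV.mem_nhds hy)) ?_
        exact contDiffAt_id.sub contDiffAt_const
      exact (Complex.ofRealCLM.contDiff.contDiffAt.comp y hχs.contDiffAt).mul h1
    · refine (contDiffAt_const (c := (0 : ℂ))).congr_of_eventuallyEq ?_
      filter_upwards [hχ0 y hy] with z hz
      simp [hZ, hz]
  have hZeq : ∀ i, ∀ y ∈ closure V, Z i y = V.indicator (X i) (y - v) := by
    intro i y hy
    by_cases hyK : y - v ∈ K
    · have h1 : y ∈ closure V ∩ Kt := ⟨hy, (hmem y).2 hyK⟩
      have h2 : y - v ∈ V := hsub h1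
      rw [Set.indicator_of_mem h2, hZ]
      simp [hχ, hρ1 y h1]
    · by_cases hyW : y - v ∈ V
      · rw [Set.indicator_of_mem hyW, hZ]
        simp [hXK i _ (subset_closure hyW) hyK]
      · rw [Set.indicator_of_notMem hyW, hZ]
        have := (hχ0 y hyW).self_of_nhds
        simp [this]
  have hZ0 : ∀ i, ∀ y ∉ Kt, Z i y = 0 := by
    intro i y hy
    rw [hmem] at hy
    by_cases hyW : y ∈ W
    · rw [hZ]
      simp [hXK i _ (subset_closure hyW) hy]
    · have := (hχ0 y hyW).self_of_nhds
      simp [hZ, this]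
  refine ⟨Z, hZs, fun i => HasCompactSupport.intro hKtc (hZ0 i), hZeq, fun y hy => ?_⟩
  by_cases hyW : y - v ∈ V
  · rw [Set.indicator_of_mem hyW, divField, divField]
    refine Finset.sum_congr rfl fun i _ => ?_
    have h1 : Z i =ᶠ[𝓝 y] fun z => X i (z - v) := by
      filter_upwards [hV.mem_nhds hy, hWo.mem_nhds hyW] with z hz1 hz2
      rw [hZeq i z (subset_closure hz1), Set.indicator_of_mem (by exact hz2)]
    rw [pderiv_congr h1, pderiv, fderiv_comp_sub]
  · rw [Set.indicator_of_notMem hyW]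
    refine divField_eq_zero fun i => ?_
    have h1 : y ∉ Kt := fun h => hyW (hsub ⟨subset_closure hy, h⟩)
    filter_upwards [hKtc.isClosed.isOpen_compl.mem_nhds h1] with z hz
    exact hZ0 i z hz

/-- The divergence theorem for fields that are supported near a boundary point. Fields that are
differentiable only inside of `V` are moved to the outside a bit. -/
lemma IsFlatAt.integral_divField (hf : IsFlatAt V ν x₀ ε δ φ) (h : HasOutwardUnitNormal V ν)
    (hV : IsOpen V) {X : Fin 3 → E3 → ℂ}
    {K : Set E3} (hK : IsCompact K) (hKB : K ⊆ ball x₀ δ)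
    (hXK : ∀ i, ∀ y ∈ closure V, y ∉ K → X i y = 0) (hXc : ∀ i, ContinuousOn (X i) (closure V))
    (hX1 : ∀ i, ContDiffOn ℝ 1 (X i) V) (hint : IntegrableOn (divField X) V) :
    ∫ y in V, divField X y = ∫ y in frontier V, normalComp ν X y ∂(μHE[2] : Measure E3) := by
  have := h.isLocallyFiniteMeasure hV
  obtain ⟨r, hr, hrK⟩ := hK.exists_thickening_subset_open isOpen_ball hKB
  have hn := hf.norm_normal
  have htK : ∀ t, 0 < t → t < r → ∀ y ∈ K, y + t • ν x₀ ∈ ball x₀ δ := by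
    intro t ht htr y hy
    refine hrK (mem_thickening_iff.2 ⟨y, hy, ?_⟩)
    rw [dist_eq_norm, add_sub_cancel_left, norm_smul, hn, Real.norm_of_nonneg ht.le, mul_one]
    exact htr
  have hM : ∀ i, ∃ M, 0 ≤ M ∧ ∀ y ∈ closure V ∩ K, ‖X i y‖ ≤ M := fun i => by
    obtain ⟨M, hM⟩ := (hK.inter_left isClosed_closure).exists_bound_of_continuousOn
      ((hXc i).mono Set.inter_subset_left)
    exact ⟨max M 0, le_max_right _ _, fun y hy => (hM y hy).trans (le_max_left _ _)⟩
  choose M hM0 hM using hM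
  have hlimv : Tendsto (fun t : ℝ => t • ν x₀) (𝓝[>] 0) (𝓝 0) := by
    have : Continuous fun t : ℝ => t • ν x₀ := by fun_prop
    simpa using (this.tendsto 0).mono_left nhdsWithin_le_nhds
  have hIoo : ∀ᶠ t : ℝ in 𝓝[>] 0, 0 < t ∧ t < r ∧ t < 1 := by
    filter_upwards [Ioo_mem_nhdsGT (lt_min hr one_pos)] with t ht
    exact ⟨ht.1, ht.2.trans_le (min_le_left _ _), ht.2.trans_le (min_le_right _ _)⟩
  -- the volume integrals converge
  have hvol : Tendsto (fun t : ℝ => ∫ y in V, V.indicator (divField X) (y - t • ν x₀)) (𝓝[>] 0)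
      (𝓝 (∫ y in V, divField X y)) := by
    have h1 : ∀ t : ℝ, ∫ y in V, V.indicator (divField X) (y - t • ν x₀)
        = ∫ y in V, {z | z + t • ν x₀ ∈ V}.indicator (divField X) y := by
      intro t
      rw [← integral_indicator hV.measurableSet, ← integral_indicator hV.measurableSet,
        ← integral_add_right_eq_self _ (t • ν x₀)]
      congr 1
      funext y
      by_cases h1 : y ∈ V <;> by_cases h2 : y + t • ν x₀ ∈ V <;> simp [Set.indicator, h1, h2]
    simp only [h1]
    refine tendsto_integral_filter_of_dominated_convergence (fun y => ‖divField X y‖) ?_ ?_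
      hint.norm ?_
    · refine Eventually.of_forall fun t => hint.aestronglyMeasurable.indicator ?_
      exact (hV.preimage (continuous_id.add continuous_const)).measurableSet
    · exact Eventually.of_forall fun t => Eventually.of_forall fun y =>
        norm_indicator_le_norm_self _ _
    · refine (ae_restrict_mem hV.measurableSet).mono fun y hy => ?_
      refine tendsto_const_nhds.congr' ?_
      have h2 : Tendsto (fun t : ℝ => y + t • ν x₀) (𝓝[>] 0) (𝓝 y) := by
        simpa using hlimv.const_add y
      filter_upwards [h2 (hV.mem_nhds hy)] with t ht
      rw [Set.indicator_of_mem (by exact ht)]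
  -- the surface integrals converge
  have hsurf : Tendsto (fun t : ℝ => ∫ y in frontier V,
      ∑ i, (ν y i : ℂ) * V.indicator (X i) (y - t • ν x₀) ∂(μHE[2] : Measure E3)) (𝓝[>] 0)
      (𝓝 (∫ y in frontier V, normalComp ν X y ∂(μHE[2] : Measure E3))) := by
    refine tendsto_integral_filter_of_dominated_convergence
      ((cthickening 1 K).indicator fun _ => ∑ i, M i) ?_ ?_ ?_ ?_
    · filter_upwards [hIoo] with t ht
      obtain ⟨Z, hZ1, -, hZ2, -⟩ := hf.exists_shift hV hK hKB hXK hX1 ht.1 (htK t ht.1 ht.2.1)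
      have h1 : ContinuousOn (normalComp ν Z) (frontier V) :=
        continuousOn_finsetSum _ fun i _ =>
          (h.continuousOn_apply i).mul (hZ1 i).continuous.continuousOn
      refine (h1.aestronglyMeasurable isClosed_frontier.measurableSet).congr ?_
      refine (ae_restrict_mem isClosed_frontier.measurableSet).mono fun y hy => ?_
      exact Finset.sum_congr rfl fun i _ => by rw [hZ2 i y (frontier_subset_closure hy)]
    · filter_upwards [hIoo] with t ht
      refine (ae_restrict_mem isClosed_frontier.measurableSet).mono fun y hy => ?_
      by_cases hyK : y - t • ν x₀ ∈ closure V ∩ K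
      · have h1 : y ∈ cthickening 1 K := by
          refine mem_cthickening_of_dist_le y _ 1 K hyK.2 ?_
          rw [dist_eq_norm, sub_sub_cancel, norm_smul, hn, Real.norm_of_nonneg ht.1.le, mul_one]
          exact ht.2.2.le
        rw [Set.indicator_of_mem h1]
        refine (norm_sum_le _ _).trans (Finset.sum_le_sum fun i _ => ?_)
        rw [norm_mul, ← one_mul (M i)]
        refine mul_le_mul (h.norm_apply_le hy i) ?_ (norm_nonneg _) zero_le_one
        exact (norm_indicator_le_norm_self _ _).trans (hM i _ hyK)
      · have h1 : ∀ i, V.indicator (X i) (y - t • ν x₀) = 0 := by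
          intro i
          by_cases h2 : y - t • ν x₀ ∈ V
          · rw [Set.indicator_of_mem h2]
            exact hXK i _ (subset_closure h2) fun h3 => hyK ⟨subset_closure h2, h3⟩
          · rw [Set.indicator_of_notMem h2]
        simp only [h1, mul_zero, Finset.sum_const_zero, norm_zero]
        exact Set.indicator_nonneg (fun _ _ => Finset.sum_nonneg fun i _ => hM0 i) y
    · rw [integrable_indicator_iff isClosed_cthickening.measurableSet]
      exact integrableOn_const (hK.cthickening.measure_lt_top.ne)
    · refine (ae_restrict_mem isClosed_frontier.measurableSet).mono fun y hy => ?_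
      refine tendsto_finsetSum _ fun i _ => Tendsto.const_mul _ ?_
      have h2 : Tendsto (fun t : ℝ => y - t • ν x₀) (𝓝[>] 0) (𝓝 y) := by
        simpa using hlimv.const_sub y
      by_cases hyB : y ∈ ball x₀ δ
      · have h3 : ∀ᶠ t : ℝ in 𝓝[>] 0, y - t • ν x₀ ∈ V := by
          filter_upwards [h2 (isOpen_ball.mem_nhds hyB), self_mem_nhdsWithin] with t ht1 ht2
          exact hf.sub_smul_mem ht2 hyB ht1 ((hf.closure_iff hyB).1 (frontier_subset_closure hy))
        have h4 : Tendsto (fun t : ℝ => X i (y - t • ν x₀)) (𝓝[>] 0) (𝓝 (X i y)) := by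
          refine (hXc i y (frontier_subset_closure hy)).tendsto.comp ?_
          refine tendsto_nhdsWithin_iff.2 ⟨h2, h3.mono fun t ht => subset_closure ht⟩
        refine h4.congr' ?_
        filter_upwards [h3] with t ht
        rw [Set.indicator_of_mem ht]
      · have hyK : y ∉ K := fun h => hyB (hKB h)
        rw [hXK i y (frontier_subset_closure hy) hyK]
        refine tendsto_const_nhds.congr' ?_
        filter_upwards [h2 (hK.isClosed.isOpen_compl.mem_nhds hyK)] with t ht
        by_cases h5 : y - t • ν x₀ ∈ V
        · rw [Set.indicator_of_mem h5, hXK i _ (subset_closure h5) ht]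
        · rw [Set.indicator_of_notMem h5]
  refine tendsto_nhds_unique hvol (hsurf.congr' ?_)
  filter_upwards [hIoo] with t ht
  obtain ⟨Z, hZ1, hZc, hZ2, hZ3⟩ := hf.exists_shift hV hK hKB hXK hX1 ht.1 (htK t ht.1 ht.2.1)
  rw [← setIntegral_congr_fun hV.measurableSet hZ3, h.integral_divField hV hZ1 hZc]
  refine setIntegral_congr_fun isClosed_frontier.measurableSet fun y hy => ?_
  exact Finset.sum_congr rfl fun i _ => by rw [hZ2 i y (frontier_subset_closure hy)]

lemma pderiv_mul {u v : E3 → ℂ} {x : E3} (hu : DifferentiableAt ℝ u x)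
    (hv : DifferentiableAt ℝ v x) (i : Fin 3) :
    pderiv i (fun y => u y * v y) x = u x * pderiv i v x + pderiv i u x * v x := by
  rw [pderiv, fderiv_fun_mul hu hv]
  simp [pderiv, mul_comm]

/-- **The divergence theorem** on an open set with `C¹` boundary, for fields that are continuous up
to the boundary, differentiable inside, and vanish outside of a compact set. -/
theorem HasOutwardUnitNormal.divergence_theorem (h : HasOutwardUnitNormal V ν)
    (hV : IsOpen V) {X : Fin 3 → E3 → ℂ} {K : Set E3} (hK : IsCompact K)
    (hXK : ∀ i, ∀ y ∈ closure V, y ∉ K → X i y = 0) (hXc : ∀ i, ContinuousOn (X i) (closure V))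
    (hX1 : ∀ i, ContDiffOn ℝ 1 (X i) V) (hint : IntegrableOn (divField X) V) :
    ∫ y in V, divField X y = ∫ y in frontier V, normalComp ν X y ∂(μHE[2] : Measure E3) := by
  -- every point has a neighbourhood such that the theorem holds for fields supported there
  have hloc : ∀ x : E3, ∃ U : Set E3, IsOpen U ∧ x ∈ U ∧ ∀ (Y : Fin 3 → E3 → ℂ) (L : Set E3),
      IsCompact L → L ⊆ U → (∀ i, ∀ y ∈ closure V, y ∉ L → Y i y = 0) →
      (∀ i, ContinuousOn (Y i) (closure V)) → (∀ i, ContDiffOn ℝ 1 (Y i) V) →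
      IntegrableOn (divField Y) V →
      ∫ y in V, divField Y y = ∫ y in frontier V, normalComp ν Y y ∂(μHE[2] : Measure E3) := by
    intro x
    by_cases hx : x ∈ frontier V
    · obtain ⟨δ, φ, hf⟩ := h.exists_isFlatAt hx (ε := 1 / 2) (by norm_num) (by norm_num)
      exact ⟨ball x δ, isOpen_ball, mem_ball_self hf.pos, fun Y L hL hLU h1 h2 h3 h4 =>
        hf.integral_divField h hV hL hLU h1 h2 h3 h4⟩
    have hS0 : ∀ (Y : Fin 3 → E3 → ℂ), (∀ i, ∀ y ∈ frontier V, Y i y = 0) →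
        ∫ y in frontier V, normalComp ν Y y ∂(μHE[2] : Measure E3) = 0 := by
      intro Y hY
      refine setIntegral_eq_zero_of_forall_eq_zero fun y hy => ?_
      exact Finset.sum_eq_zero fun i _ => by rw [hY i y hy, mul_zero]
    by_cases hxV : x ∈ V
    · refine ⟨V, hV, hxV, fun Y L hL hLV h1 h2 h3 h4 => ?_⟩
      have hZ1 : ∀ i, ContDiff ℝ 1 (V.indicator (Y i)) := by
        intro i
        rw [contDiff_iff_contDiffAt]
        intro y
        by_cases hy : y ∈ V
        · refine ((h3 i).contDiffAt (hV.mem_nhds hy)).congr_of_eventuallyEq ?_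
          filter_upwards [hV.mem_nhds hy] with z hz using Set.indicator_of_mem hz _
        · refine (contDiffAt_const (c := (0 : ℂ))).congr_of_eventuallyEq ?_
          filter_upwards [hL.isClosed.isOpen_compl.mem_nhds fun hyL => hy (hLV hyL)] with z hz
          by_cases hzV : z ∈ V
          · rw [Set.indicator_of_mem hzV, h1 i z (subset_closure hzV) hz]
          · rw [Set.indicator_of_notMem hzV]
      have hZc : ∀ i, HasCompactSupport (V.indicator (Y i)) := fun i =>
        HasCompactSupport.intro hL fun z hz => by
          by_cases hzV : z ∈ V
          · rw [Set.indicator_of_mem hzV, h1 i z (subset_closure hzV) hz]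
          · rw [Set.indicator_of_notMem hzV]
      have hSV : ∀ y ∈ frontier V, y ∉ V := fun y hy => by
        rw [hV.frontier_eq] at hy; exact hy.2
      have key := h.integral_divField hV hZ1 hZc
      rw [hS0 _ fun i y hy => Set.indicator_of_notMem (hSV y hy) _] at key
      rw [hS0 Y fun i y hy => h1 i y (frontier_subset_closure hy) fun hyL => hSV y hy (hLV hyL),
        ← key]
      refine setIntegral_congr_fun hV.measurableSet fun y hy => divField_congr fun i => ?_
      filter_upwards [hV.mem_nhds hy] with z hz using (Set.indicator_of_mem hz _).symm
    · refine ⟨(closure V)ᶜ, isClosed_closure.isOpen_compl, fun hcl => ?_,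
        fun Y L hL hLV h1 h2 h3 h4 => ?_⟩
      · rw [hV.frontier_eq] at hx
        exact hx ⟨hcl, hxV⟩
      · have h5 : ∀ i, ∀ y ∈ closure V, Y i y = 0 := fun i y hy =>
          h1 i y hy fun hyL => hLV hyL hy
        rw [hS0 Y fun i y hy => h5 i y (frontier_subset_closure hy)]
        refine setIntegral_eq_zero_of_forall_eq_zero fun y hy => divField_eq_zero fun i => ?_
        filter_upwards [hV.mem_nhds hy] with z hz using h5 i z (subset_closure hz)
  choose U hUo hxU hU using hloc
  obtain ⟨t, ρ, hρ, hρU, -, hρ1⟩ := exists_finite_smooth_partition hK U hUo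
    (fun x _ => Set.mem_iUnion.2 ⟨x, hxU x⟩)
  have hρC : ∀ j, ContDiff ℝ 1 (fun y => (ρ j y : ℂ)) := fun j =>
    Complex.ofRealCLM.contDiff.comp ((hρ j).of_le (by exact_mod_cast le_top))
  set Y : E3 → Fin 3 → E3 → ℂ := fun j i y => (ρ j y : ℂ) * X i y with hY
  have hYK : ∀ j i, ∀ y ∈ closure V, y ∉ tsupport (ρ j) ∩ K → Y j i y = 0 := by
    intro j i y hy hyK
    by_cases h1 : y ∈ K
    · simp [hY, image_eq_zero_of_notMem_tsupport fun h2 => hyK ⟨h2, h1⟩]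
    · simp [hY, hXK i y hy h1]
  have hYc : ∀ j i, ContinuousOn (Y j i) (closure V) := fun j i =>
    (hρC j).continuous.continuousOn.mul (hXc i)
  have hY1 : ∀ j i, ContDiffOn ℝ 1 (Y j i) V := fun j i => (hρC j).contDiffOn.mul (hX1 i)
  have hXd : ∀ i, ∀ y ∈ V, DifferentiableAt ℝ (X i) y := fun i y hy =>
    ((hX1 i).contDiffAt (hV.mem_nhds hy)).differentiableAt one_ne_zero
  have hYd : ∀ j i, ∀ y ∈ V, DifferentiableAt ℝ (Y j i) y := fun j i y hy =>
    ((hY1 j i).contDiffAt (hV.mem_nhds hy)).differentiableAt one_ne_zero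
  have hYi : ∀ j, IntegrableOn (divField (Y j)) V := by
    intro j
    have h1 : IntegrableOn (fun y => (ρ j y : ℂ) * divField X y) (V ∩ K) :=
      (hint.mono_set Set.inter_subset_left).continuousOn_mul_of_subset
        (hρC j).continuous.continuousOn hK (hV.measurableSet.inter hK.measurableSet)
        Set.inter_subset_right
    have h2 : IntegrableOn (fun y => ∑ i, pderiv i (fun y => (ρ j y : ℂ)) y * X i y) (V ∩ K) := by
      refine IntegrableOn.mono_set (t := closure V ∩ K) (ContinuousOn.integrableOn_compact
        (hK.inter_left isClosed_closure) ?_) (Set.inter_subset_inter_left _ subset_closure)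
      refine continuousOn_finsetSum _ fun i _ => ContinuousOn.mul ?_
        ((hXc i).mono Set.inter_subset_left)
      exact (((hρC j).continuous_fderiv one_ne_zero).clm_apply continuous_const).continuousOn
    refine IntegrableOn.of_forall_sdiff_eq_zero ((h1.add h2).congr_fun (fun y hy => ?_)
      (hV.measurableSet.inter hK.measurableSet)) hV.measurableSet fun y hy => ?_
    · simp only [divField, Pi.add_apply, Finset.mul_sum, ← Finset.sum_add_distrib]
      refine Finset.sum_congr rfl fun i _ => ?_
      rw [hY]
      simp only
      rw [pderiv_mul ((hρC j).differentiable one_ne_zero y) (hXd i y hy.1)]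
    · refine divField_eq_zero fun i => ?_
      have hyK : y ∉ K := fun h => hy.2 ⟨hy.1, h⟩
      filter_upwards [hV.mem_nhds hy.1, hK.isClosed.isOpen_compl.mem_nhds hyK] with z hz1 hz2
      exact hYK j i z (subset_closure hz1) fun h => hz2 h.2
  have hsum : ∀ i, ∀ y ∈ closure V, X i y = ∑ j ∈ t, Y j i y := by
    intro i y hy
    by_cases hyK : y ∈ K
    · rw [hY]
      simp only
      rw [← Finset.sum_mul, ← Complex.ofReal_sum, hρ1 y hyK, Complex.ofReal_one, one_mul]
    · rw [hXK i y hy hyK]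
      exact (Finset.sum_eq_zero fun j _ => hYK j i y hy fun h => hyK h.2).symm
  have hvol : ∫ y in V, divField X y = ∑ j ∈ t, ∫ y in V, divField (Y j) y := by
    rw [← integral_finsetSum _ fun j _ => hYi j]
    refine setIntegral_congr_fun hV.measurableSet fun y hy => ?_
    simp only [divField]
    rw [Finset.sum_comm]
    refine Finset.sum_congr rfl fun i _ => ?_
    have h1 : X i =ᶠ[𝓝 y] fun z => ∑ j ∈ t, Y j i z := by
      filter_upwards [hV.mem_nhds hy] with z hz using hsum i z (subset_closure hz)
    rw [pderiv_congr h1, pderiv, fderiv_fun_sum fun j _ => hYd j i y hy]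
    simp [pderiv]
  have hsurf : ∫ y in frontier V, normalComp ν X y ∂(μHE[2] : Measure E3)
      = ∑ j ∈ t, ∫ y in frontier V, normalComp ν (Y j) y ∂(μHE[2] : Measure E3) := by
    rw [← integral_finsetSum]
    · refine setIntegral_congr_fun isClosed_frontier.measurableSet fun y hy => ?_
      simp only [normalComp]
      rw [Finset.sum_comm]
      refine Finset.sum_congr rfl fun i _ => ?_
      rw [hsum i y (frontier_subset_closure hy), Finset.mul_sum]
    · intro j _
      refine h.integrableOn_frontier hV hK (continuousOn_finsetSum _ fun i _ =>
        (h.continuousOn_apply i).mul ((hYc j i).mono frontier_subset_closure)) fun y hy hyK => ?_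
      refine Finset.sum_eq_zero fun i _ => ?_
      rw [hYK j i y (frontier_subset_closure hy) fun h => hyK h.2, mul_zero]
  rw [hvol, hsurf]
  refine Finset.sum_congr rfl fun j _ => ?_
  exact hU j (Y j) (tsupport (ρ j) ∩ K) (hK.inter_left (isClosed_tsupport _))
    (Set.inter_subset_left.trans (hρU j)) (hYK j) (hYc j) (hY1 j) (hYi j)

end Divergence

/-! ### The fundamental solution of the Helmholtz equation -/

section Fundamental

open Metric InnerProductSpace
open scoped ContDiff

/-- The gradient of a complex field, as a vector field with complex components. -/
noncomputable def gradField (u : E3 → ℂ) : Fin 3 → E3 → ℂ := fun i => pderiv i u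

lemma laplacian_eq_divField {u : E3 → ℂ} {x : E3} (hu : ContDiffAt ℝ 2 u x) :
    Laplacian.laplacian u x = divField (gradField u) x := by
  rw [congrFun (laplacian_eq_iteratedFDeriv_orthonormalBasis u
    (EuclideanSpace.basisFun (Fin 3) ℝ)) x, divField]
  refine Finset.sum_congr rfl fun i _ => ?_
  have hd : DifferentiableAt ℝ (fderiv ℝ u) x :=
    (hu.fderiv_right (m := 1) (by norm_num)).differentiableAt one_ne_zero
  rw [iteratedFDeriv_two_apply, gradField, pderiv]
  have h1 : (fun y => pderiv i u y) = fun y => fderiv ℝ u y (EuclideanSpace.single i 1) := rfl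
  change _ = fderiv ℝ (fun y => fderiv ℝ u y (EuclideanSpace.single i 1)) x _
  rw [fderiv_clm_apply hd (differentiableAt_const _)]
  simp

lemma contDiff_pderiv {u : E3 → ℂ} (hu : ContDiff ℝ 2 u) (i : Fin 3) : ContDiff ℝ 1 (pderiv i u) :=
  (hu.fderiv_right (m := 1) (by norm_num)).clm_apply contDiff_const

lemma integral_divField_eq_zero {X : Fin 3 → E3 → ℂ} (hX : ∀ i, ContDiff ℝ 1 (X i))
    (hc : ∀ i, HasCompactSupport (X i)) : ∫ y, divField X y = 0 := by
  have h : HasOutwardUnitNormal (Set.univ : Set E3) 0 := by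
    intro x hx
    simp at hx
  simpa using h.integral_divField isOpen_univ hX hc

lemma hasCompactSupport_pderiv {u : E3 → ℂ} (hu : HasCompactSupport u) (i : Fin 3) :
    HasCompactSupport (pderiv i u) := hu.fderiv_apply (𝕜 := ℝ) _

lemma pderiv_sub {u v : E3 → ℂ} {x : E3} (hu : DifferentiableAt ℝ u x)
    (hv : DifferentiableAt ℝ v x) (i : Fin 3) :
    pderiv i (fun y => u y - v y) x = pderiv i u x - pderiv i v x := by
  rw [pderiv, fderiv_fun_sub hu hv]
  simp [pderiv]

lemma pderiv_add {u v : E3 → ℂ} {x : E3} (hu : DifferentiableAt ℝ u x)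
    (hv : DifferentiableAt ℝ v x) (i : Fin 3) :
    pderiv i (fun y => u y + v y) x = pderiv i u x + pderiv i v x := by
  rw [pderiv, fderiv_fun_add hu hv]
  simp [pderiv]

/-- Green's second identity in the whole space. -/
lemma integral_green {G φ : E3 → ℂ} (hG : ContDiff ℝ 2 G) (hφ : ContDiff ℝ 2 φ)
    (hc : HasCompactSupport φ) :
    ∫ y, G y * divField (gradField φ) y = ∫ y, φ y * divField (gradField G) y := by
  have hG1 := hG.of_le (m := 1) (by norm_num)
  have hφ1 := hφ.of_le (m := 1) (by norm_num)
  have h1 := integral_divField_eq_zero (X := fun i y => G y * pderiv i φ y - φ y * pderiv i G y)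
    (fun i => (hG1.mul (contDiff_pderiv hφ i)).sub (hφ1.mul (contDiff_pderiv hG i)))
    (fun i => (((hasCompactSupport_pderiv hc i).mul_left).sub hc.mul_right))
  have h2 : ∀ y, divField (fun i y => G y * pderiv i φ y - φ y * pderiv i G y) y
      = G y * divField (gradField φ) y - φ y * divField (gradField G) y := by
    intro y
    simp only [divField, gradField, Finset.mul_sum, ← Finset.sum_sub_distrib]
    refine Finset.sum_congr rfl fun i _ => ?_
    have hGd := hG1.differentiable one_ne_zero y
    have hφd := hφ1.differentiable one_ne_zero y
    have hGd' := (contDiff_pderiv hG i).differentiable one_ne_zero y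
    have hφd' := (contDiff_pderiv hφ i).differentiable one_ne_zero y
    rw [pderiv_sub (hGd.fun_mul hφd') (hφd.fun_mul hGd'), pderiv_mul hGd hφd', pderiv_mul hφd hGd']
    ring
  have hdc : ∀ {u : E3 → ℂ}, ContDiff ℝ 2 u → Continuous (divField (gradField u)) := fun hu => by
    unfold divField
    exact continuous_finsetSum _ fun i _ =>
      ((contDiff_pderiv hu i).continuous_fderiv one_ne_zero).clm_apply continuous_const
  have hdcs : HasCompactSupport (divField (gradField φ)) := by
    refine HasCompactSupport.intro hc fun y hy => divField_eq_zero fun i => ?_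
    filter_upwards [(isClosed_tsupport φ).isOpen_compl.mem_nhds hy] with z hz
    exact image_eq_zero_of_notMem_tsupport fun h => hz (tsupport_fderiv_apply_subset ℝ _ h)
  simp only [h2] at h1
  rwa [integral_sub, sub_eq_zero] at h1
  · exact (hG.continuous.mul (hdc hφ)).integrable_of_hasCompactSupport hdcs.mul_left
  · exact (hφ.continuous.mul (hdc hG)).integrable_of_hasCompactSupport hc.mul_right

/-- The regularized distance `√(|y|² + ε²)` to the origin. -/
noncomputable def rad (ε : ℝ) (y : E3) : ℝ := √(‖y‖ ^ 2 + ε ^ 2)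

lemma rad_zero (y : E3) : rad 0 y = ‖y‖ := by simp [rad]

lemma rad_pos {ε : ℝ} (hε : 0 < ε) (y : E3) : 0 < rad ε y := Real.sqrt_pos.2 (by positivity)

lemma rad_sq (ε : ℝ) (y : E3) : rad ε y ^ 2 = ‖y‖ ^ 2 + ε ^ 2 := Real.sq_sqrt (by positivity)

lemma norm_le_rad (ε : ℝ) (y : E3) : ‖y‖ ≤ rad ε y :=
  Real.le_sqrt_of_sq_le (by nlinarith [sq_nonneg ε])

lemma le_rad {ε : ℝ} (y : E3) : ε ≤ rad ε y :=
  Real.le_sqrt_of_sq_le (by nlinarith [sq_nonneg ‖y‖])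

lemma continuous_rad (ε : ℝ) : Continuous (rad ε) := by unfold rad; fun_prop

lemma contDiffAt_rad {ε : ℝ} {y : E3} (h : rad ε y ≠ 0) {n : ℕ∞} : ContDiffAt ℝ n (rad ε) y := by
  unfold rad at h ⊢
  refine ContDiffAt.sqrt ?_ fun h0 => h (by rw [h0, Real.sqrt_zero])
  exact ((contDiff_norm_sq ℝ).add contDiff_const).contDiffAt

lemma hasFDerivAt_rad {ε : ℝ} {y : E3} (h : rad ε y ≠ 0) :
    HasFDerivAt (rad ε) ((rad ε y)⁻¹ • innerSL ℝ y) y := by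
  have h0 : ‖y‖ ^ 2 + ε ^ 2 ≠ 0 := fun h0 => h (by rw [rad, h0, Real.sqrt_zero])
  have h1 : HasFDerivAt (fun y : E3 => ‖y‖ ^ 2 + ε ^ 2) (2 • innerSL ℝ y) y :=
    (hasStrictFDerivAt_norm_sq y).hasFDerivAt.add_const _
  have h2 : HasFDerivAt (rad ε) _ y := h1.sqrt h0
  refine h2.congr_fderiv ?_
  rw [← Nat.cast_smul_eq_nsmul ℝ, smul_smul]
  congr 1
  rw [rad]
  push_cast
  field_simp

lemma pderiv_comp_rad {ε : ℝ} {y : E3} (h : rad ε y ≠ 0) {g : ℝ → ℂ} {g' : ℂ}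
    (hg : HasDerivAt g g' (rad ε y)) (i : Fin 3) :
    pderiv i (fun y => g (rad ε y)) y = g' * (y i / rad ε y) := by
  have h1 := hg.hasFDerivAt.comp y (hasFDerivAt_rad h)
  rw [pderiv, HasFDerivAt.fderiv (f := fun y => g (rad ε y)) h1]
  simp [EuclideanSpace.inner_single_right]
  ring

lemma pderiv_coord (i : Fin 3) (y : E3) : pderiv i (fun y => (y i : ℂ)) y = 1 := by
  have h1 : HasFDerivAt (fun y : E3 => (y i : ℂ))
      (Complex.ofRealCLM.comp (EuclideanSpace.proj (𝕜 := ℝ) i)) y :=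
    (Complex.ofRealCLM.comp (EuclideanSpace.proj (𝕜 := ℝ) i)).hasFDerivAt
  rw [pderiv, h1.fderiv]
  simp

/-- The profile `e^{iks} / s` of the outgoing fundamental solution. -/
noncomputable def outgoing (k s : ℝ) : ℂ := Complex.exp (Complex.I * k * s) / s

/-- The function `e^{iks} (iks - 1) / s³`, which is `s⁻¹` times the derivative of `outgoing k`. -/
noncomputable def outgoing' (k s : ℝ) : ℂ :=
  Complex.exp (Complex.I * k * s) * (Complex.I * k * s - 1) / s ^ 3

lemma norm_exp_I_mul (k s : ℝ) : ‖Complex.exp (Complex.I * k * s)‖ = 1 := by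
  rw [mul_assoc, mul_comm, ← Complex.ofReal_mul, Complex.norm_exp_ofReal_mul_I]

lemma norm_outgoing (k : ℝ) {s : ℝ} (hs : 0 ≤ s) : ‖outgoing k s‖ = s⁻¹ := by
  rw [outgoing, norm_div, norm_exp_I_mul, Complex.norm_real, Real.norm_of_nonneg hs, one_div]

lemma hasDerivAt_exp_I_mul (k s : ℝ) : HasDerivAt (fun s : ℝ => Complex.exp (Complex.I * k * s))
    (Complex.I * k * Complex.exp (Complex.I * k * s)) s := by
  have h1 : HasDerivAt (fun s : ℝ => Complex.I * k * (s : ℂ)) (Complex.I * k) s := by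
    simpa using (Complex.ofRealCLM.hasDerivAt (x := s)).const_mul (Complex.I * k)
  convert h1.cexp using 1
  ring

lemma hasDerivAt_outgoing (k : ℝ) {s : ℝ} (hs : s ≠ 0) :
    HasDerivAt (outgoing k) (s * outgoing' k s) s := by
  have hs' : (s : ℂ) ≠ 0 := Complex.ofReal_ne_zero.2 hs
  have h1 : HasDerivAt (fun s : ℝ => (s : ℂ)) 1 s := Complex.ofRealCLM.hasDerivAt (x := s)
  have h2 : HasDerivAt (outgoing k) _ s := (hasDerivAt_exp_I_mul k s).div h1 hs'
  refine h2.congr_deriv ?_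
  simp only [outgoing']
  field_simp

lemma hasDerivAt_outgoing' (k : ℝ) {s : ℝ} (hs : s ≠ 0) :
    HasDerivAt (outgoing' k) (Complex.exp (Complex.I * k * s) *
      (-k ^ 2 / s ^ 2 - 3 * (Complex.I * k * s - 1) / s ^ 4)) s := by
  have hs' : (s : ℂ) ≠ 0 := Complex.ofReal_ne_zero.2 hs
  have h1 : HasDerivAt (fun s : ℝ => (s : ℂ)) 1 s := Complex.ofRealCLM.hasDerivAt (x := s)
  have h2 := ((h1.const_mul (Complex.I * k)).sub_const 1)
  have h3 : HasDerivAt (outgoing' k) _ s :=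
    ((hasDerivAt_exp_I_mul k s).mul h2).div (h1.pow 3) (pow_ne_zero 3 hs')
  refine h3.congr_deriv ?_
  simp only [Pi.mul_apply]
  field_simp
  ring_nf
  simp only [Complex.I_sq]
  ring

lemma pderiv_outgoing (k : ℝ) {ε : ℝ} {y : E3} (h : rad ε y ≠ 0) (i : Fin 3) :
    pderiv i (fun y => outgoing k (rad ε y)) y = outgoing' k (rad ε y) * y i := by
  rw [pderiv_comp_rad h (hasDerivAt_outgoing k h)]
  have : (rad ε y : ℂ) ≠ 0 := Complex.ofReal_ne_zero.2 h
  field_simp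

lemma contDiffAt_outgoing_rad (k : ℝ) {ε : ℝ} {y : E3} (h : rad ε y ≠ 0) {n : ℕ∞} :
    ContDiffAt ℝ n (fun y => outgoing k (rad ε y)) y := by
  have h1 : ContDiffAt ℝ n (fun y => (rad ε y : ℂ)) y :=
    Complex.ofRealCLM.contDiff.contDiffAt.comp y (contDiffAt_rad h)
  simp only [outgoing, div_eq_mul_inv]
  exact (contDiffAt_const.mul h1).cexp.mul (h1.inv (Complex.ofReal_ne_zero.2 h))

lemma divField_gradField_outgoing (k : ℝ) {ε : ℝ} (hε : 0 < ε) (y : E3) :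
    divField (gradField fun y => outgoing k (rad ε y)) y + k ^ 2 * outgoing k (rad ε y)
      = Complex.exp (Complex.I * k * rad ε y) * (ε ^ 2 * (k ^ 2 / rad ε y ^ 3
        + 3 * Complex.I * k / rad ε y ^ 4 - 3 / rad ε y ^ 5)) := by
  have hs : ∀ y : E3, rad ε y ≠ 0 := fun y => (rad_pos hε y).ne'
  have h1 : ∀ i, pderiv i (gradField (fun y => outgoing k (rad ε y)) i) y
      = outgoing' k (rad ε y) + Complex.exp (Complex.I * k * rad ε y) *
      (-k ^ 2 / rad ε y ^ 2 - 3 * (Complex.I * k * rad ε y - 1) / rad ε y ^ 4) *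
        (y i ^ 2 / rad ε y) := by
    intro i
    have h2 : gradField (fun y => outgoing k (rad ε y)) i
        = fun y => outgoing' k (rad ε y) * (y i : ℂ) :=
      funext fun y => pderiv_outgoing k (hs y) i
    have hd1 : DifferentiableAt ℝ (fun y => outgoing' k (rad ε y)) y :=
      ((hasDerivAt_outgoing' k (hs y)).hasFDerivAt.comp y (hasFDerivAt_rad (hs y))).differentiableAt
    have hd2 : DifferentiableAt ℝ (fun y : E3 => (y i : ℂ)) y :=
      (Complex.ofRealCLM.comp (EuclideanSpace.proj (𝕜 := ℝ) i)).differentiableAt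
    rw [h2, pderiv_mul hd1 hd2, pderiv_coord, pderiv_comp_rad (hs y) (hasDerivAt_outgoing' k (hs y))]
    ring
  have h3 : ∑ i, (y i : ℂ) ^ 2 = (rad ε y : ℂ) ^ 2 - ε ^ 2 := by
    have := rad_sq ε y
    rw [EuclideanSpace.norm_sq_eq] at this
    simp only [Real.norm_eq_abs, sq_abs] at this
    have h4 : ∑ i, y i ^ 2 = rad ε y ^ 2 - ε ^ 2 := by linarith
    exact_mod_cast congrArg (fun x : ℝ => (x : ℂ)) h4
  rw [divField]
  simp only [h1]
  rw [Finset.sum_add_distrib, ← Finset.mul_sum, ← Finset.sum_div, h3]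
  have hs' : (rad ε y : ℂ) ≠ 0 := Complex.ofReal_ne_zero.2 (hs y)
  simp only [outgoing', outgoing, Finset.sum_const, Finset.card_univ, Fintype.card_fin, nsmul_eq_mul]
  field_simp
  push_cast
  ring

lemma locallyIntegrable_inv_sq (R : ℝ) : IntegrableOn (fun y : E3 => (‖y‖ ^ 2)⁻¹) (ball 0 R) := by
  rw [integrableOn_fun_norm_addHaar volume (f := fun r : ℝ => (r ^ 2)⁻¹)]
  refine IntegrableOn.congr_fun (f := fun _ => (1 : ℝ)) (integrableOn_const (by simp)) ?_
    measurableSet_Ioo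
  intro r hr
  have : r ≠ 0 := hr.1.ne'
  simp [this]

lemma integrable_inv_rad_pow : Integrable (fun z : E3 => (rad 1 z ^ 5)⁻¹) := by
  have h := integrable_rpow_neg_one_add_norm_sq (E := E3) (μ := volume) (r := 5) (by simp; norm_num)
  refine h.congr (Eventually.of_forall fun z => ?_)
  simp only [rad]
  rw [Real.sqrt_eq_rpow, ← Real.rpow_natCast (_ ^ (1 / 2 : ℝ)) 5, ← Real.rpow_mul (by positivity),
    ← Real.rpow_neg (by positivity)]
  norm_num [add_comm]

/-- The normalizing constant of the fundamental solution (its value is `4π`). -/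
noncomputable def fundamentalConst : ℝ := ∫ z : E3, 3 * (rad 1 z ^ 5)⁻¹

lemma fundamentalConst_pos : 0 < fundamentalConst := by
  have hpos : ∀ z : E3, 0 < 3 * (rad 1 z ^ 5)⁻¹ := fun z => by
    have := rad_pos one_pos z; positivity
  rw [fundamentalConst, integral_pos_iff_support_of_nonneg (fun z => (hpos z).le)
    (integrable_inv_rad_pow.const_mul 3)]
  have : Function.support (fun z : E3 => 3 * (rad 1 z ^ 5)⁻¹) = Set.univ :=
    Set.eq_univ_of_forall fun z => (hpos z).ne'
  rw [this]
  simp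

lemma tendsto_rad (y : E3) : Tendsto (fun ε => rad ε y) (𝓝[>] 0) (𝓝 ‖y‖) := by
  have : Continuous fun ε => rad ε y := by unfold rad; fun_prop
  have := (this.tendsto 0).mono_left (nhdsWithin_le_nhds (s := Set.Ioi 0))
  rwa [rad_zero] at this

end Fundamental

section FundamentalIdentity

open Metric InnerProductSpace
open scoped ContDiff

/-- The Helmholtz operator `Δ + k²`. -/
noncomputable def helmholtzOp (k : ℝ) (u : E3 → ℂ) (y : E3) : ℂ :=
  divField (gradField u) y + k ^ 2 * u y

lemma continuous_helmholtzOp (k : ℝ) {u : E3 → ℂ} (hu : ContDiff ℝ 2 u) :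
    Continuous (helmholtzOp k u) := by
  unfold helmholtzOp divField
  exact (continuous_finsetSum _ fun i _ =>
    ((contDiff_pderiv hu i).continuous_fderiv one_ne_zero).clm_apply continuous_const).add
    (continuous_const.mul hu.continuous)

lemma helmholtzOp_congr (k : ℝ) {u v : E3 → ℂ} {y : E3} (h : u =ᶠ[𝓝 y] v) :
    helmholtzOp k u y = helmholtzOp k v y := by
  rw [helmholtzOp, helmholtzOp, h.self_of_nhds]
  congr 1
  refine divField_congr fun i => ?_
  filter_upwards [h.eventually_nhds] with z hz using pderiv_congr hz i

lemma helmholtzOp_zero (k : ℝ) (y : E3) : helmholtzOp k 0 y = 0 := by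
  rw [helmholtzOp, divField_eq_zero fun i => ?_]
  · simp
  · refine Eventually.of_forall fun z => ?_
    simp [gradField, pderiv]

lemma helmholtzOp_eq_zero (k : ℝ) {u : E3 → ℂ} {y : E3} (hy : y ∉ tsupport u) :
    helmholtzOp k u y = 0 := by
  have : u =ᶠ[𝓝 y] 0 := notMem_tsupport_iff_eventuallyEq.1 hy
  rw [helmholtzOp_congr k this, helmholtzOp_zero]

lemma hasCompactSupport_helmholtzOp (k : ℝ) {u : E3 → ℂ} (hc : HasCompactSupport u) :
    HasCompactSupport (helmholtzOp k u) :=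
  HasCompactSupport.intro hc fun _ => helmholtzOp_eq_zero k

lemma ae_ne_zero : ∀ᵐ y : E3, y ≠ 0 := by
  rw [ae_iff]
  simp

lemma inv_le_one_add_inv_sq (r : ℝ) : r⁻¹ ≤ 1 + (r ^ 2)⁻¹ := by
  rw [← inv_pow]
  nlinarith [sq_nonneg (r⁻¹ - 1), sq_nonneg r⁻¹]

/-- An integrable majorant for functions with compact support and singularities of order `|y|⁻²`. -/
lemma exists_integrable_majorant {φ : E3 → ℂ} (hφ : Continuous φ) (hc : HasCompactSupport φ) :
    ∃ b : E3 → ℝ, Integrable b ∧ ∀ y, ‖φ y‖ * (1 + (‖y‖ ^ 2)⁻¹) ≤ b y := by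
  obtain ⟨M, hM⟩ := hφ.bounded_above_of_compact_support hc
  obtain ⟨r, -, hr⟩ := hc.isBounded.subset_ball_lt 0 0
  refine ⟨(ball 0 r).indicator fun y => M * (1 + (‖y‖ ^ 2)⁻¹), ?_, fun y => ?_⟩
  · rw [integrable_indicator_iff measurableSet_ball]
    exact ((integrableOn_const measure_ball_lt_top.ne).add (locallyIntegrable_inv_sq r)).const_mul M
  · by_cases hy : y ∈ ball 0 r
    · rw [Set.indicator_of_mem hy]
      exact mul_le_mul_of_nonneg_right (hM y) (by positivity)
    · rw [Set.indicator_of_notMem hy, image_eq_zero_of_notMem_tsupport fun h => hy (hr h)]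
      simp

lemma tendsto_integral_outgoing (k : ℝ) {ψ : E3 → ℂ} (hψ : Continuous ψ)
    (hc : HasCompactSupport ψ) :
    Tendsto (fun ε => ∫ y, outgoing k (rad ε y) * ψ y) (𝓝[>] 0)
      (𝓝 (∫ y, outgoing k ‖y‖ * ψ y)) := by
  obtain ⟨b, hb, hbψ⟩ := exists_integrable_majorant hψ hc
  refine tendsto_integral_filter_of_dominated_convergence b ?_ ?_ hb ?_
  · filter_upwards [self_mem_nhdsWithin] with ε hε
    have h1 : Continuous fun y => outgoing k (rad ε y) := continuous_iff_continuousAt.2 fun y =>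
      (contDiffAt_outgoing_rad k (rad_pos hε y).ne' (n := 0)).continuousAt
    exact (h1.mul hψ).aestronglyMeasurable
  · filter_upwards [self_mem_nhdsWithin] with ε hε
    filter_upwards [ae_ne_zero] with y hy
    have hy' := norm_pos_iff.2 hy
    refine le_trans ?_ (hbψ y)
    rw [norm_mul, norm_outgoing k (rad_pos hε y).le, mul_comm]
    refine mul_le_mul_of_nonneg_left ?_ (norm_nonneg _)
    exact (inv_anti₀ hy' (norm_le_rad ε y)).trans (inv_le_one_add_inv_sq _)
  · filter_upwards [ae_ne_zero] with y hy
    have h1 : ContinuousAt (outgoing k) ‖y‖ :=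
      (hasDerivAt_outgoing k (norm_ne_zero_iff.2 hy)).continuousAt
    exact (h1.tendsto.comp (tendsto_rad y)).mul_const _

lemma continuous_exp_rad (k ε : ℝ) :
    Continuous fun y => Complex.exp (Complex.I * k * rad ε y) := by
  have h1 := Complex.continuous_ofReal.comp (continuous_rad ε)
  exact (continuous_const.mul h1).cexp

lemma tendsto_integral_lower_order (k : ℝ) {φ : E3 → ℂ} (hφ : Continuous φ)
    (hc : HasCompactSupport φ) :
    Tendsto (fun ε : ℝ => ∫ y, φ y * (Complex.exp (Complex.I * k * rad ε y) *
      (ε ^ 2 * (k ^ 2 / rad ε y ^ 3 + 3 * Complex.I * k / rad ε y ^ 4)))) (𝓝[>] 0) (𝓝 0) := by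
  obtain ⟨b, hb, hbφ⟩ := exists_integrable_majorant hφ hc
  have h0 : (0 : ℂ) = ∫ _ : E3, (0 : ℂ) := by simp
  rw [h0]
  refine tendsto_integral_filter_of_dominated_convergence (fun y => (k ^ 2 + 3 * |k|) * b y) ?_ ?_
    (hb.const_mul _) ?_
  · filter_upwards [self_mem_nhdsWithin] with ε hε
    have h1 := Complex.continuous_ofReal.comp (continuous_rad ε)
    have h2 : ∀ y, (rad ε y : ℂ) ≠ 0 := fun y => Complex.ofReal_ne_zero.2 (rad_pos hε y).ne'
    refine (hφ.mul ((continuous_exp_rad k ε).mul (continuous_const.mul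
      ((continuous_const.div (h1.pow 3) fun y => pow_ne_zero 3 (h2 y)).add
      (continuous_const.div (h1.pow 4) fun y => pow_ne_zero 4 (h2 y)))))).aestronglyMeasurable
  · filter_upwards [self_mem_nhdsWithin] with ε hε
    filter_upwards [ae_ne_zero] with y hy
    have hε : 0 < ε := hε
    have hy' := norm_pos_iff.2 hy
    have hs := rad_pos hε y
    have h1 : ε ^ 2 ≤ rad ε y ^ 2 := pow_le_pow_left₀ hε.le (le_rad y) 2
    have h2 : (rad ε y)⁻¹ ≤ 1 + (‖y‖ ^ 2)⁻¹ :=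
      (inv_anti₀ hy' (norm_le_rad ε y)).trans (inv_le_one_add_inv_sq _)
    have h3 : (rad ε y ^ 2)⁻¹ ≤ 1 + (‖y‖ ^ 2)⁻¹ :=
      (inv_anti₀ (by positivity) (pow_le_pow_left₀ hy'.le (norm_le_rad ε y) 2)).trans (by linarith)
    have h4 : ‖(ε : ℂ) ^ 2 * (k ^ 2 / rad ε y ^ 3 + 3 * Complex.I * k / rad ε y ^ 4)‖
        ≤ k ^ 2 * (rad ε y)⁻¹ + 3 * |k| * (rad ε y ^ 2)⁻¹ := by
      rw [norm_mul]
      calc ‖(ε : ℂ) ^ 2‖ * ‖(k ^ 2 / rad ε y ^ 3 + 3 * Complex.I * k / rad ε y ^ 4 : ℂ)‖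
          ≤ rad ε y ^ 2 * (k ^ 2 / rad ε y ^ 3 + 3 * |k| / rad ε y ^ 4) := by
            refine mul_le_mul ?_ ?_ (norm_nonneg _) (by positivity)
            · simpa using h1
            · refine (norm_add_le _ _).trans_eq ?_
              simp [abs_of_pos hs]
        _ = _ := by field_simp
    rw [norm_mul, norm_mul, norm_exp_I_mul, one_mul]
    calc ‖φ y‖ * _ ≤ ‖φ y‖ * ((k ^ 2 + 3 * |k|) * (1 + (‖y‖ ^ 2)⁻¹)) := by
          refine mul_le_mul_of_nonneg_left (h4.trans ?_) (norm_nonneg _)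
          rw [add_mul]
          gcongr
      _ = (k ^ 2 + 3 * |k|) * (‖φ y‖ * (1 + (‖y‖ ^ 2)⁻¹)) := by ring
      _ ≤ _ := mul_le_mul_of_nonneg_left (hbφ y) (by positivity)
  · filter_upwards [ae_ne_zero] with y hy
    have hy' : ((‖y‖ : ℝ) : ℂ) ≠ 0 := Complex.ofReal_ne_zero.2 (norm_ne_zero_iff.2 hy)
    have h1 : Tendsto (fun ε => (rad ε y : ℂ)) (𝓝[>] 0) (𝓝 ((‖y‖ : ℝ) : ℂ)) :=
      (Complex.continuous_ofReal.tendsto _).comp (tendsto_rad y)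
    have h2 : Tendsto (fun ε : ℝ => (ε : ℂ)) (𝓝[>] 0) (𝓝 0) := by
      have := (Complex.continuous_ofReal.tendsto 0).mono_left (nhdsWithin_le_nhds (s := Set.Ioi 0))
      simpa using this
    have h3 := ((h1.const_mul (Complex.I * k)).cexp).mul ((h2.pow 2).mul
      ((tendsto_const_nhds (x := (k : ℂ) ^ 2)).div (h1.pow 3) (pow_ne_zero 3 hy') |>.add
      ((tendsto_const_nhds (x := 3 * Complex.I * (k : ℂ))).div (h1.pow 4) (pow_ne_zero 4 hy'))))
    simpa using h3.const_mul (φ y)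

lemma rad_smul {ε : ℝ} (hε : 0 < ε) (z : E3) : rad ε (ε • z) = ε * rad 1 z := by
  rw [rad, rad, norm_smul, Real.norm_of_nonneg hε.le]
  rw [show (ε * ‖z‖) ^ 2 + ε ^ 2 = ε ^ 2 * (‖z‖ ^ 2 + 1 ^ 2) by ring, Real.sqrt_mul (by positivity),
    Real.sqrt_sq hε.le]

/-- Concentration of the leading part of the regularized source at the origin. -/
lemma tendsto_integral_source (k : ℝ) {φ : E3 → ℂ} (hφ : Continuous φ)
    (hc : HasCompactSupport φ) :
    Tendsto (fun ε : ℝ => ∫ y, φ y * (Complex.exp (Complex.I * k * rad ε y) *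
      (ε ^ 2 * (3 / rad ε y ^ 5)))) (𝓝[>] 0) (𝓝 (fundamentalConst * φ 0)) := by
  obtain ⟨M, hM⟩ := hφ.bounded_above_of_compact_support hc
  have h1 : ∀ ε : ℝ, 0 < ε → ∫ y, φ y * (Complex.exp (Complex.I * k * rad ε y) *
      (ε ^ 2 * (3 / rad ε y ^ 5)))
      = ∫ z, φ (ε • z) * (Complex.exp (Complex.I * k * (ε * rad 1 z : ℝ)) *
        ((3 * (rad 1 z ^ 5)⁻¹ : ℝ) : ℂ)) := by
    intro ε hε
    have h2 := Measure.integral_comp_smul (volume : Measure E3) (fun y =>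
      φ y * (Complex.exp (Complex.I * k * rad ε y) * (ε ^ 2 * (3 / rad ε y ^ 5)))) ε
    have hfr : Module.finrank ℝ E3 = 3 := by simp
    rw [hfr, abs_of_pos (by positivity), eq_inv_smul_iff₀ (by positivity)] at h2
    rw [← h2, ← integral_smul]
    congr 1
    funext z
    have hz : (rad 1 z : ℂ) ≠ 0 := Complex.ofReal_ne_zero.2 (rad_pos one_pos z).ne'
    have hε' : (ε : ℂ) ≠ 0 := Complex.ofReal_ne_zero.2 hε.ne'
    rw [rad_smul hε, Complex.real_smul]
    push_cast
    field_simp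
  have h3 : (fundamentalConst * φ 0 : ℂ) = ∫ z, φ 0 * ((3 * (rad 1 z ^ 5)⁻¹ : ℝ) : ℂ) := by
    rw [integral_const_mul, fundamentalConst, mul_comm]
    congr 1
    exact integral_ofReal.symm
  rw [h3]
  refine Tendsto.congr' (f₁ := fun ε : ℝ => ∫ z, φ (ε • z) *
    (Complex.exp (Complex.I * k * (ε * rad 1 z : ℝ)) * ((3 * (rad 1 z ^ 5)⁻¹ : ℝ) : ℂ))) ?_ ?_
  · filter_upwards [self_mem_nhdsWithin] with ε hε using (h1 ε hε).symm
  have hr := continuous_rad 1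
  have hr0 : ∀ z, rad 1 z ^ 5 ≠ 0 := fun z => pow_ne_zero 5 (rad_pos one_pos z).ne'
  refine tendsto_integral_filter_of_dominated_convergence (fun z => M * (3 * (rad 1 z ^ 5)⁻¹)) ?_ ?_
    ((integrable_inv_rad_pow.const_mul 3).const_mul M) ?_
  · refine Eventually.of_forall fun ε => Continuous.aestronglyMeasurable ?_
    refine (hφ.comp (continuous_const_smul ε)).mul (Continuous.mul ?_ ?_)
    · exact (continuous_const.mul (Complex.continuous_ofReal.comp (continuous_const.mul hr))).cexp
    · exact Complex.continuous_ofReal.comp (continuous_const.mul ((hr.pow 5).inv₀ hr0))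
  · refine Eventually.of_forall fun ε => Eventually.of_forall fun z => ?_
    have hp := rad_pos one_pos z
    rw [norm_mul, norm_mul, norm_exp_I_mul, one_mul, Complex.norm_real,
      Real.norm_of_nonneg (by positivity)]
    exact mul_le_mul_of_nonneg_right (hM _) (by positivity)
  · refine Eventually.of_forall fun z => ?_
    have hcont : Continuous fun ε : ℝ => φ (ε • z) * (Complex.exp (Complex.I * k *
        (ε * rad 1 z : ℝ)) * ((3 * (rad 1 z ^ 5)⁻¹ : ℝ) : ℂ)) := by
      refine (hφ.comp (continuous_id.smul continuous_const)).mul (Continuous.mul ?_ continuous_const)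
      exact (continuous_const.mul (Complex.continuous_ofReal.comp
        (continuous_id.mul continuous_const))).cexp
    have := (hcont.tendsto 0).mono_left (nhdsWithin_le_nhds (s := Set.Ioi 0))
    simpa using this

lemma integral_outgoing_mul_helmholtzOp_zero (k : ℝ) {φ : E3 → ℂ} (hφ : ContDiff ℝ 2 φ)
    (hc : HasCompactSupport φ) :
    ∫ y, outgoing k ‖y‖ * helmholtzOp k φ y = - (fundamentalConst * φ 0) := by
  have h1 := tendsto_integral_outgoing k (continuous_helmholtzOp k hφ)
    (hasCompactSupport_helmholtzOp k hc)
  have h2 := (tendsto_integral_lower_order k hφ.continuous hc).sub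
    (tendsto_integral_source k hφ.continuous hc)
  rw [zero_sub] at h2
  refine tendsto_nhds_unique h1 (h2.congr' ?_)
  filter_upwards [self_mem_nhdsWithin] with ε hε
  have hε : 0 < ε := hε
  have hr := Complex.continuous_ofReal.comp (continuous_rad ε)
  have hr0 : ∀ y, (rad ε y : ℂ) ≠ 0 := fun y => Complex.ofReal_ne_zero.2 (rad_pos hε y).ne'
  have hG : ContDiff ℝ 2 (fun y => outgoing k (rad ε y)) := contDiff_iff_contDiffAt.2 fun y =>
    contDiffAt_outgoing_rad k (rad_pos hε y).ne' (n := 2)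
  rw [← integral_sub]
  · have hdc : Continuous (divField (gradField φ)) :=
      continuous_finsetSum _ fun i _ =>
        ((contDiff_pderiv hφ i).continuous_fderiv one_ne_zero).clm_apply continuous_const
    have hdcG : Continuous (divField (gradField fun y => outgoing k (rad ε y))) :=
      continuous_finsetSum _ fun i _ =>
        ((contDiff_pderiv hG i).continuous_fderiv one_ne_zero).clm_apply continuous_const
    have hdcs : HasCompactSupport (divField (gradField φ)) := by
      have := hasCompactSupport_helmholtzOp 0 hc
      refine this.mono' fun y hy => subset_tsupport _ ?_
      simpa [helmholtzOp] using hy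
    have e1 : ∫ y, outgoing k (rad ε y) * helmholtzOp k φ y
        = (∫ y, outgoing k (rad ε y) * divField (gradField φ) y)
          + ∫ y, φ y * (k ^ 2 * outgoing k (rad ε y)) := by
      rw [← integral_add]
      · congr 1
        funext y
        rw [helmholtzOp]
        ring
      · exact (hG.continuous.mul hdc).integrable_of_hasCompactSupport hdcs.mul_left
      · exact (hφ.continuous.mul (continuous_const.mul
          hG.continuous)).integrable_of_hasCompactSupport hc.mul_right
    rw [e1, integral_green hG hφ hc, ← integral_add]
    · congr 1
      funext y
      rw [← mul_add, divField_gradField_outgoing k hε]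
      ring
    · exact (hφ.continuous.mul hdcG).integrable_of_hasCompactSupport hc.mul_right
    · exact (hφ.continuous.mul (continuous_const.mul
          hG.continuous)).integrable_of_hasCompactSupport hc.mul_right
  · refine Continuous.integrable_of_hasCompactSupport ?_ hc.mul_right
    exact hφ.continuous.mul ((continuous_exp_rad k ε).mul (continuous_const.mul
      ((continuous_const.div (hr.pow 3) fun y => pow_ne_zero 3 (hr0 y)).add
      (continuous_const.div (hr.pow 4) fun y => pow_ne_zero 4 (hr0 y)))))
  · refine Continuous.integrable_of_hasCompactSupport ?_ hc.mul_right
    exact hφ.continuous.mul ((continuous_exp_rad k ε).mul (continuous_const.mul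
      (continuous_const.div (hr.pow 5) fun y => pow_ne_zero 5 (hr0 y))))

lemma pderiv_comp_add (i : Fin 3) (u : E3 → ℂ) (x y : E3) :
    pderiv i (fun z => u (z + x)) y = pderiv i u (y + x) := by
  rw [pderiv, fderiv_comp_add_right]

lemma helmholtzOp_comp_add (k : ℝ) (u : E3 → ℂ) (x y : E3) :
    helmholtzOp k (fun z => u (z + x)) y = helmholtzOp k u (y + x) := by
  have h1 : gradField (fun z => u (z + x)) = fun i z => gradField u i (z + x) := by
    funext i z
    exact pderiv_comp_add i u x z
  rw [helmholtzOp, helmholtzOp, h1, divField, divField]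
  congr 1
  exact Finset.sum_congr rfl fun i _ => pderiv_comp_add i _ x y

/-- The outgoing spherical wave is, up to a constant factor, a fundamental solution of the Helmholtz
equation. -/
theorem integral_outgoing_mul_helmholtzOp (k : ℝ) {φ : E3 → ℂ} (hφ : ContDiff ℝ 2 φ)
    (hc : HasCompactSupport φ) (x : E3) :
    ∫ y, outgoing k ‖x - y‖ * helmholtzOp k φ y = - (fundamentalConst * φ x) := by
  have h1 := integral_outgoing_mul_helmholtzOp_zero k (φ := fun z => φ (z + x))
    (hφ.comp (contDiff_id.add contDiff_const))
    (hc.comp_homeomorph (Homeomorph.addRight x))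
  simp only [helmholtzOp_comp_add, zero_add] at h1
  rw [← h1, ← integral_add_right_eq_self _ x]
  congr 1
  funext y
  rw [sub_add_cancel_right, norm_neg]

end FundamentalIdentity

/-! ### Radial cutoff functions -/

section Cutoff

open Metric InnerProductSpace
open scoped ContDiff

/-- A radial cutoff function: it is `1` on the ball of radius `R` and `0` outside of the ball of
radius `2R`. -/
noncomputable def cutoff (R : ℝ) (y : E3) : ℝ := Real.smoothTransition (2 - ‖y‖ ^ 2 / R ^ 2)

/-- The density `b ≥ 0` with `∇ (cutoff R) = - b(y) y`. -/
noncomputable def cutoffDensity (R : ℝ) (y : E3) : ℝ :=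
  deriv Real.smoothTransition (2 - ‖y‖ ^ 2 / R ^ 2) * (2 / R ^ 2)

variable {R : ℝ}

lemma contDiff_cutoff (R : ℝ) {n : ℕ∞} : ContDiff ℝ n (cutoff R) := by
  unfold cutoff
  exact Real.smoothTransition.contDiff.comp
    (contDiff_const.sub ((contDiff_norm_sq ℝ).div_const _))

lemma contDiff_cutoff_complex (R : ℝ) {n : ℕ∞} : ContDiff ℝ n (fun y => (cutoff R y : ℂ)) :=
  Complex.ofRealCLM.contDiff.comp (contDiff_cutoff R)

lemma cutoff_nonneg (R : ℝ) (y : E3) : 0 ≤ cutoff R y := Real.smoothTransition.nonneg _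

lemma cutoff_le_one (R : ℝ) (y : E3) : cutoff R y ≤ 1 := Real.smoothTransition.le_one _

lemma cutoff_eq_one (hR : 0 < R) {y : E3} (hy : ‖y‖ ≤ R) : cutoff R y = 1 := by
  refine Real.smoothTransition.one_of_one_le ?_
  have : ‖y‖ ^ 2 / R ^ 2 ≤ 1 := by
    rw [div_le_one (by positivity)]
    exact pow_le_pow_left₀ (norm_nonneg _) hy 2
  linarith

lemma cutoff_eq_zero (hR : 0 < R) {y : E3} (hy : 2 * R ≤ ‖y‖) : cutoff R y = 0 := by
  refine Real.smoothTransition.zero_of_nonpos ?_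
  have : 2 ≤ ‖y‖ ^ 2 / R ^ 2 := by
    rw [le_div_iff₀ (by positivity)]
    nlinarith
  linarith

lemma hasCompactSupport_cutoff (hR : 0 < R) : HasCompactSupport (fun y => (cutoff R y : ℂ)) :=
  HasCompactSupport.intro (isCompact_closedBall 0 (2 * R)) fun y hy => by
    rw [mem_closedBall_zero_iff, not_le] at hy
    rw [cutoff_eq_zero hR hy.le, Complex.ofReal_zero]

lemma tendsto_cutoff (y : E3) : Tendsto (fun R => cutoff R y) atTop (𝓝 1) := by
  refine tendsto_const_nhds.congr' ?_
  filter_upwards [eventually_ge_atTop ‖y‖, eventually_gt_atTop 0] with R hR1 hR2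
  exact (cutoff_eq_one hR2 hR1).symm

lemma differentiable_smoothTransition : Differentiable ℝ Real.smoothTransition :=
  (Real.smoothTransition.contDiff (n := 1)).differentiable one_ne_zero

lemma pderiv_cutoff (R : ℝ) (i : Fin 3) (y : E3) :
    pderiv i (fun y => (cutoff R y : ℂ)) y = - (cutoffDensity R y * y i) := by
  have h1 : HasFDerivAt (fun y : E3 => 2 - ‖y‖ ^ 2 / R ^ 2) (-((R ^ 2)⁻¹ • (2 • innerSL ℝ y))) y := by
    simpa [div_eq_inv_mul] using
      ((hasStrictFDerivAt_norm_sq y).hasFDerivAt.const_mul (R ^ 2)⁻¹).const_sub 2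
  have h2 := (differentiable_smoothTransition (2 - ‖y‖ ^ 2 / R ^ 2)).hasDerivAt.hasFDerivAt.comp y h1
  have h3 : HasFDerivAt (fun y => (cutoff R y : ℂ)) _ y := Complex.ofRealCLM.hasFDerivAt.comp y h2
  rw [pderiv, h3.fderiv]
  simp [cutoffDensity, EuclideanSpace.inner_single_right]
  ring

lemma deriv_smoothTransition_nonneg (t : ℝ) : 0 ≤ deriv Real.smoothTransition t :=
  Real.smoothTransition.monotone.deriv_nonneg

lemma cutoffDensity_nonneg (R : ℝ) (y : E3) : 0 ≤ cutoffDensity R y :=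
  mul_nonneg (deriv_smoothTransition_nonneg _) (by positivity)

lemma continuous_deriv_smoothTransition : Continuous (deriv Real.smoothTransition) :=
  (Real.smoothTransition.contDiff (n := 1)).continuous_deriv le_rfl

lemma continuous_cutoffDensity (R : ℝ) : Continuous (cutoffDensity R) := by
  unfold cutoffDensity
  exact (continuous_deriv_smoothTransition.comp (by fun_prop)).mul continuous_const

lemma deriv_smoothTransition_of_one_lt {t : ℝ} (ht : 1 < t) :
    deriv Real.smoothTransition t = 0 := by
  have : Real.smoothTransition =ᶠ[𝓝 t] fun _ => 1 := by
    filter_upwards [lt_mem_nhds ht] with s hs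
    exact Real.smoothTransition.one_of_one_le hs.le
  rw [this.deriv_eq, deriv_const]

lemma deriv_smoothTransition_of_neg {t : ℝ} (ht : t < 0) :
    deriv Real.smoothTransition t = 0 := by
  have : Real.smoothTransition =ᶠ[𝓝 t] fun _ => 0 := by
    filter_upwards [gt_mem_nhds ht] with s hs
    exact Real.smoothTransition.zero_of_nonpos hs.le
  rw [this.deriv_eq, deriv_const]

lemma cutoffDensity_of_lt (hR : 0 < R) {y : E3} (hy : ‖y‖ < R) : cutoffDensity R y = 0 := by
  rw [cutoffDensity, deriv_smoothTransition_of_one_lt, zero_mul]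
  have : ‖y‖ ^ 2 / R ^ 2 < 1 := by
    rw [div_lt_one (by positivity)]
    exact pow_lt_pow_left₀ hy (norm_nonneg _) two_ne_zero
  linarith

lemma cutoffDensity_of_gt (hR : 0 < R) {y : E3} (hy : 2 * R < ‖y‖) : cutoffDensity R y = 0 := by
  rw [cutoffDensity, deriv_smoothTransition_of_neg, zero_mul]
  have : 2 < ‖y‖ ^ 2 / R ^ 2 := by
    rw [lt_div_iff₀ (by positivity)]
    nlinarith
  linarith

lemma mem_of_cutoffDensity_ne_zero (hR : 0 < R) {y : E3} (hy : cutoffDensity R y ≠ 0) :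
    R ≤ ‖y‖ ∧ ‖y‖ ≤ 2 * R := by
  constructor
  · by_contra! h; exact hy (cutoffDensity_of_lt hR h)
  · by_contra! h; exact hy (cutoffDensity_of_gt hR h)

lemma hasCompactSupport_cutoffDensity (hR : 0 < R) : HasCompactSupport (cutoffDensity R) :=
  HasCompactSupport.intro (isCompact_closedBall 0 (2 * R)) fun y hy => by
    rw [mem_closedBall_zero_iff, not_le] at hy
    exact cutoffDensity_of_gt hR hy

/-- The weight `cutoffDensity R` has total mass of order `R`. -/
lemma exists_cutoffDensity_bound : ∃ B : ℝ, 0 < B ∧ ∀ (R m : ℝ) (g : E3 → ℂ), 0 < R →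
    (∀ y, R ≤ ‖y‖ → ‖y‖ ≤ 2 * R → ‖g y‖ ≤ m) →
    ‖∫ y, (cutoffDensity R y : ℂ) * g y‖ ≤ B * R * m := by
  obtain ⟨M, hM⟩ : ∃ M, ∀ t, ‖deriv Real.smoothTransition t‖ ≤ M := by
    refine continuous_deriv_smoothTransition.bounded_above_of_compact_support ?_
    refine HasCompactSupport.intro (isCompact_Icc (a := (0 : ℝ)) (b := 1)) fun t ht => ?_
    rw [Set.mem_Icc, not_and_or, not_le, not_le] at ht
    rcases ht with ht | ht
    · exact deriv_smoothTransition_of_neg ht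
    · exact deriv_smoothTransition_of_one_lt ht
  have hM0 : 0 ≤ M := (norm_nonneg _).trans (hM 0)
  set v := volume.real (closedBall (0 : E3) 1) with hv
  refine ⟨M * 2 * 8 * v + 1, by positivity, fun R m g hR hg => ?_⟩
  have hm : 0 ≤ m := by
    obtain ⟨y, hy⟩ : ∃ y : E3, ‖y‖ = R := by
      refine ⟨EuclideanSpace.single 0 R, ?_⟩
      simp [abs_of_pos hR]
    exact (norm_nonneg _).trans (hg y hy.ge (by linarith))
  have h1 : ∫ y, (cutoffDensity R y : ℂ) * g y
      = ∫ y in closedBall (0 : E3) (2 * R), (cutoffDensity R y : ℂ) * g y := by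
    refine (setIntegral_eq_integral_of_forall_compl_eq_zero fun y hy => ?_).symm
    rw [mem_closedBall_zero_iff, not_le] at hy
    rw [cutoffDensity_of_gt hR hy, Complex.ofReal_zero, zero_mul]
  rw [h1]
  have h2 : ∀ y ∈ closedBall (0 : E3) (2 * R),
      ‖(cutoffDensity R y : ℂ) * g y‖ ≤ M * (2 / R ^ 2) * m := by
    intro y _
    by_cases hy : cutoffDensity R y = 0
    · rw [hy, Complex.ofReal_zero, zero_mul, norm_zero]; positivity
    · obtain ⟨hy1, hy2⟩ := mem_of_cutoffDensity_ne_zero hR hy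
      rw [norm_mul]
      refine mul_le_mul ?_ (hg y hy1 hy2) (norm_nonneg _) (by positivity)
      rw [Complex.norm_real, cutoffDensity, norm_mul, Real.norm_of_nonneg (by positivity : 0 ≤ 2 / R ^ 2)]
      exact mul_le_mul_of_nonneg_right (hM _) (by positivity)
  refine (norm_setIntegral_le_of_norm_le_const measure_closedBall_lt_top h2).trans ?_
  have h3 : volume.real (closedBall (0 : E3) (2 * R)) = 8 * R ^ 3 * v := by
    have hfr : Module.finrank ℝ E3 = 3 := by simp
    rw [hv, Measure.addHaar_real_closedBall _ _ (by positivity), hfr,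
      Measure.addHaar_real_closedBall_eq_addHaar_real_ball]
    ring
  rw [h3]
  calc M * (2 / R ^ 2) * m * (8 * R ^ 3 * v) = (M * 2 * 8 * v) * R * m := by field_simp
    _ ≤ (M * 2 * 8 * v + 1) * R * m := by gcongr; linarith

/-- The divergence theorem with a cutoff function. -/
lemma integral_cutoff_mul_divField (hR : 0 < R) {X : Fin 3 → E3 → ℂ}
    (hX : ∀ i, ContDiff ℝ 1 (X i)) :
    ∫ y, (cutoff R y : ℂ) * divField X y = ∫ y, (cutoffDensity R y : ℂ) * ∑ i, y i * X i y := by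
  have hcs := hasCompactSupport_cutoff hR
  have hcd := contDiff_cutoff_complex R (n := 1)
  have h1 := integral_divField_eq_zero (X := fun i y => (cutoff R y : ℂ) * X i y)
    (fun i => hcd.mul (hX i)) (fun i => hcs.mul_right)
  have h2 : ∀ y, divField (fun i y => (cutoff R y : ℂ) * X i y) y
      = (cutoff R y : ℂ) * divField X y - (cutoffDensity R y : ℂ) * ∑ i, y i * X i y := by
    intro y
    simp only [divField, Finset.mul_sum, ← Finset.sum_sub_distrib]
    refine Finset.sum_congr rfl fun i _ => ?_
    rw [pderiv_mul (hcd.differentiable one_ne_zero y) ((hX i).differentiable one_ne_zero y),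
      pderiv_cutoff]
    ring
  simp only [h2] at h1
  rwa [integral_sub, sub_eq_zero] at h1
  · have hdc : Continuous (divField X) := continuous_finsetSum _ fun i _ =>
      ((hX i).continuous_fderiv one_ne_zero).clm_apply continuous_const
    exact (hcd.continuous.mul hdc).integrable_of_hasCompactSupport hcs.mul_right
  · refine Continuous.integrable_of_hasCompactSupport ?_ ?_
    · refine (Complex.continuous_ofReal.comp (continuous_cutoffDensity R)).mul
        (continuous_finsetSum _ fun i _ => Continuous.mul ?_ (hX i).continuous)
      fun_prop
    · exact ((hasCompactSupport_cutoffDensity hR).comp_left Complex.ofReal_zero).mul_right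

end Cutoff

/-! ### Consequences of the radiation condition -/

section Radiation

open Metric InnerProductSpace
open scoped ContDiff

lemma fderiv_apply_eq_sum (u : E3 → ℂ) (x v : E3) :
    fderiv ℝ u x v = ∑ i, (v i : ℂ) * pderiv i u x := by
  have h1 : v = ∑ i, v i • (EuclideanSpace.single i (1 : ℝ) : E3) := by
    ext j
    simp [Finset.sum_apply, Pi.single_apply]
  conv_lhs => rw [h1]
  rw [map_sum]
  exact Finset.sum_congr rfl fun i _ => by rw [map_smul, Complex.real_smul]

/-- `r` times the defect `∂u/∂r - iku` in the radiation condition. -/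
noncomputable def radDefect (k : ℝ) (u : E3 → ℂ) (y : E3) : ℂ :=
  fderiv ℝ u y y - Complex.I * k * ‖y‖ * u y

lemma SommerfeldRadiation.tendsto_radDefect {k : ℝ} {u : E3 → ℂ} (h : SommerfeldRadiation k u) :
    Tendsto (radDefect k u) (Bornology.cobounded E3) (𝓝 0) := by
  refine Tendsto.congr' ?_ h
  filter_upwards [Bornology.eventually_ne_cobounded 0] with y hy
  have hy' : (‖y‖ : ℂ) ≠ 0 := Complex.ofReal_ne_zero.2 (norm_ne_zero_iff.2 hy)
  rw [map_smul, Complex.real_smul, radDefect]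
  push_cast
  field_simp

lemma SommerfeldRadiation.exists_bound {k : ℝ} {u : E3 → ℂ} (h : SommerfeldRadiation k u) {η : ℝ}
    (hη : 0 < η) : ∃ R₀, 0 < R₀ ∧ ∀ y, R₀ ≤ ‖y‖ → ‖radDefect k u y‖ ≤ η := by
  have h1 := h.tendsto_radDefect (closedBall_mem_nhds _ hη)
  obtain ⟨R₀, hR₀⟩ := (hasBasis_cobounded_norm.mem_iff.1 (mem_map.1 h1))
  refine ⟨max R₀ 1, by positivity, fun y hy => ?_⟩
  simpa using hR₀.2 ((le_max_left _ _).trans hy)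

variable {k : ℝ} {w : E3 → ℂ}

lemma pderiv_conj {u : E3 → ℂ} (i : Fin 3) (x : E3) :
    pderiv i (fun y => starRingEnd ℂ (u y)) x = starRingEnd ℂ (pderiv i u x) := by
  have h1 : (fun y => starRingEnd ℂ (u y)) = Complex.conjCLE ∘ u := rfl
  rw [pderiv, h1, Complex.conjCLE.comp_fderiv]
  rfl

/-- The integrals of `|w|²` over the spheres `|y| = r`, averaged over the shell `R ≤ r ≤ 2R`, are
bounded uniformly in `R`: the energy flux through a sphere bounds them, and it does not grow. -/
lemma exists_shell_bound (hk : 0 < k) (hw : ContDiff ℝ 2 w)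
    (hf : HasCompactSupport (helmholtzOp k w)) (hrad : SommerfeldRadiation k w) :
    ∃ C R₀ : ℝ, 0 < R₀ ∧ ∀ R, R₀ ≤ R →
      ∫ y, cutoffDensity R y * (‖y‖ * ‖w y‖ ^ 2) ≤ C := by
  obtain ⟨B, hB, hBound⟩ := exists_cutoffDensity_bound
  obtain ⟨R₀, hR₀, hS⟩ := hrad.exists_bound one_pos
  have hw1 := hw.of_le (m := 1) (by norm_num)
  have hwc : ContDiff ℝ 1 (fun y => starRingEnd ℂ (w y)) := Complex.conjCLE.contDiff.comp hw1
  have hDc : Continuous fun y => fderiv ℝ w y y :=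
    (hw.continuous_fderiv two_ne_zero).clm_apply continuous_id
  have hSc : Continuous (radDefect k w) := by
    unfold radDefect
    exact hDc.sub ((continuous_const.mul
      (Complex.continuous_ofReal.comp continuous_norm)).mul hw.continuous)
  have hfc := continuous_helmholtzOp k hw
  refine ⟨(B + 2 * k * ∫ y, ‖starRingEnd ℂ (w y) * helmholtzOp k w y‖) / k ^ 2, R₀, hR₀,
    fun R hR => ?_⟩
  have hRpos : 0 < R := hR₀.trans_le hR
  have hcs := hasCompactSupport_cutoffDensity hRpos
  have hcc := continuous_cutoffDensity R
  have hInt : ∀ {g : E3 → ℝ}, Continuous g → Integrable fun y => cutoffDensity R y * g y :=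
    fun hg => (hcc.mul hg).integrable_of_hasCompactSupport hcs.mul_right
  have hfi : Integrable fun y => starRingEnd ℂ (w y) * helmholtzOp k w y :=
    (hwc.continuous.mul hfc).integrable_of_hasCompactSupport hf.mul_left
  -- the energy flux through the shell
  have hflux : ∫ y, cutoffDensity R y * (starRingEnd ℂ (w y) * fderiv ℝ w y y).im
      = ∫ y, (cutoff R y * (starRingEnd ℂ (w y) * helmholtzOp k w y)).im := by
    have h1 := integral_cutoff_mul_divField hRpos
      (X := fun i y => starRingEnd ℂ (w y) * pderiv i w y)
      (fun i => hwc.mul (contDiff_pderiv hw i))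
    have h2 : ∀ y, divField (fun i y => starRingEnd ℂ (w y) * pderiv i w y) y
        = ∑ i, (Complex.normSq (pderiv i w y) : ℂ) + starRingEnd ℂ (w y) * helmholtzOp k w y
          - k ^ 2 * (Complex.normSq (w y) : ℂ) := by
      intro y
      have h3 : divField (fun i y => starRingEnd ℂ (w y) * pderiv i w y) y
          = starRingEnd ℂ (w y) * divField (gradField w) y
            + ∑ i, (Complex.normSq (pderiv i w y) : ℂ) := by
        simp only [divField, gradField, Finset.mul_sum, ← Finset.sum_add_distrib]
        refine Finset.sum_congr rfl fun i _ => ?_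
        rw [pderiv_mul (hwc.differentiable one_ne_zero y)
          ((contDiff_pderiv hw i).differentiable one_ne_zero y), pderiv_conj,
          Complex.normSq_eq_conj_mul_self]
      rw [h3, helmholtzOp, Complex.normSq_eq_conj_mul_self]
      ring
    have h4 : ∀ y, ∑ i, (y i : ℂ) * (starRingEnd ℂ (w y) * pderiv i w y)
        = starRingEnd ℂ (w y) * fderiv ℝ w y y := by
      intro y
      rw [fderiv_apply_eq_sum, Finset.mul_sum]
      exact Finset.sum_congr rfl fun i _ => by ring
    simp only [h4] at h1
    have h5 : Integrable fun y => (cutoffDensity R y : ℂ) *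
        (starRingEnd ℂ (w y) * fderiv ℝ w y y) :=
      ((Complex.continuous_ofReal.comp hcc).mul
        (hwc.continuous.mul hDc)).integrable_of_hasCompactSupport
        (hcs.comp_left Complex.ofReal_zero).mul_right
    have hdX : Continuous (divField (fun i y => starRingEnd ℂ (w y) * pderiv i w y)) :=
      continuous_finsetSum _ fun i _ => ((hwc.mul (contDiff_pderiv hw i)).continuous_fderiv
        one_ne_zero).clm_apply continuous_const
    have h6 : Integrable fun y => (cutoff R y : ℂ) *
        divField (fun i y => starRingEnd ℂ (w y) * pderiv i w y) y :=
      ((contDiff_cutoff_complex R (n := 0)).continuous.mul hdX).integrable_of_hasCompactSupport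
        (hasCompactSupport_cutoff hRpos).mul_right
    have h7 := congrArg Complex.im h1
    rw [← RCLike.im_eq_complex_im, ← integral_im h5, ← integral_im h6] at h7
    simp only [RCLike.im_eq_complex_im, Complex.im_ofReal_mul] at h7
    rw [← h7]
    congr 1
    funext y
    rw [h2, Complex.im_ofReal_mul]
    congr 1
    rw [← Complex.ofReal_sum, ← Complex.ofReal_pow]
    simp [Complex.sub_im, Complex.add_im, ← Complex.ofReal_mul, -Complex.ofReal_pow]
  have hfluxle : ∫ y, cutoffDensity R y * (starRingEnd ℂ (w y) * fderiv ℝ w y y).im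
      ≤ ∫ y, ‖starRingEnd ℂ (w y) * helmholtzOp k w y‖ := by
    rw [hflux]
    have h1 : Integrable fun y => (cutoff R y : ℂ) * (starRingEnd ℂ (w y) * helmholtzOp k w y) :=
      ((contDiff_cutoff_complex R (n := 0)).continuous.mul
        (hwc.continuous.mul hfc)).integrable_of_hasCompactSupport
        (hasCompactSupport_cutoff hRpos).mul_right
    refine integral_mono h1.im hfi.norm fun y => ?_
    refine ((le_abs_self _).trans (Complex.abs_im_le_norm _)).trans ?_
    rw [norm_mul, Complex.norm_real, Real.norm_of_nonneg (cutoff_nonneg R y)]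
    exact mul_le_of_le_one_left (norm_nonneg _) (cutoff_le_one R y)
  have hmass : ∫ y, cutoffDensity R y * R⁻¹ ≤ B := by
    have h1 := hBound R R⁻¹ (fun _ => ((R⁻¹ : ℝ) : ℂ)) hRpos fun y _ _ => by
      rw [Complex.norm_real, Real.norm_of_nonneg (by positivity)]
    have h2 : ∫ y, (cutoffDensity R y : ℂ) * ((R⁻¹ : ℝ) : ℂ)
        = ((∫ y, cutoffDensity R y * R⁻¹ : ℝ) : ℂ) := by
      simp only [← Complex.ofReal_mul]
      exact integral_ofReal
    rw [h2, Complex.norm_real, mul_inv_cancel_right₀ hRpos.ne'] at h1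
    exact (le_abs_self _).trans h1
  have hpt : ∀ y, cutoffDensity R y * (k ^ 2 * (‖y‖ * ‖w y‖ ^ 2)) ≤ cutoffDensity R y * R⁻¹
      + 2 * k * (cutoffDensity R y * (starRingEnd ℂ (w y) * fderiv ℝ w y y).im) := by
    intro y
    by_cases hy : cutoffDensity R y = 0
    · simp [hy]
    obtain ⟨hy1, -⟩ := mem_of_cutoffDensity_ne_zero hRpos hy
    have hypos : 0 < ‖y‖ := hRpos.trans_le hy1
    have h1 := hS y (hR.trans hy1)
    have h2 : ‖radDefect k w y‖ ^ 2 = ‖fderiv ℝ w y y‖ ^ 2 + k ^ 2 * ‖y‖ ^ 2 * ‖w y‖ ^ 2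
        - 2 * k * ‖y‖ * (starRingEnd ℂ (w y) * fderiv ℝ w y y).im := by
      simp only [← Complex.normSq_eq_norm_sq, radDefect, Complex.normSq_apply, Complex.mul_im,
        Complex.mul_re, Complex.sub_re, Complex.sub_im, Complex.I_re, Complex.I_im,
        Complex.conj_re, Complex.conj_im, Complex.ofReal_re, Complex.ofReal_im]
      ring
    have h3 : k ^ 2 * ‖y‖ ^ 2 * ‖w y‖ ^ 2
        ≤ 1 + 2 * k * ‖y‖ * (starRingEnd ℂ (w y) * fderiv ℝ w y y).im := by
      have : ‖radDefect k w y‖ ^ 2 ≤ 1 := pow_le_one₀ (norm_nonneg _) h1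
      nlinarith [sq_nonneg ‖fderiv ℝ w y y‖]
    have h4 : k ^ 2 * (‖y‖ * ‖w y‖ ^ 2)
        ≤ R⁻¹ + 2 * k * (starRingEnd ℂ (w y) * fderiv ℝ w y y).im := by
      have h5 : ‖y‖⁻¹ ≤ R⁻¹ := inv_anti₀ hRpos hy1
      have h6 : k ^ 2 * (‖y‖ * ‖w y‖ ^ 2) = ‖y‖⁻¹ * (k ^ 2 * ‖y‖ ^ 2 * ‖w y‖ ^ 2) := by
        field_simp
      have h7 := mul_le_mul_of_nonneg_left h3 (inv_pos.2 hypos).le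
      have h8 : ‖y‖⁻¹ * (1 + 2 * k * ‖y‖ * (starRingEnd ℂ (w y) * fderiv ℝ w y y).im)
          = ‖y‖⁻¹ + 2 * k * (starRingEnd ℂ (w y) * fderiv ℝ w y y).im := by field_simp
      rw [h6]
      linarith
    have := mul_le_mul_of_nonneg_left h4 (cutoffDensity_nonneg R y)
    linarith
  rw [le_div_iff₀ (by positivity), ← integral_mul_const]
  have hc1 : Continuous fun y => (starRingEnd ℂ (w y) * fderiv ℝ w y y).im :=
    Complex.continuous_im.comp (hwc.continuous.mul hDc)
  have hc2 : Continuous fun y => ‖y‖ * ‖w y‖ ^ 2 := continuous_norm.mul (hw.continuous.norm.pow 2)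
  calc ∫ y, cutoffDensity R y * (‖y‖ * ‖w y‖ ^ 2) * k ^ 2
      ≤ ∫ y, (cutoffDensity R y * R⁻¹
        + 2 * k * (cutoffDensity R y * (starRingEnd ℂ (w y) * fderiv ℝ w y y).im)) := by
        refine integral_mono ((hInt hc2).mul_const _)
          ((hInt continuous_const).add ((hInt hc1).const_mul _)) fun y => ?_
        refine le_trans (le_of_eq ?_) (hpt y)
        ring
    _ ≤ _ := by
        rw [integral_add (hInt continuous_const) ((hInt hc1).const_mul _), integral_const_mul]
        have : 0 ≤ 2 * k := by positivity
        have := mul_le_mul_of_nonneg_left hfluxle this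
        linarith

end Radiation

/-! ### Representation of radiating solutions by volume potentials -/

section Representation

open Metric InnerProductSpace
open scoped ContDiff

/-- The outgoing spherical wave `e^{ik|y - x|} / |y - x|` with source `x`. -/
noncomputable def sphericalWave (k : ℝ) (x y : E3) : ℂ := outgoing k ‖y - x‖

variable {k : ℝ} {w : E3 → ℂ} {x y : E3}

lemma sphericalWave_eq (k : ℝ) (x : E3) :
    sphericalWave k x = fun y => outgoing k (rad 0 (y + -x)) := by
  funext y
  rw [sphericalWave, rad_zero, sub_eq_add_neg]

lemma norm_sphericalWave (k : ℝ) (x y : E3) : ‖sphericalWave k x y‖ = ‖y - x‖⁻¹ :=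
  norm_outgoing k (norm_nonneg _)

lemma rad_sub_ne_zero (h : y ≠ x) : rad 0 (y + -x) ≠ 0 := by
  rw [rad_zero, ← sub_eq_add_neg]
  exact norm_ne_zero_iff.2 (sub_ne_zero.2 h)

lemma contDiffAt_sphericalWave (k : ℝ) (h : y ≠ x) {n : ℕ∞} :
    ContDiffAt ℝ n (sphericalWave k x) y := by
  rw [sphericalWave_eq]
  exact ContDiffAt.comp y (g := fun z => outgoing k (rad 0 z)) (f := fun y => y + -x)
    (contDiffAt_outgoing_rad k (rad_sub_ne_zero h)) (contDiffAt_id.add contDiffAt_const)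

lemma pderiv_sphericalWave (k : ℝ) (h : y ≠ x) (i : Fin 3) :
    pderiv i (sphericalWave k x) y = outgoing' k ‖y - x‖ * (y i - x i) := by
  rw [sphericalWave_eq, pderiv_comp_add i (fun z => outgoing k (rad 0 z)),
    pderiv_outgoing k (rad_sub_ne_zero h), rad_zero, ← sub_eq_add_neg]
  simp

lemma fderiv_sphericalWave (k : ℝ) (h : y ≠ x) (v : E3) :
    fderiv ℝ (sphericalWave k x) y v = outgoing' k ‖y - x‖ * ⟪y - x, v⟫_ℝ := by
  rw [fderiv_apply_eq_sum, PiLp.inner_apply]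
  push_cast
  rw [Finset.mul_sum]
  refine Finset.sum_congr rfl fun i _ => ?_
  rw [pderiv_sphericalWave k h]
  simp
  ring

/-- Products of a spherical wave with continuous compactly supported functions are integrable. -/
lemma integrable_sphericalWave_mul (k : ℝ) (x : E3) {g : E3 → ℂ} (hg : Continuous g)
    (hc : HasCompactSupport g) : Integrable fun y => sphericalWave k x y * g y := by
  obtain ⟨b, hb, hbg⟩ := exists_integrable_majorant (φ := fun z => g (z + x))
    (hg.comp (continuous_add_const x)) (hc.comp_homeomorph (Homeomorph.addRight x))
  have hb' : Integrable fun y => b (y - x) := hb.comp_sub_right x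
  refine hb'.mono' ?_ (Eventually.of_forall fun y => ?_)
  · refine AEStronglyMeasurable.mul ?_ hg.aestronglyMeasurable
    refine Measurable.aestronglyMeasurable ?_
    unfold sphericalWave outgoing
    fun_prop
  · have h1 := hbg (y - x)
    rw [sub_add_cancel] at h1
    rw [norm_mul, norm_sphericalWave, mul_comm]
    exact (mul_le_mul_of_nonneg_left (inv_le_one_add_inv_sq _) (norm_nonneg _)).trans h1

lemma radDefect_sphericalWave_le (hk : 0 < k) {r : ℝ} (hr : 2 * ‖x‖ + 1 ≤ r) (hy : r ≤ ‖y‖) :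
    ‖radDefect k (sphericalWave k x) y‖ ≤ (4 * k * ‖x‖ + 4) / r := by
  have hx := norm_nonneg x
  have hs : ‖y‖ / 2 ≤ ‖y - x‖ := by
    have := norm_sub_norm_le y x
    linarith
  have hypos : 0 < ‖y‖ := by linarith
  have hspos : 0 < ‖y - x‖ := by linarith
  have hne : y ≠ x := by
    rintro rfl
    simp at hspos
  set s := ‖y - x‖ with hsdef
  set p := ⟪y - x, y⟫_ℝ with hp
  have hs' : (s : ℂ) ≠ 0 := Complex.ofReal_ne_zero.2 hspos.ne'
  have h1 : radDefect k (sphericalWave k x) y = Complex.exp (Complex.I * k * s) / s *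
      (Complex.I * k * ((p / s - ‖y‖ : ℝ) : ℂ) - ((p / s ^ 2 : ℝ) : ℂ)) := by
    rw [radDefect, fderiv_sphericalWave k hne, sphericalWave, ← hsdef, outgoing', outgoing]
    push_cast
    field_simp
    ring
  have hp1 : |p| ≤ s * ‖y‖ := abs_real_inner_le_norm _ _
  have hp2 : |p / s - ‖y‖| ≤ 2 * ‖x‖ := by
    have h2 : p = s ^ 2 + ⟪y - x, x⟫_ℝ := by
      rw [hp, hsdef, ← real_inner_self_eq_norm_sq, ← inner_add_right, sub_add_cancel]
    have h3 : |⟪y - x, x⟫_ℝ / s| ≤ ‖x‖ := by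
      rw [abs_div, abs_of_pos hspos, div_le_iff₀ hspos, mul_comm]
      exact abs_real_inner_le_norm _ _
    have h4 : p / s - ‖y‖ = (s - ‖y‖) + ⟪y - x, x⟫_ℝ / s := by
      rw [h2]; field_simp; ring
    have h5 : |s - ‖y‖| ≤ ‖x‖ := by
      have := abs_norm_sub_norm_le (y - x) y
      rwa [sub_sub_cancel_left, norm_neg] at this
    rw [h4]
    exact (abs_add_le _ _).trans (by linarith)
  have hp3 : |p / s ^ 2| ≤ 2 := by
    rw [abs_div, abs_of_pos (by positivity : 0 < s ^ 2), div_le_iff₀ (by positivity)]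
    nlinarith
  rw [h1, norm_mul, norm_div, norm_exp_I_mul, Complex.norm_real, Real.norm_of_nonneg hspos.le]
  have h6 : ‖Complex.I * k * ((p / s - ‖y‖ : ℝ) : ℂ) - ((p / s ^ 2 : ℝ) : ℂ)‖
      ≤ k * (2 * ‖x‖) + 2 := by
    refine (norm_sub_le _ _).trans (add_le_add ?_ ?_)
    · rw [norm_mul, norm_mul, Complex.norm_I, one_mul, Complex.norm_real, Complex.norm_real,
        Real.norm_of_nonneg hk.le]
      exact mul_le_mul_of_nonneg_left hp2 hk.le
    · rw [Complex.norm_real]; exact hp3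
  have hrpos : 0 < r := by linarith
  calc 1 / s * _ ≤ (2 / r) * (k * (2 * ‖x‖) + 2) := by
        refine mul_le_mul ?_ h6 (norm_nonneg _) (by positivity)
        rw [div_le_div_iff₀ hspos hrpos]
        linarith
    _ = _ := by ring

lemma helmholtzOp_cutoff_mul (R : ℝ) (hw : ContDiff ℝ 2 w) (y : E3) :
    helmholtzOp k (fun z => (cutoff R z : ℂ) * w z) y = (cutoff R y : ℂ) * helmholtzOp k w y
      + ∑ i, (2 * (pderiv i (fun z => (cutoff R z : ℂ)) y * pderiv i w y)
        + w y * pderiv i (pderiv i fun z => (cutoff R z : ℂ)) y) := by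
  have hψ : ContDiff ℝ 2 (fun z => (cutoff R z : ℂ)) := contDiff_cutoff_complex R (n := 2)
  have hψd := hψ.differentiable two_ne_zero
  have hwd := hw.differentiable two_ne_zero
  have h1 : gradField (fun z => (cutoff R z : ℂ) * w z) = fun i z => (cutoff R z : ℂ) * pderiv i w z
      + pderiv i (fun z => (cutoff R z : ℂ)) z * w z := by
    funext i z
    exact pderiv_mul (hψd z) (hwd z) i
  rw [helmholtzOp, helmholtzOp, h1]
  simp only [divField, gradField, mul_add, Finset.mul_sum]
  rw [add_right_comm, ← Finset.sum_add_distrib]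
  · rw [show (k : ℂ) ^ 2 * ((cutoff R y : ℂ) * w y) = (cutoff R y : ℂ) * ((k : ℂ) ^ 2 * w y) by ring]
    congr 1
    refine Finset.sum_congr rfl fun i _ => ?_
    have hψi := (contDiff_pderiv hψ i).differentiable one_ne_zero y
    have hwi := (contDiff_pderiv hw i).differentiable one_ne_zero y
    rw [pderiv_add ((hψd y).fun_mul hwi) (hψi.fun_mul (hwd y)), pderiv_mul (hψd y) hwi,
      pderiv_mul hψi (hwd y)]
    ring

/-- Green's representation formula with a smooth cutoff instead of a sphere. -/
lemma representation_cutoff (k : ℝ) (hw : ContDiff ℝ 2 w) (x : E3) {R : ℝ} (hR : ‖x‖ < R) :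
    fundamentalConst * w x + ∫ y, sphericalWave k x y * ((cutoff R y : ℂ) * helmholtzOp k w y)
      = ∫ y, (cutoffDensity R y : ℂ) * (sphericalWave k x y * radDefect k w y
        - w y * radDefect k (sphericalWave k x) y) := by
  have hRpos : 0 < R := (norm_nonneg x).trans_lt hR
  have hψ : ContDiff ℝ 2 (fun z => (cutoff R z : ℂ)) := contDiff_cutoff_complex R (n := 2)
  have hψc := hasCompactSupport_cutoff hRpos
  have hw1 := hw.of_le (m := 1) (by norm_num)
  have hf := continuous_helmholtzOp k hw
  set Φ := sphericalWave k x with hΦ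
  set P : Fin 3 → E3 → ℂ := fun i => pderiv i (fun z => (cutoff R z : ℂ)) with hP
  have hPval : ∀ i z, P i z = -(cutoffDensity R z * z i) := fun i z => pderiv_cutoff R i z
  have hP0 : ∀ i, P i =ᶠ[𝓝 x] 0 := by
    intro i
    filter_upwards [isOpen_ball.mem_nhds (mem_ball_zero_iff.2 hR)] with z hz
    rw [hPval, cutoffDensity_of_lt hRpos (mem_ball_zero_iff.1 hz)]
    simp
  have hP1 : ∀ i, ContDiff ℝ 1 (P i) := contDiff_pderiv hψ
  set X : Fin 3 → E3 → ℂ := fun i z => Φ z * (w z * P i z) with hX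
  have hX1 : ∀ i, ContDiff ℝ 1 (X i) := by
    intro i
    rw [contDiff_iff_contDiffAt]
    intro y
    by_cases hy : y = x
    · subst hy
      refine (contDiffAt_const (c := (0 : ℂ))).congr_of_eventuallyEq ?_
      filter_upwards [hP0 i] with z hz
      simp [hX, hz]
    · exact (contDiffAt_sphericalWave k hy (n := 1)).mul (hw1.mul (hP1 i)).contDiffAt
  have hXc : ∀ i, HasCompactSupport (X i) := fun i =>
    ((hasCompactSupport_pderiv hψc i).mul_left).mul_left
  have hdiv : ∀ y, divField X y = Φ y * (∑ i, (P i y * pderiv i w y + w y * pderiv i (P i) y))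
      + w y * ∑ i, pderiv i Φ y * P i y := by
    intro y
    by_cases hy : y = x
    · subst hy
      have h1 : ∀ i, pderiv i (P i) y = 0 := fun i => by
        rw [pderiv_congr (hP0 i)]; simp [pderiv]
      have h2 : ∀ i, P i y = 0 := fun i => (hP0 i).self_of_nhds
      rw [divField_eq_zero fun i => ?_]
      · simp [h1, h2]
      · filter_upwards [hP0 i] with z hz
        simp [hX, hz]
    · rw [divField, Finset.mul_sum, Finset.mul_sum, ← Finset.sum_add_distrib]
      refine Finset.sum_congr rfl fun i _ => ?_
      have hwd := hw1.differentiable one_ne_zero y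
      have hPd := (hP1 i).differentiable one_ne_zero y
      rw [hX, pderiv_mul ((contDiffAt_sphericalWave k hy (n := 1)).differentiableAt one_ne_zero)
        (hwd.fun_mul hPd), pderiv_mul hwd hPd]
      ring
  have hpt : ∀ y, (cutoffDensity R y : ℂ) * (Φ y * radDefect k w y - w y * radDefect k Φ y)
      = Φ y * ((cutoff R y : ℂ) * helmholtzOp k w y) + divField X y
        - Φ y * helmholtzOp k (fun z => (cutoff R z : ℂ) * w z) y := by
    intro y
    have h1 : ∀ u : E3 → ℂ, ∑ i, pderiv i u y * P i y = - (cutoffDensity R y * fderiv ℝ u y y) := by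
      intro u
      rw [fderiv_apply_eq_sum, Finset.mul_sum, ← Finset.sum_neg_distrib]
      exact Finset.sum_congr rfl fun i _ => by rw [hPval]; ring
    have h2 : ∑ i, (2 * (P i y * pderiv i w y) + w y * pderiv i (P i) y)
        = ∑ i, (P i y * pderiv i w y + w y * pderiv i (P i) y) + ∑ i, pderiv i w y * P i y := by
      rw [← Finset.sum_add_distrib]
      exact Finset.sum_congr rfl fun i _ => by ring
    rw [hdiv, helmholtzOp_cutoff_mul R hw, h2, h1, h1, radDefect, radDefect]
    ring
  simp only [hpt]
  have hi1 : Integrable fun y => Φ y * ((cutoff R y : ℂ) * helmholtzOp k w y) :=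
    integrable_sphericalWave_mul k x (hψ.continuous.mul hf) hψc.mul_right
  have hi2 : Integrable (divField X) := by
    unfold divField
    exact integrable_finsetSum _ fun i _ => integrable_pderiv (hX1 i) (hXc i) i
  have hi3 : Integrable fun y => Φ y * helmholtzOp k (fun z => (cutoff R z : ℂ) * w z) y :=
    integrable_sphericalWave_mul k x (continuous_helmholtzOp k (hψ.mul hw))
      (hasCompactSupport_helmholtzOp k hψc.mul_right)
  have hfund := integral_outgoing_mul_helmholtzOp k (hψ.mul hw) hψc.mul_right x
  simp only [norm_sub_rev x] at hfund
  have hi12 : Integrable fun y => Φ y * ((cutoff R y : ℂ) * helmholtzOp k w y) + divField X y :=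
    hi1.add hi2
  rw [integral_sub hi12 hi3, integral_add hi1 hi2, integral_divField_eq_zero hX1 hXc]
  rw [cutoff_eq_one hRpos hR.le, Complex.ofReal_one, one_mul] at hfund
  have h3 : ∫ y, Φ y * helmholtzOp k (fun z => (cutoff R z : ℂ) * w z) y
      = -(fundamentalConst * w x) := hfund
  rw [h3]
  ring

/-- A radiating function is the volume potential of its source. -/
theorem representation (hk : 0 < k) (hw : ContDiff ℝ 2 w)
    (hf : HasCompactSupport (helmholtzOp k w)) (hrad : SommerfeldRadiation k w) (x : E3) :
    fundamentalConst * w x = - ∫ y, sphericalWave k x y * helmholtzOp k w y := by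
  obtain ⟨B, hB, hBound⟩ := exists_cutoffDensity_bound
  obtain ⟨C, R₁, hR₁, hshell⟩ := exists_shell_bound hk hw hf hrad
  obtain ⟨ρ, hρ, hfρ⟩ := hf.isBounded.subset_ball_lt 0 0
  set D := 4 * k * ‖x‖ + 4 with hD
  have hDpos : 0 < D := by positivity
  set E := fundamentalConst * w x + ∫ y, sphericalWave k x y * helmholtzOp k w y with hE
  have hmass : ∀ R, 0 < R → ∫ y, cutoffDensity R y ≤ B * R := by
    intro R hR
    have h1 := hBound R 1 (fun _ => 1) hR fun y _ _ => by simp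
    simp only [mul_one] at h1
    have h2 : ∫ y, (cutoffDensity R y : ℂ) = ((∫ y, cutoffDensity R y : ℝ) : ℂ) := integral_ofReal
    rw [h2, Complex.norm_real] at h1
    exact (le_abs_self _).trans h1
  -- the remainder of the representation formula with cutoff tends to zero
  have key : ∀ η : ℝ, 0 < η → ∀ᶠ R in atTop, ‖E‖ ≤ 2 * B * η + D / 2 * (C + B) / R := by
    intro η hη
    obtain ⟨R₂, hR₂, hS⟩ := hrad.exists_bound hη
    filter_upwards [eventually_ge_atTop (max (max R₁ R₂) (max ρ (2 * ‖x‖ + 1)))] with R hR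
    simp only [max_le_iff] at hR
    obtain ⟨⟨hRR₁, hRR₂⟩, hRρ, hRx⟩ := hR
    have hRpos : 0 < R := hR₁.trans_le hRR₁
    have hcs := hasCompactSupport_cutoffDensity hRpos
    have hcc := continuous_cutoffDensity R
    have hx := norm_nonneg x
    have hrep := representation_cutoff k hw x (R := R) (by linarith)
    have h1 : ∀ y, sphericalWave k x y * ((cutoff R y : ℂ) * helmholtzOp k w y)
        = sphericalWave k x y * helmholtzOp k w y := by
      intro y
      by_cases hy : y ∈ tsupport (helmholtzOp k w)
      · have := mem_ball_zero_iff.1 (hfρ hy)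
        rw [cutoff_eq_one hRpos (by linarith), Complex.ofReal_one, one_mul]
      · rw [image_eq_zero_of_notMem_tsupport hy, mul_zero]
    simp only [h1] at hrep
    rw [hE, hrep]
    have hc2 : Continuous fun y => ‖y‖ * ‖w y‖ ^ 2 := continuous_norm.mul (hw.continuous.norm.pow 2)
    have hInt : ∀ {g : E3 → ℝ}, Continuous g → Integrable fun y => cutoffDensity R y * g y :=
      fun hg => (hcc.mul hg).integrable_of_hasCompactSupport hcs.mul_right
    have hI1 : Integrable (cutoffDensity R) := hcc.integrable_of_hasCompactSupport hcs
    have hle : ∀ y, ‖(cutoffDensity R y : ℂ) * (sphericalWave k x y * radDefect k w y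
        - w y * radDefect k (sphericalWave k x) y)‖
        ≤ (2 * η / R + D / 2 / R ^ 2) * cutoffDensity R y
          + D / 2 / R * (cutoffDensity R y * (‖y‖ * ‖w y‖ ^ 2)) := by
      intro y
      by_cases hy : cutoffDensity R y = 0
      · simp [hy]
      obtain ⟨hy1, -⟩ := mem_of_cutoffDensity_ne_zero hRpos hy
      have hypos : 0 < ‖y‖ := hRpos.trans_le hy1
      have h2 := hS y (hRR₂.trans hy1)
      have h3 := radDefect_sphericalWave_le hk hRx hy1
      have h4 : ‖sphericalWave k x y‖ ≤ 2 / R := by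
        have h5 : R / 2 ≤ ‖y - x‖ := by
          have := norm_sub_norm_le y x
          linarith
        rw [norm_sphericalWave, inv_le_comm₀ (by linarith) (by positivity), inv_div]
        exact h5
      have h6 : ‖w y‖ / R ≤ (‖y‖ * ‖w y‖ ^ 2 / R + 1 / R ^ 2) / 2 := by
        have h7 : 2 * ‖w y‖ ≤ ‖y‖ * ‖w y‖ ^ 2 + 1 / ‖y‖ := by
          have h8 : ‖y‖ * ‖w y‖ ^ 2 + 1 / ‖y‖ - 2 * ‖w y‖ = (‖y‖ * ‖w y‖ - 1) ^ 2 / ‖y‖ := by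
            field_simp; ring
          have : 0 ≤ (‖y‖ * ‖w y‖ - 1) ^ 2 / ‖y‖ := by positivity
          linarith
        have h9 : 1 / ‖y‖ ≤ 1 / R := one_div_le_one_div_of_le hRpos hy1
        rw [div_le_iff₀ hRpos]
        have h10 : (‖y‖ * ‖w y‖ ^ 2 / R + 1 / R ^ 2) / 2 * R = (‖y‖ * ‖w y‖ ^ 2 + 1 / R) / 2 := by
          field_simp
        rw [h10]
        linarith
      rw [norm_mul, Complex.norm_real, Real.norm_of_nonneg (cutoffDensity_nonneg R y)]
      calc cutoffDensity R y * _ ≤ cutoffDensity R y *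
            (2 / R * η + D * ((‖y‖ * ‖w y‖ ^ 2 / R + 1 / R ^ 2) / 2)) := by
            refine mul_le_mul_of_nonneg_left ?_ (cutoffDensity_nonneg R y)
            refine (norm_sub_le _ _).trans (add_le_add ?_ ?_)
            · rw [norm_mul]
              exact mul_le_mul h4 h2 (norm_nonneg _) (by positivity)
            · rw [norm_mul]
              calc ‖w y‖ * _ ≤ ‖w y‖ * (D / R) := mul_le_mul_of_nonneg_left h3 (norm_nonneg _)
                _ = D * (‖w y‖ / R) := by ring
                _ ≤ _ := mul_le_mul_of_nonneg_left h6 hDpos.le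
        _ = _ := by ring
    have hgi : Integrable fun y => (2 * η / R + D / 2 / R ^ 2) * cutoffDensity R y
          + D / 2 / R * (cutoffDensity R y * (‖y‖ * ‖w y‖ ^ 2)) :=
      (hI1.const_mul _).add ((hInt hc2).const_mul _)
    refine (norm_integral_le_of_norm_le hgi (Eventually.of_forall hle)).trans ?_
    rw [integral_add (hI1.const_mul _) ((hInt hc2).const_mul _), integral_const_mul,
      integral_const_mul]
    have h11 := mul_le_mul_of_nonneg_left (hmass R hRpos)
      (by positivity : 0 ≤ 2 * η / R + D / 2 / R ^ 2)
    have h12 := mul_le_mul_of_nonneg_left (hshell R hRR₁) (by positivity : 0 ≤ D / 2 / R)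
    have h13 : (2 * η / R + D / 2 / R ^ 2) * (B * R) + D / 2 / R * C
        = 2 * B * η + D / 2 * (C + B) / R := by field_simp; ring
    linarith
  have hE0 : ‖E‖ ≤ 0 := by
    refine le_of_forall_pos_le_add fun ε hε => ?_
    have h1 := key (ε / (2 * B)) (by positivity)
    have h2 : Tendsto (fun R : ℝ => 2 * B * (ε / (2 * B)) + D / 2 * (C + B) / R) atTop
        (𝓝 (2 * B * (ε / (2 * B)) + 0)) :=
      tendsto_const_nhds.add (tendsto_const_nhds.div_atTop tendsto_id)
    have h3 := ge_of_tendsto h2 h1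
    have h4 : 2 * B * (ε / (2 * B)) = ε := by field_simp
    linarith
  exact eq_neg_of_add_eq_zero_left (norm_le_zero_iff.1 hE0)

end Representation

/-! ### Asymptotics of volume potentials -/

section Asymptotics

open Metric InnerProductSpace
open scoped ContDiff

variable {k ρ : ℝ} {x y : E3}

lemma measurable_outgoing (k : ℝ) : Measurable (outgoing k) := by
  unfold outgoing; fun_prop

lemma measurable_outgoing' (k : ℝ) : Measurable (outgoing' k) := by
  unfold outgoing'; fun_prop

lemma norm_outgoing'_le (hk : 0 ≤ k) {s : ℝ} (hs : 1 ≤ s) :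
    ‖outgoing' k s‖ ≤ (k + 1) / s ^ 2 := by
  have hs0 : 0 < s := by linarith
  have h1 : ‖(Complex.I * k * s - 1 : ℂ)‖ ≤ (k + 1) * s := by
    refine (norm_sub_le _ _).trans ?_
    simp only [norm_mul, Complex.norm_I, Complex.norm_real, norm_one, Real.norm_of_nonneg hk,
      Real.norm_of_nonneg hs0.le]
    nlinarith
  rw [outgoing', norm_div, norm_mul, norm_exp_I_mul, norm_pow, Complex.norm_real,
    Real.norm_of_nonneg hs0.le, one_mul, div_le_div_iff₀ (by positivity) (by positivity)]
  calc ‖(Complex.I * k * s - 1 : ℂ)‖ * s ^ 2 ≤ (k + 1) * s * s ^ 2 := by gcongr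
    _ = (k + 1) * s ^ 3 := by ring

lemma half_norm_le_norm_sub (hy : ‖y‖ ≤ ρ) (hx : 4 * ρ ≤ ‖x‖) : ‖x‖ / 2 ≤ ‖x - y‖ := by
  have h1 := norm_sub_norm_le x y
  have h2 := norm_nonneg y
  linarith

/-- The far-field approximation `e^{ikr} e^{-ik θ·y} / r` of the spherical wave, `x = rθ`. -/
lemma norm_outgoing_sub_le (hk : 0 < k) (hρ : 1 ≤ ρ) (hy : ‖y‖ ≤ ρ) (hx : 4 * ρ ≤ ‖x‖) :
    ‖outgoing k ‖x - y‖ - Complex.exp (Complex.I * k * ‖x‖) / ‖x‖ *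
      Complex.exp (-(Complex.I * k * (⟪‖x‖⁻¹ • x, y⟫_ℝ : ℝ)))‖
      ≤ (2 * ρ + k * ρ ^ 2) / ‖x‖ ^ 2 := by
  set r := ‖x‖ with hr
  set s := ‖x - y‖ with hs
  set p := ⟪r⁻¹ • x, y⟫_ℝ with hp
  have hr0 : 0 < r := by linarith
  have hsr : r / 2 ≤ s := half_norm_le_norm_sub hy hx
  have hs0 : 0 < s := by linarith
  have hpr : r * p = ⟪x, y⟫_ℝ := by
    rw [hp, real_inner_smul_left, mul_inv_cancel_left₀ hr0.ne']
  have hpy : |p| ≤ ‖y‖ := by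
    refine (abs_real_inner_le_norm _ _).trans ?_
    rw [norm_smul, norm_inv, norm_norm, ← hr, inv_mul_cancel₀ hr0.ne', one_mul]
  have hsq : s ^ 2 = r ^ 2 - 2 * ⟪x, y⟫_ℝ + ‖y‖ ^ 2 := norm_sub_sq_real x y
  have hrs : |r - s| ≤ ρ := (abs_norm_sub_norm_le x (x - y)).trans (by simpa using hy)
  have hp1 := abs_le.1 hpy
  have hy0 := norm_nonneg y
  -- the phases differ by `O(1/r)`
  have hph : |s - (r - p)| ≤ ρ ^ 2 / r := by
    have h1 : (s - (r - p)) * (s + (r - p)) = ‖y‖ ^ 2 - p ^ 2 := by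
      rw [← hpr] at hsq
      linear_combination hsq
    have h2 : r ≤ s + (r - p) := by linarith
    rw [le_div_iff₀ hr0]
    have h3 : |s - (r - p)| * (s + (r - p)) = |‖y‖ ^ 2 - p ^ 2| := by
      rw [← h1, abs_mul, abs_of_pos (by linarith : 0 < s + (r - p))]
    have h4 : |‖y‖ ^ 2 - p ^ 2| ≤ ρ ^ 2 := by
      rw [abs_le]
      constructor
      · nlinarith [sq_abs p, abs_nonneg p]
      · nlinarith [sq_nonneg p]
    calc |s - (r - p)| * r ≤ |s - (r - p)| * (s + (r - p)) := by gcongr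
      _ ≤ ρ ^ 2 := by rw [h3]; exact h4
  have e1 : Complex.exp (Complex.I * k * r) * Complex.exp (-(Complex.I * k * p))
      = Complex.exp (Complex.I * (k * (r - p) : ℝ)) := by
    rw [← Complex.exp_add]
    congr 1
    push_cast
    ring
  have e2 : Complex.exp (Complex.I * k * s) = Complex.exp (Complex.I * (k * s : ℝ)) := by
    congr 1
    push_cast
    ring
  have hexp : ‖Complex.exp (Complex.I * (k * s : ℝ)) - Complex.exp (Complex.I * (k * (r - p) : ℝ))‖
      ≤ k * (ρ ^ 2 / r) := by
    have h1 : Complex.exp (Complex.I * (k * s : ℝ)) - Complex.exp (Complex.I * (k * (r - p) : ℝ))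
        = Complex.exp (Complex.I * (k * (r - p) : ℝ)) *
          (Complex.exp (Complex.I * (k * (s - (r - p)) : ℝ)) - 1) := by
      rw [mul_sub (Complex.exp _), ← Complex.exp_add, mul_one]
      congr 2
      push_cast
      ring
    have h2 := Real.norm_exp_I_mul_ofReal_sub_one_le (x := k * (s - (r - p)))
    rw [h1, norm_mul, mul_comm Complex.I, Complex.norm_exp_ofReal_mul_I, one_mul]
    refine h2.trans ?_
    rw [Real.norm_eq_abs, abs_mul, abs_of_pos hk]
    gcongr
  have hsplit : outgoing k s - Complex.exp (Complex.I * k * r) / r *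
      Complex.exp (-(Complex.I * k * p))
      = Complex.exp (Complex.I * (k * s : ℝ)) * ((s⁻¹ - r⁻¹ : ℝ) : ℂ)
        + (Complex.exp (Complex.I * (k * s : ℝ)) - Complex.exp (Complex.I * (k * (r - p) : ℝ)))
          * ((r⁻¹ : ℝ) : ℂ) := by
    rw [outgoing, e2, ← e1]
    push_cast
    ring
  rw [hsplit]
  refine (norm_add_le _ _).trans ?_
  rw [norm_mul, norm_mul, mul_comm Complex.I ((k * s : ℝ) : ℂ), Complex.norm_exp_ofReal_mul_I,
    mul_comm ((k * s : ℝ) : ℂ) Complex.I, one_mul, Complex.norm_real, Complex.norm_real,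
    Real.norm_eq_abs, Real.norm_of_nonneg (inv_nonneg.2 hr0.le)]
  have h5 : |s⁻¹ - r⁻¹| ≤ 2 * ρ / r ^ 2 := by
    rw [inv_sub_inv hs0.ne' hr0.ne', abs_div, abs_of_pos (mul_pos hs0 hr0),
      div_le_div_iff₀ (by positivity) (by positivity)]
    calc |r - s| * r ^ 2 ≤ ρ * r ^ 2 := by gcongr
      _ = 2 * ρ * (r / 2 * r) := by ring
      _ ≤ 2 * ρ * (s * r) := by gcongr
  calc |s⁻¹ - r⁻¹| + ‖Complex.exp (Complex.I * (k * s : ℝ))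
        - Complex.exp (Complex.I * (k * (r - p) : ℝ))‖ * r⁻¹
      ≤ 2 * ρ / r ^ 2 + k * (ρ ^ 2 / r) * r⁻¹ := by gcongr
    _ = (2 * ρ + k * ρ ^ 2) / r ^ 2 := by
      field_simp

/-- The radial derivative of the spherical wave is `(ik - 1/r)` times the wave, up to `O(r⁻³)`. -/
lemma norm_radial_outgoing_sub_le (hk : 0 < k) (hρ : 1 ≤ ρ) (hy : ‖y‖ ≤ ρ) (hx : 4 * ρ ≤ ‖x‖) :
    ‖outgoing' k ‖x - y‖ * (⟪x - y, x⟫_ℝ : ℝ) - (Complex.I * k * ‖x‖ - 1) * outgoing k ‖x - y‖‖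
      ≤ (2 * k * ρ ^ 2 + 4 * ρ) / ‖x‖ ^ 2 := by
  set r := ‖x‖ with hr
  set s := ‖x - y‖ with hs
  set q := ⟪x - y, x⟫_ℝ with hq
  have hr0 : 0 < r := by linarith
  have hsr : r / 2 ≤ s := half_norm_le_norm_sub hy hx
  have hs0 : 0 < s := by linarith
  have hs' : (s : ℂ) ≠ 0 := Complex.ofReal_ne_zero.2 hs0.ne'
  have hrs : |r - s| ≤ ‖y‖ := (abs_norm_sub_norm_le x (x - y)).trans (by simp)
  have hy0 := norm_nonneg y
  have hq2 : 2 * q = r ^ 2 + s ^ 2 - ‖y‖ ^ 2 := by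
    have h1 : ‖x - (x - y)‖ ^ 2 = _ := norm_sub_sq_real x (x - y)
    rw [sub_sub_cancel, real_inner_comm] at h1
    linarith
  have hqs : |q / s - r| ≤ ρ ^ 2 / r := by
    have h1 : q / s - r = ((r - s) ^ 2 - ‖y‖ ^ 2) / (2 * s) := by
      field_simp
      linear_combination hq2
    rw [h1, abs_div, abs_of_pos (by linarith : 0 < 2 * s)]
    have h2 : |(r - s) ^ 2 - ‖y‖ ^ 2| ≤ ρ ^ 2 := by
      have h3 : (r - s) ^ 2 ≤ ‖y‖ ^ 2 := sq_le_sq' (abs_le.1 hrs).1 (abs_le.1 hrs).2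
      rw [abs_le]
      constructor
      · nlinarith [sq_nonneg (r - s)]
      · nlinarith [sq_nonneg (r - s)]
    exact div_le_div₀ (by positivity) h2 hr0 (by linarith)
  have hq1 : |q / s ^ 2 - 1| ≤ 2 * ρ / r := by
    have h1 : q / s ^ 2 - 1 = ⟪x - y, y⟫_ℝ / s ^ 2 := by
      have h2 : q = s ^ 2 + ⟪x - y, y⟫_ℝ := by
        rw [hq, hs, ← real_inner_self_eq_norm_sq, ← inner_add_right, sub_add_cancel]
      rw [h2]
      field_simp
      ring
    rw [h1, abs_div, abs_of_pos (by positivity : 0 < s ^ 2)]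
    have h3 : |⟪x - y, y⟫_ℝ| ≤ s * ρ :=
      (abs_real_inner_le_norm _ _).trans (by gcongr)
    rw [div_le_div_iff₀ (by positivity) hr0]
    calc |⟪x - y, y⟫_ℝ| * r ≤ s * ρ * r := by gcongr
      _ = 2 * ρ * (s * (r / 2)) := by ring
      _ ≤ 2 * ρ * (s * s) := by gcongr
      _ = 2 * ρ * s ^ 2 := by ring
  have hsplit : outgoing' k s * (q : ℝ) - (Complex.I * k * r - 1) * outgoing k s
      = outgoing k s * (Complex.I * k * ((q / s - r : ℝ) : ℂ) - ((q / s ^ 2 - 1 : ℝ) : ℂ)) := by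
    rw [outgoing', outgoing]
    push_cast
    field_simp
    ring
  rw [hsplit, norm_mul, norm_outgoing k hs0.le]
  have h1 : ‖Complex.I * k * ((q / s - r : ℝ) : ℂ) - ((q / s ^ 2 - 1 : ℝ) : ℂ)‖
      ≤ k * (ρ ^ 2 / r) + 2 * ρ / r := by
    refine (norm_sub_le _ _).trans ?_
    rw [norm_mul, norm_mul, Complex.norm_I, one_mul, Complex.norm_real, Complex.norm_real,
      Complex.norm_real, Real.norm_of_nonneg hk.le, Real.norm_eq_abs, Real.norm_eq_abs]
    gcongr
  have h2 : s⁻¹ ≤ 2 / r := by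
    rw [inv_eq_one_div, div_le_div_iff₀ hs0 hr0]
    linarith
  calc s⁻¹ * _ ≤ 2 / r * (k * (ρ ^ 2 / r) + 2 * ρ / r) := by gcongr
    _ = _ := by field_simp; ring

/-- The tangential part of the gradient of the spherical wave is `O(r⁻²)`. -/
lemma norm_tangential_outgoing_le (hk : 0 < k) (hρ : 1 ≤ ρ) (hy : ‖y‖ ≤ ρ) (hx : 4 * ρ ≤ ‖x‖)
    (i : Fin 3) :
    ‖(‖x‖ : ℂ) ^ 2 * (outgoing' k ‖x - y‖ * ((x i - y i : ℝ) : ℂ))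
      - x i * (outgoing' k ‖x - y‖ * (⟪x - y, x⟫_ℝ : ℝ))‖ ≤ 8 * (k + 1) * ρ := by
  set r := ‖x‖ with hr
  set s := ‖x - y‖ with hs
  have hr0 : 0 < r := by linarith
  have hsr : r / 2 ≤ s := half_norm_le_norm_sub hy hx
  have hs1 : 1 ≤ s := by linarith
  have hs0 : 0 < s := by linarith
  have hsplit : (r : ℂ) ^ 2 * (outgoing' k s * ((x i - y i : ℝ) : ℂ))
      - x i * (outgoing' k s * (⟪x - y, x⟫_ℝ : ℝ))
      = outgoing' k s * ((x i * ⟪y, x⟫_ℝ - r ^ 2 * y i : ℝ) : ℂ) := by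
    rw [inner_sub_left, real_inner_self_eq_norm_sq, ← hr]
    push_cast
    ring
  have h1 : |x i * ⟪y, x⟫_ℝ - r ^ 2 * y i| ≤ 2 * ρ * r ^ 2 := by
    refine (abs_sub _ _).trans ?_
    rw [abs_mul, abs_mul, abs_of_pos (by positivity : 0 < r ^ 2)]
    have h2 : |x i| ≤ r := PiLp.norm_apply_le x i
    have h3 : |y i| ≤ ρ := (PiLp.norm_apply_le y i).trans hy
    have h4 : |⟪y, x⟫_ℝ| ≤ ρ * r := (abs_real_inner_le_norm _ _).trans (by gcongr)
    calc |x i| * |⟪y, x⟫_ℝ| + r ^ 2 * |y i| ≤ r * (ρ * r) + r ^ 2 * ρ := by gcongr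
      _ = 2 * ρ * r ^ 2 := by ring
  rw [hsplit, norm_mul, Complex.norm_real, Real.norm_eq_abs]
  calc _ ≤ (k + 1) / s ^ 2 * (2 * ρ * r ^ 2) := by
        gcongr
        exact norm_outgoing'_le hk.le hs1
    _ ≤ (k + 1) / (r / 2) ^ 2 * (2 * ρ * r ^ 2) := by gcongr
    _ = _ := by field_simp; ring

end Asymptotics

section RadiatingAsymptotics

open Metric InnerProductSpace
open scoped ContDiff

variable {k ρ : ℝ} {x y : E3} {f w : E3 → ℂ}

lemma integrable_kernel_mul {κ : E3 → ℂ} {b : ℝ} (hκ : Measurable κ)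
    (hb : ∀ y, ‖y‖ ≤ ρ → ‖κ y‖ ≤ b) (hf : Continuous f) (hfc : HasCompactSupport f)
    (hfρ : ∀ y, f y ≠ 0 → ‖y‖ ≤ ρ) :
    Integrable (fun y => κ y * f y) ∧ ‖∫ y, κ y * f y‖ ≤ b * ∫ y, ‖f y‖ := by
  have hfi : Integrable fun y => b * ‖f y‖ :=
    ((hf.integrable_of_hasCompactSupport hfc).norm).const_mul b
  have h1 : ∀ y, ‖κ y * f y‖ ≤ b * ‖f y‖ := by
    intro y
    by_cases hy : f y = 0
    · simp [hy]
    · rw [norm_mul]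
      gcongr
      exact hb y (hfρ y hy)
  refine ⟨hfi.mono' (hκ.aestronglyMeasurable.mul hf.aestronglyMeasurable)
    (Eventually.of_forall h1), ?_⟩
  rw [← integral_const_mul]
  exact norm_integral_le_of_norm_le hfi (Eventually.of_forall h1)

lemma measurable_outgoing_norm_sub (k : ℝ) (x : E3) :
    Measurable fun y : E3 => outgoing k ‖x - y‖ :=
  (measurable_outgoing k).comp (by fun_prop)

lemma measurable_outgoing'_norm_sub (k : ℝ) (x v : E3) :
    Measurable fun y : E3 => outgoing' k ‖x - y‖ * ((⟪x - y, v⟫_ℝ : ℝ) : ℂ) := by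
  refine ((measurable_outgoing' k).comp (by fun_prop)).mul (Complex.measurable_ofReal.comp ?_)
  have : Continuous fun y : E3 => ⟪x - y, v⟫_ℝ := by fun_prop
  exact this.measurable

lemma norm_outgoing'_mul_inner_le (hk : 0 ≤ k) {z v : E3} (hz : 1 ≤ ‖z‖) :
    ‖outgoing' k ‖z‖ * ((⟪z, v⟫_ℝ : ℝ) : ℂ)‖ ≤ (k + 1) * ‖v‖ := by
  have hz0 : 0 < ‖z‖ := by linarith
  rw [norm_mul, Complex.norm_real, Real.norm_eq_abs]
  calc _ ≤ (k + 1) / ‖z‖ ^ 2 * (‖z‖ * ‖v‖) := by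
        gcongr
        · exact norm_outgoing'_le hk hz
        · exact abs_real_inner_le_norm _ _
    _ = (k + 1) * ‖v‖ / ‖z‖ := by field_simp
    _ ≤ (k + 1) * ‖v‖ := div_le_self (by positivity) hz

lemma one_le_norm_sub (hρ : 1 ≤ ρ) (hx : 4 * ρ ≤ ‖x‖) (hy : ‖y‖ ≤ ρ) : 1 ≤ ‖x - y‖ := by
  have := half_norm_le_norm_sub hy hx
  linarith

/-- Directional derivatives of a volume potential may be computed under the integral. -/
lemma fderiv_potential (hk : 0 ≤ k) (hf : Continuous f) (hfc : HasCompactSupport f)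
    (hρ : 1 ≤ ρ) (hfρ : ∀ y, f y ≠ 0 → ‖y‖ ≤ ρ) {c : ℂ}
    (hw : ∀ x, w x = c * ∫ y, outgoing k ‖x - y‖ * f y) (hwd : Differentiable ℝ w)
    (hx : 4 * ρ ≤ ‖x‖) (v : E3) :
    fderiv ℝ w x v = c * ∫ y, outgoing' k ‖x - y‖ * ((⟪x - y, v⟫_ℝ : ℝ) : ℂ) * f y := by
  have hline : HasDerivAt (fun t : ℝ => x + t • v) v 0 := by
    simpa using ((hasDerivAt_id (0 : ℝ)).smul_const v).const_add x
  have h1 : HasDerivAt (fun t : ℝ => w (x + t • v)) (fderiv ℝ w x v) 0 := by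
    have h2 : HasFDerivAt w (fderiv ℝ w x) (x + (0 : ℝ) • v) := by
      rw [zero_smul, add_zero]; exact (hwd x).hasFDerivAt
    exact h2.comp_hasDerivAt 0 hline
  have hs : {t : ℝ | ‖t • v‖ < 1} ∈ 𝓝 (0 : ℝ) := by
    refine (isOpen_lt (by fun_prop) continuous_const).mem_nhds ?_
    simp
  -- on the support of `f` the distance to points of the line segment is at least one
  have hfar : ∀ t ∈ {t : ℝ | ‖t • v‖ < 1}, ∀ y, f y ≠ 0 → 1 ≤ ‖x + t • v - y‖ := by
    intro t ht y hy
    rw [Set.mem_ofPred_eq] at ht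
    have h3 := norm_sub_norm_le x (y - t • v)
    have h4 := norm_sub_le y (t • v)
    have h5 := hfρ y hy
    rw [show x + t • v - y = x - (y - t • v) by abel]
    linarith
  have hx0 : (0 : ℝ) ∈ {t : ℝ | ‖t • v‖ < 1} := mem_of_mem_nhds hs
  have hint := (integrable_kernel_mul (κ := fun y => outgoing k ‖x - y‖) (b := 1)
    (measurable_outgoing_norm_sub k x) (fun y hy => by
      rw [norm_outgoing k (norm_nonneg _)]
      exact inv_le_one_of_one_le₀ (one_le_norm_sub hρ hx hy)) hf hfc hfρ).1
  have h2 := hasDerivAt_integral_of_dominated_loc_of_deriv_le (μ := volume) (𝕜 := ℝ)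
    (F := fun t y => outgoing k ‖x + t • v - y‖ * f y)
    (F' := fun t y => outgoing' k ‖x + t • v - y‖ * ((⟪x + t • v - y, v⟫_ℝ : ℝ) : ℂ) * f y)
    (bound := fun y => (k + 1) * ‖v‖ * ‖f y‖) hs
    (Eventually.of_forall fun t =>
      (measurable_outgoing_norm_sub k _).aestronglyMeasurable.mul hf.aestronglyMeasurable)
    (by simpa using hint)
    ((measurable_outgoing'_norm_sub k _ v).aestronglyMeasurable.mul hf.aestronglyMeasurable)
    (Eventually.of_forall fun y t ht => by
      by_cases hy : f y = 0
      · simp [hy]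
      · rw [norm_mul]
        gcongr
        exact norm_outgoing'_mul_inner_le hk (hfar t ht y hy))
    ((hf.integrable_of_hasCompactSupport hfc).norm.const_mul _)
    (Eventually.of_forall fun y t ht => by
      by_cases hy : f y = 0
      · simpa [hy] using hasDerivAt_const t (0 : ℂ)
      · have h5 := hfar t ht y hy
        have hne : x + t • v ≠ y := fun h => by
          rw [h, sub_self, norm_zero] at h5; linarith
        have h6 := ((contDiffAt_sphericalWave k hne (n := 1)).differentiableAt
          one_ne_zero).hasFDerivAt
        have hl : HasDerivAt (fun t : ℝ => x + t • v) v t := by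
          simpa using ((hasDerivAt_id t).smul_const v).const_add x
        have h7 := h6.comp_hasDerivAt t hl
        rw [fderiv_sphericalWave k hne] at h7
        exact h7.mul_const (f y))
  have h3 := h2.2.const_mul c
  simp only [← hw] at h3
  rw [h1.unique h3]
  simp

/-- Asymptotics of the volume potential of a compactly supported density. -/
theorem potential_asymptotics (hk : 0 < k) (hf : Continuous f) (hfc : HasCompactSupport f)
    {c : ℂ} (hw : ∀ x, w x = c * ∫ y, outgoing k ‖x - y‖ * f y) (hwd : Differentiable ℝ w) :
    ∃ g : E3 → ℂ, Continuous g ∧ ∃ M r₀ : ℝ, 0 < M ∧ 1 ≤ r₀ ∧ ∀ x : E3, r₀ ≤ ‖x‖ →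
      ‖w x‖ ≤ M / ‖x‖ ∧
      ‖w x - g (‖x‖⁻¹ • x) * sphericalHankelZero (k * ‖x‖)‖ ≤ M / ‖x‖ ^ 2 ∧
      ‖fderiv ℝ w x x - (Complex.I * k * ‖x‖ - 1) * w x‖ ≤ M / ‖x‖ ^ 2 ∧
      ∀ i, ‖(‖x‖ : ℂ) ^ 2 * pderiv i w x - x i * fderiv ℝ w x x‖ ≤ M := by
  obtain ⟨ρ₁, -, hρ₁⟩ := hfc.isBounded.subset_ball_lt 0 0
  set ρ := max ρ₁ 1 with hρdef
  have hρ : 1 ≤ ρ := le_max_right _ _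
  have hfρ : ∀ y, f y ≠ 0 → ‖y‖ ≤ ρ := fun y hy =>
    (mem_ball_zero_iff.1 (hρ₁ (subset_tsupport f hy))).le.trans (le_max_left _ _)
  set e : E3 → E3 → ℂ := fun θ y => Complex.exp (-(Complex.I * k * (⟪θ, y⟫_ℝ : ℝ))) with he
  have hec : Continuous fun p : E3 × E3 => e p.1 p.2 := by
    simp only [he]
    have h1 : Continuous fun p : E3 × E3 => ((⟪p.1, p.2⟫_ℝ : ℝ) : ℂ) :=
      Complex.continuous_ofReal.comp (by fun_prop)
    fun_prop
  have hen : ∀ θ y, ‖e θ y‖ ≤ 1 := by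
    intro θ y
    have : e θ y = Complex.exp ((-(k * ⟪θ, y⟫_ℝ) : ℝ) * Complex.I) := by
      simp only [he]; congr 1; push_cast; ring
    rw [this, Complex.norm_exp_ofReal_mul_I]
  have hkC : (k : ℂ) ≠ 0 := Complex.ofReal_ne_zero.2 hk.ne'
  set T := ∫ y, ‖f y‖ with hT
  have hT0 : 0 ≤ T := integral_nonneg fun _ => norm_nonneg _
  set M := (‖c‖ * T + 1) * (2 + (2 * ρ + k * ρ ^ 2) + (2 * k * ρ ^ 2 + 4 * ρ) + 8 * (k + 1) * ρ)
    with hM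
  have hM0 : 0 < M := by positivity
  -- an integral of a kernel bounded by `b` is controlled by `M`
  have hcalc : ∀ b t : ℝ, 0 ≤ b → b ≤ 2 + (2 * ρ + k * ρ ^ 2) + (2 * k * ρ ^ 2 + 4 * ρ)
      + 8 * (k + 1) * ρ → 0 < t → ∀ J : ℂ, ‖J‖ ≤ b / t * T → ‖c * J‖ ≤ M / t := by
    intro b t hb hbM ht J hJ
    rw [norm_mul]
    calc ‖c‖ * ‖J‖ ≤ ‖c‖ * (b / t * T) := by gcongr
      _ = (‖c‖ * T) * b / t := by ring
      _ ≤ M / t := by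
        rw [hM]
        gcongr
        linarith
  refine ⟨fun θ => Complex.I * k * c * ∫ y, e θ y * f y, ?_, M, 4 * ρ, hM0, by linarith,
    fun x hx => ?_⟩
  · refine continuous_const.mul (continuous_of_dominated (bound := fun y => ‖f y‖) ?_ ?_ ?_ ?_)
    · intro θ
      exact ((hec.comp (Continuous.prodMk_right θ)).mul hf).aestronglyMeasurable
    · intro θ
      refine Eventually.of_forall fun y => ?_
      rw [norm_mul]
      exact mul_le_of_le_one_left (norm_nonneg _) (hen θ y)
    · exact (hf.integrable_of_hasCompactSupport hfc).norm
    · refine Eventually.of_forall fun y => ?_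
      exact (hec.comp (Continuous.prodMk_left y)).mul continuous_const
  have hr0 : 0 < ‖x‖ := by linarith
  have hrC : (‖x‖ : ℂ) ≠ 0 := Complex.ofReal_ne_zero.2 hr0.ne'
  have hs : ∀ y, ‖y‖ ≤ ρ → 1 ≤ ‖x - y‖ := fun y hy => one_le_norm_sub hρ hx hy
  have hk1 := mul_pos hk (by positivity : 0 < ρ ^ 2)
  have hk2 := mul_pos hk (by positivity : 0 < ρ)
  have hi0 := integrable_kernel_mul (κ := fun y => outgoing k ‖x - y‖) (b := 2 / ‖x‖)
    (measurable_outgoing_norm_sub k x) (fun y hy => by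
      have h1 := half_norm_le_norm_sub hy hx
      rw [norm_outgoing k (norm_nonneg _), inv_eq_one_div,
        div_le_div_iff₀ (by linarith) hr0]
      linarith) hf hfc hfρ
  have hiv : ∀ v : E3, Integrable fun y =>
      outgoing' k ‖x - y‖ * ((⟪x - y, v⟫_ℝ : ℝ) : ℂ) * f y := fun v =>
    (integrable_kernel_mul (measurable_outgoing'_norm_sub k x v)
      (fun y hy => norm_outgoing'_mul_inner_le hk.le (hs y hy)) hf hfc hfρ).1
  have hem : Measurable fun y => e (‖x‖⁻¹ • x) y :=
    (hec.comp (Continuous.prodMk_right _)).measurable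
  have hie := (integrable_kernel_mul hem (fun y _ => hen _ y) hf hfc hfρ).1
  have hfd := fun v => fderiv_potential hk.le hf hfc hρ hfρ hw hwd hx v
  have hpd : ∀ i, pderiv i w x
      = c * ∫ y, outgoing' k ‖x - y‖ * ((x i - y i : ℝ) : ℂ) * f y := by
    intro i
    rw [pderiv, hfd]
    simp [EuclideanSpace.inner_single_right]
  refine ⟨?_, ?_, ?_, fun i => ?_⟩
  · rw [hw]
    exact hcalc 2 ‖x‖ (by norm_num) (by nlinarith) hr0 _ hi0.2
  · have h1 : w x - Complex.I * k * c * (∫ y, e (‖x‖⁻¹ • x) y * f y)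
          * sphericalHankelZero (k * ‖x‖)
        = c * ∫ y, (outgoing k ‖x - y‖ - Complex.exp (Complex.I * k * ‖x‖) / ‖x‖
          * e (‖x‖⁻¹ • x) y) * f y := by
      have h2 : ∀ y, (outgoing k ‖x - y‖ - Complex.exp (Complex.I * k * ‖x‖) / ‖x‖
          * e (‖x‖⁻¹ • x) y) * f y = outgoing k ‖x - y‖ * f y
            - Complex.exp (Complex.I * k * ‖x‖) / ‖x‖ * (e (‖x‖⁻¹ • x) y * f y) :=
        fun y => by ring
      simp only [h2]
      rw [integral_sub hi0.1 (hie.const_mul _), integral_const_mul, hw, sphericalHankelZero,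
        ← mul_assoc Complex.I]
      have := Complex.I_ne_zero
      field_simp
    rw [h1]
    refine hcalc (2 * ρ + k * ρ ^ 2) _ (by positivity) (by nlinarith) (by positivity) _ ?_
    exact (integrable_kernel_mul ((measurable_outgoing_norm_sub k x).sub (hem.const_mul _))
      (fun y hy => norm_outgoing_sub_le hk hρ hy hx) hf hfc hfρ).2
  · have h1 : fderiv ℝ w x x - (Complex.I * k * ‖x‖ - 1) * w x
        = c * ∫ y, (outgoing' k ‖x - y‖ * ((⟪x - y, x⟫_ℝ : ℝ) : ℂ)
          - (Complex.I * k * ‖x‖ - 1) * outgoing k ‖x - y‖) * f y := by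
      have h2 : ∀ y, (outgoing' k ‖x - y‖ * ((⟪x - y, x⟫_ℝ : ℝ) : ℂ)
          - (Complex.I * k * ‖x‖ - 1) * outgoing k ‖x - y‖) * f y
          = outgoing' k ‖x - y‖ * ((⟪x - y, x⟫_ℝ : ℝ) : ℂ) * f y
            - (Complex.I * k * ‖x‖ - 1) * (outgoing k ‖x - y‖ * f y) := fun y => by ring
      simp only [h2]
      rw [integral_sub (hiv x) (hi0.1.const_mul _), integral_const_mul, hw, hfd]
      ring
    rw [h1]
    refine hcalc (2 * k * ρ ^ 2 + 4 * ρ) _ (by positivity) (by nlinarith) (by positivity) _ ?_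
    exact (integrable_kernel_mul ((measurable_outgoing'_norm_sub k x x).sub
      ((measurable_outgoing_norm_sub k x).const_mul _))
      (fun y hy => norm_radial_outgoing_sub_le hk hρ hy hx) hf hfc hfρ).2
  · have hii : Integrable fun y => outgoing' k ‖x - y‖ * ((x i - y i : ℝ) : ℂ) * f y := by
      simpa [EuclideanSpace.inner_single_right] using hiv (EuclideanSpace.single i 1)
    have hmi : Measurable fun y : E3 => outgoing' k ‖x - y‖ * ((x i - y i : ℝ) : ℂ) := by
      simpa [EuclideanSpace.inner_single_right] using
        measurable_outgoing'_norm_sub k x (EuclideanSpace.single i 1)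
    have h1 : (‖x‖ : ℂ) ^ 2 * pderiv i w x - x i * fderiv ℝ w x x
        = c * ∫ y, ((‖x‖ : ℂ) ^ 2 * (outgoing' k ‖x - y‖ * ((x i - y i : ℝ) : ℂ))
          - x i * (outgoing' k ‖x - y‖ * ((⟪x - y, x⟫_ℝ : ℝ) : ℂ))) * f y := by
      have h2 : ∀ y : E3, ((‖x‖ : ℂ) ^ 2 * (outgoing' k ‖x - y‖ * ((x i - y i : ℝ) : ℂ))
          - x i * (outgoing' k ‖x - y‖ * ((⟪x - y, x⟫_ℝ : ℝ) : ℂ))) * f y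
          = (‖x‖ : ℂ) ^ 2 * (outgoing' k ‖x - y‖ * ((x i - y i : ℝ) : ℂ) * f y)
            - x i * (outgoing' k ‖x - y‖ * ((⟪x - y, x⟫_ℝ : ℝ) : ℂ) * f y) := fun y => by ring
      simp only [h2]
      rw [integral_sub (hii.const_mul _) ((hiv x).const_mul _), integral_const_mul,
        integral_const_mul, hpd, hfd]
      ring
    have h3 := (integrable_kernel_mul ((hmi.const_mul _).sub
      ((measurable_outgoing'_norm_sub k x x).const_mul _))
      (fun y hy => norm_tangential_outgoing_le hk hρ hy hx i) hf hfc hfρ).2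
    rw [h1, ← div_one M]
    exact hcalc (8 * (k + 1) * ρ) 1 (by positivity) (by nlinarith) one_pos _ (by simpa using h3)

end RadiatingAsymptotics

/-! ### Asymptotics of radiating solutions -/

section FarField

open Metric InnerProductSpace
open scoped ContDiff

variable {k M r₀ : ℝ} {u g v g' : E3 → ℂ}

/-- The asymptotic behaviour of outgoing waves, with far-field pattern `g`: decay, convergence to
the far field, the radial derivative `∂u/∂r ≈ (ik - 1/r) u` with an error of order `r⁻³`, and
tangential derivatives of order `r⁻²`. The derivatives are scaled: the third bound is multiplied
by `r`, the fourth one by `r²`. -/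
structure HasOutgoingAsymptotics (k M r₀ : ℝ) (u g : E3 → ℂ) : Prop where
  continuous : Continuous g
  pos : 0 < M
  one_le : 1 ≤ r₀
  decay : ∀ x, r₀ ≤ ‖x‖ → ‖u x‖ ≤ M / ‖x‖
  far : ∀ x, r₀ ≤ ‖x‖ →
    ‖u x - g (‖x‖⁻¹ • x) * sphericalHankelZero (k * ‖x‖)‖ ≤ M / ‖x‖ ^ 2
  radial : ∀ x, r₀ ≤ ‖x‖ → ‖fderiv ℝ u x x - (Complex.I * k * ‖x‖ - 1) * u x‖ ≤ M / ‖x‖ ^ 2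
  tangential : ∀ x, r₀ ≤ ‖x‖ → ∀ i, ‖(‖x‖ : ℂ) ^ 2 * pderiv i u x - x i * fderiv ℝ u x x‖ ≤ M

lemma HasOutgoingAsymptotics.mono (h : HasOutgoingAsymptotics k M r₀ u g) {M' r₁ : ℝ}
    (hM : M ≤ M') (hr : r₀ ≤ r₁) : HasOutgoingAsymptotics k M' r₁ u g where
  continuous := h.continuous
  pos := h.pos.trans_le hM
  one_le := h.one_le.trans hr
  decay x hx := (h.decay x (hr.trans hx)).trans (by gcongr)
  far x hx := (h.far x (hr.trans hx)).trans (by gcongr)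
  radial x hx := (h.radial x (hr.trans hx)).trans (by gcongr)
  tangential x hx i := (h.tangential x (hr.trans hx) i).trans hM

/-- Radiating solutions of the Helmholtz equation in the exterior of a ball have the outgoing
asymptotics: cut off near the ball, they are volume potentials. -/
theorem SommerfeldRadiation.exists_asymptotics (hk : 0 < k) {R₀ : ℝ} (hR₀ : 0 < R₀)
    (hu : ContDiffOn ℝ 2 u {x | R₀ < ‖x‖})
    (hH : ∀ x, R₀ < ‖x‖ → Laplacian.laplacian u x + (k : ℂ) ^ 2 * u x = 0)
    (hrad : SommerfeldRadiation k u) :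
    ∃ g M r₀, HasOutgoingAsymptotics k M r₀ u g := by
  set R := 2 * R₀ with hR
  have hRpos : 0 < R := by positivity
  have hopen : IsOpen {x : E3 | R₀ < ‖x‖} := isOpen_lt continuous_const continuous_norm
  have huat : ∀ x, R₀ < ‖x‖ → ContDiffAt ℝ 2 u x := fun x hx => hu.contDiffAt (hopen.mem_nhds hx)
  set w : E3 → ℂ := fun x => (1 - (cutoff R x : ℂ)) * u x with hw
  have hw0 : ∀ x, ‖x‖ < R → w =ᶠ[𝓝 x] 0 := by
    intro x hx
    filter_upwards [(isOpen_lt continuous_norm continuous_const).mem_nhds hx] with y hy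
    simp [hw, cutoff_eq_one hRpos (le_of_lt hy)]
  have hwu : ∀ x, 2 * R < ‖x‖ → w =ᶠ[𝓝 x] u := by
    intro x hx
    filter_upwards [(isOpen_lt continuous_const continuous_norm).mem_nhds hx] with y hy
    simp [hw, cutoff_eq_zero hRpos (le_of_lt hy)]
  have hwC : ContDiff ℝ 2 w := by
    rw [contDiff_iff_contDiffAt]
    intro x
    by_cases hx : ‖x‖ < R
    · exact contDiffAt_const.congr_of_eventuallyEq (hw0 x hx)
    · exact (contDiffAt_const.sub (contDiff_cutoff_complex R (n := 2)).contDiffAt).mul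
        (huat x (by linarith))
  have hfc : HasCompactSupport (helmholtzOp k w) := by
    refine HasCompactSupport.intro (isCompact_closedBall 0 (2 * R)) fun x hx => ?_
    rw [mem_closedBall_zero_iff, not_le] at hx
    rw [helmholtzOp_congr k (hwu x hx), helmholtzOp,
      ← laplacian_eq_divField (huat x (by linarith))]
    exact hH x (by linarith)
  have hwrad : SommerfeldRadiation k w := by
    refine Tendsto.congr' ?_ hrad
    filter_upwards [(tendsto_norm_cobounded_atTop (E := E3)).eventually_gt_atTop (2 * R)] with x hx
    rw [(hwu x hx).fderiv_eq, (hwu x hx).self_of_nhds]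
  have hc0 : (fundamentalConst : ℂ) ≠ 0 := Complex.ofReal_ne_zero.2 fundamentalConst_pos.ne'
  have hrep : ∀ x, w x = -(fundamentalConst : ℂ)⁻¹
      * ∫ y, outgoing k ‖x - y‖ * helmholtzOp k w y := by
    intro x
    have h1 := representation hk hwC hfc hwrad x
    simp only [sphericalWave, norm_sub_rev _ x] at h1
    rw [neg_mul, ← mul_neg, ← h1, inv_mul_cancel_left₀ hc0]
  obtain ⟨g, hg, M, r₀, hM, hr₀, h⟩ := potential_asymptotics hk
    (continuous_helmholtzOp k hwC) hfc hrep (hwC.differentiable two_ne_zero)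
  refine ⟨g, M, max r₀ (2 * R + 1), hg, hM, hr₀.trans (le_max_left _ _), ?_, ?_, ?_, ?_⟩ <;>
    intro x hx <;>
    obtain ⟨h1, h2, h3, h4⟩ := h x ((le_max_left _ _).trans hx) <;>
    have hx2 : 2 * R < ‖x‖ := by linarith [(le_max_right r₀ (2 * R + 1)).trans hx]
  · rwa [← (hwu x hx2).self_of_nhds]
  · rwa [← (hwu x hx2).self_of_nhds]
  · rwa [← (hwu x hx2).self_of_nhds, ← (hwu x hx2).fderiv_eq]
  · intro i
    rw [← pderiv_congr (hwu x hx2), ← (hwu x hx2).fderiv_eq]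
    exact h4 i

lemma norm_sphericalHankelZero (hk : 0 < k) {r : ℝ} (hr : 0 < r) :
    ‖sphericalHankelZero (k * r)‖ = (k * r)⁻¹ := by
  rw [sphericalHankelZero, ← mul_assoc Complex.I, norm_div, norm_exp_I_mul, norm_mul, norm_mul,
    Complex.norm_I, Complex.norm_real, Complex.norm_real, Real.norm_of_nonneg hk.le,
    Real.norm_of_nonneg hr.le, one_mul, one_div]

lemma HasOutgoingAsymptotics.farFieldPattern_eq (h : HasOutgoingAsymptotics k M r₀ u g)
    (hk : 0 < k) {θ : E3} (hθ : ‖θ‖ = 1) : farFieldPattern k u θ = g θ := by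
  refine Tendsto.limUnder_eq (tendsto_iff_norm_sub_tendsto_zero.2 ?_)
  have h1 : Tendsto (fun r : ℝ => M * k / r) atTop (𝓝 0) := tendsto_const_nhds.div_atTop tendsto_id
  refine squeeze_zero' (Eventually.of_forall fun _ => norm_nonneg _) ?_ h1
  filter_upwards [eventually_ge_atTop r₀] with r hr
  have hr0 : 0 < r := by linarith [h.one_le]
  have hn : ‖r • θ‖ = r := by rw [norm_smul, hθ, mul_one, Real.norm_of_nonneg hr0.le]
  have h2 := h.far (r • θ) (by rwa [hn])
  have hh := norm_sphericalHankelZero hk hr0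
  have hne : sphericalHankelZero (k * r) ≠ 0 := by
    rw [← norm_ne_zero_iff, hh]; positivity
  rw [hn, smul_smul, inv_mul_cancel₀ hr0.ne', one_smul] at h2
  have h3 : u (r • θ) / sphericalHankelZero (k * r) - g θ
      = (u (r • θ) - g θ * sphericalHankelZero (k * r)) / sphericalHankelZero (k * r) := by
    field_simp
  rw [h3, norm_div, hh, div_inv_eq_mul]
  calc _ ≤ M / r ^ 2 * (k * r) := by gcongr
    _ = M * k / r := by field_simp

lemma HasOutgoingAsymptotics.isFarFieldPattern (h : HasOutgoingAsymptotics k M r₀ u g)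
    (hk : 0 < k) : IsFarFieldPattern k u (farFieldPattern k u) := by
  refine Asymptotics.IsBigO.of_bound M ?_
  filter_upwards [(tendsto_norm_cobounded_atTop (E := E3)).eventually_ge_atTop r₀] with x hx
  have hx0 : 0 < ‖x‖ := by linarith [h.one_le]
  rw [h.farFieldPattern_eq hk (by rw [norm_smul, norm_inv, norm_norm, inv_mul_cancel₀ hx0.ne'])]
  refine (h.far x hx).trans (le_of_eq ?_)
  rw [norm_inv, norm_pow, norm_norm, div_eq_mul_inv]

/-- The Lagrangian-type density `∇u · ∇v̄ - k² u v̄` of two outgoing waves decays like `r⁻⁴`. -/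
lemma HasOutgoingAsymptotics.exists_lagrangian_bound (hk : 0 < k)
    (h : HasOutgoingAsymptotics k M r₀ u g) (h' : HasOutgoingAsymptotics k M r₀ v g') :
    ∃ D : ℝ, 0 < D ∧ ∀ x, r₀ ≤ ‖x‖ →
      ‖∑ i, pderiv i u x * starRingEnd ℂ (pderiv i v x)
        - k ^ 2 * (u x * starRingEnd ℂ (v x))‖ ≤ D / ‖x‖ ^ 4 := by
  have hM := h.pos
  refine ⟨M ^ 2 * (2 * (k + 1) + 5), by positivity, fun x hx => ?_⟩
  have hr1 : 1 ≤ ‖x‖ := h.one_le.trans hx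
  set r := ‖x‖ with hr
  have hr0 : 0 < r := by linarith
  have hrC : (r : ℂ) ≠ 0 := Complex.ofReal_ne_zero.2 hr0.ne'
  set a := fderiv ℝ u x x with ha
  set b := fderiv ℝ v x x with hb
  set S : Fin 3 → ℂ := fun i => (r : ℂ) ^ 2 * pderiv i u x - x i * a with hS
  set T : Fin 3 → ℂ := fun i => (r : ℂ) ^ 2 * pderiv i v x - x i * b with hT
  set p := a - (Complex.I * k * r - 1) * u x with hp
  set q := b - (Complex.I * k * r - 1) * v x with hq
  have hpn : ‖p‖ ≤ M / r ^ 2 := h.radial x hx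
  have hqn : ‖q‖ ≤ M / r ^ 2 := h'.radial x hx
  have hun : ‖u x‖ ≤ M / r := h.decay x hx
  have hvn : ‖v x‖ ≤ M / r := h'.decay x hx
  have hSn : ∀ i, ‖S i‖ ≤ M := h.tangential x hx
  have hTn : ∀ i, ‖T i‖ ≤ M := h'.tangential x hx
  have hnorm : ∑ i, (x i : ℂ) * x i = (r : ℂ) ^ 2 := by
    rw [hr, ← Complex.ofReal_pow, EuclideanSpace.real_norm_sq_eq]
    push_cast
    exact Finset.sum_congr rfl fun i _ => (sq _).symm
  have ha' : ∑ i, (x i : ℂ) * pderiv i u x = a := (fderiv_apply_eq_sum u x x).symm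
  have hb' : ∑ i, (x i : ℂ) * pderiv i v x = b := (fderiv_apply_eq_sum v x x).symm
  have hSx : ∑ i, (x i : ℂ) * S i = 0 := by
    have : ∀ i, (x i : ℂ) * S i = (r : ℂ) ^ 2 * ((x i : ℂ) * pderiv i u x)
        - a * ((x i : ℂ) * x i) := fun i => by simp only [hS]; ring
    simp only [this]
    rw [Finset.sum_sub_distrib, ← Finset.mul_sum, ← Finset.mul_sum, ha', hnorm]
    ring
  have hTx : ∑ i, (x i : ℂ) * starRingEnd ℂ (T i) = 0 := by
    have h1 : ∑ i, (x i : ℂ) * T i = 0 := by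
      have : ∀ i, (x i : ℂ) * T i = (r : ℂ) ^ 2 * ((x i : ℂ) * pderiv i v x)
          - b * ((x i : ℂ) * x i) := fun i => by simp only [hT]; ring
      simp only [this]
      rw [Finset.sum_sub_distrib, ← Finset.mul_sum, ← Finset.mul_sum, hb', hnorm]
      ring
    have h2 := congrArg (starRingEnd ℂ) h1
    simpa using h2
  -- Pythagoras: the radial and the tangential parts of the gradients are orthogonal
  have hpyth : (r : ℂ) ^ 4 * ∑ i, pderiv i u x * starRingEnd ℂ (pderiv i v x)
      = (r : ℂ) ^ 2 * (a * starRingEnd ℂ b) + ∑ i, S i * starRingEnd ℂ (T i) := by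
    have h1 : ∀ i, (r : ℂ) ^ 4 * (pderiv i u x * starRingEnd ℂ (pderiv i v x))
        = a * starRingEnd ℂ b * ((x i : ℂ) * x i) + starRingEnd ℂ b * ((x i : ℂ) * S i)
          + a * ((x i : ℂ) * starRingEnd ℂ (T i)) + S i * starRingEnd ℂ (T i) := by
      intro i
      simp only [hS, hT, map_sub, map_mul, map_pow, Complex.conj_ofReal]
      ring
    rw [Finset.mul_sum]
    simp only [h1]
    rw [Finset.sum_add_distrib, Finset.sum_add_distrib, Finset.sum_add_distrib, ← Finset.mul_sum,
      ← Finset.mul_sum, ← Finset.mul_sum, hnorm, hSx, hTx]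
    ring
  have hab : a * starRingEnd ℂ b = (k ^ 2 * r ^ 2 + 1) * (u x * starRingEnd ℂ (v x))
      + ((Complex.I * k * r - 1) * u x * starRingEnd ℂ q
        + p * starRingEnd ℂ ((Complex.I * k * r - 1) * v x) + p * starRingEnd ℂ q) := by
    have h1 : a = (Complex.I * k * r - 1) * u x + p := by rw [hp]; ring
    have h2 : b = (Complex.I * k * r - 1) * v x + q := by rw [hq]; ring
    rw [h1, h2]
    simp only [map_add, map_mul, map_sub, Complex.conj_I, Complex.conj_ofReal, map_one]
    linear_combination (-(k : ℂ) ^ 2 * r ^ 2 * (u x * starRingEnd ℂ (v x))) * Complex.I_sq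
  set E := u x * starRingEnd ℂ (v x) + ((Complex.I * k * r - 1) * u x * starRingEnd ℂ q
        + p * starRingEnd ℂ ((Complex.I * k * r - 1) * v x) + p * starRingEnd ℂ q) with hE
  have hmain : ∑ i, pderiv i u x * starRingEnd ℂ (pderiv i v x)
        - k ^ 2 * (u x * starRingEnd ℂ (v x))
      = (r ^ 2 * E + ∑ i, S i * starRingEnd ℂ (T i)) / r ^ 4 := by
    rw [eq_div_iff (pow_ne_zero 4 hrC), hE]
    rw [hab] at hpyth
    linear_combination hpyth
  have hIk : ‖(Complex.I * k * r - 1 : ℂ)‖ ≤ (k + 1) * r := by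
    refine (norm_sub_le _ _).trans ?_
    simp only [norm_mul, Complex.norm_I, Complex.norm_real, norm_one, Real.norm_of_nonneg hk.le,
      Real.norm_of_nonneg hr0.le]
    nlinarith
  have hEn : ‖E‖ ≤ M ^ 2 * (2 * (k + 1) + 2) / r ^ 2 := by
    have e1 : ‖u x * starRingEnd ℂ (v x)‖ ≤ M / r * (M / r) := by
      rw [norm_mul, RCLike.norm_conj]; gcongr
    have e2 : ‖(Complex.I * k * r - 1) * u x * starRingEnd ℂ q‖
        ≤ (k + 1) * r * (M / r) * (M / r ^ 2) := by
      rw [norm_mul, norm_mul, RCLike.norm_conj]; gcongr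
    have e3 : ‖p * starRingEnd ℂ ((Complex.I * k * r - 1) * v x)‖
        ≤ M / r ^ 2 * ((k + 1) * r * (M / r)) := by
      rw [norm_mul, RCLike.norm_conj, norm_mul]; gcongr
    have e4 : ‖p * starRingEnd ℂ q‖ ≤ M / r ^ 2 * (M / 1) := by
      rw [norm_mul, RCLike.norm_conj]
      gcongr
      exact hqn.trans (by gcongr; exact one_le_pow₀ hr1)
    calc ‖E‖ ≤ M / r * (M / r) + ((k + 1) * r * (M / r) * (M / r ^ 2)
          + M / r ^ 2 * ((k + 1) * r * (M / r)) + M / r ^ 2 * (M / 1)) := by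
          refine (norm_add_le _ _).trans (add_le_add e1 ?_)
          exact (norm_add_le _ _).trans (add_le_add ((norm_add_le _ _).trans (add_le_add e2 e3)) e4)
      _ = M ^ 2 * (2 * (k + 1) + 2) / r ^ 2 := by field_simp; ring
  have hST : ‖∑ i, S i * starRingEnd ℂ (T i)‖ ≤ 3 * M ^ 2 := by
    refine (norm_sum_le _ _).trans ?_
    calc ∑ i, ‖S i * starRingEnd ℂ (T i)‖ ≤ ∑ _i : Fin 3, M * M := by
          refine Finset.sum_le_sum fun i _ => ?_
          rw [norm_mul, RCLike.norm_conj]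
          exact mul_le_mul (hSn i) (hTn i) (norm_nonneg _) hM.le
      _ = 3 * M ^ 2 := by simp; ring
  rw [hmain, norm_div, norm_pow, Complex.norm_real, Real.norm_of_nonneg hr0.le]
  gcongr
  refine (norm_add_le _ _).trans ?_
  rw [norm_mul, norm_pow, Complex.norm_real, Real.norm_of_nonneg hr0.le]
  calc r ^ 2 * ‖E‖ + ‖∑ i, S i * starRingEnd ℂ (T i)‖
      ≤ r ^ 2 * (M ^ 2 * (2 * (k + 1) + 2) / r ^ 2) + 3 * M ^ 2 := by gcongr
    _ = M ^ 2 * (2 * (k + 1) + 5) := by field_simp; ring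

end FarField

/-! ### The energy flux of outgoing waves at infinity -/

section FluxAtInfinity

open Metric InnerProductSpace
open scoped ContDiff

variable {k M r₀ R : ℝ} {u g v g' : E3 → ℂ}

/-- Integration of a product in polar coordinates. -/
lemma integral_polar (h : ℝ → ℂ) (G : E3 → ℂ) :
    ∫ x : E3, h ‖x‖ * G (‖x‖⁻¹ • x)
      = (∫ θ : sphere (0 : E3) 1, G θ ∂(volume : Measure E3).toSphere)
        * ∫ r in Set.Ioi (0 : ℝ), (r : ℂ) ^ 2 * h r := by
  have h1 : ∫ x : E3, h ‖x‖ * G (‖x‖⁻¹ • x)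
      = ∫ x : ({(0 : E3)}ᶜ : Set E3), h ‖x.1‖ * G (‖x.1‖⁻¹ • x.1)
        ∂((volume : Measure E3).comap (↑)) := by
    rw [integral_subtype_comap (measurableSet_singleton _).compl
      fun x : E3 => h ‖x‖ * G (‖x‖⁻¹ • x), restrict_compl_singleton]
  have h2 := (volume : Measure E3).measurePreserving_homeomorphUnitSphereProd.integral_comp
    (Homeomorph.measurableEmbedding _)
    (fun p : sphere (0 : E3) 1 × Set.Ioi (0 : ℝ) => G p.1 * h p.2)
  have h3 : ∫ x : ({(0 : E3)}ᶜ : Set E3), h ‖x.1‖ * G (‖x.1‖⁻¹ • x.1)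
        ∂((volume : Measure E3).comap (↑))
      = ∫ p, G p.1 * h p.2 ∂(volume : Measure E3).toSphere.prod
        (.volumeIoiPow (Module.finrank ℝ E3 - 1)) := by
    rw [← h2]
    refine integral_congr_ae (Eventually.of_forall fun x => ?_)
    simp [mul_comm]
  have h4 : ∫ r : Set.Ioi (0 : ℝ), h r ∂(Measure.volumeIoiPow (Module.finrank ℝ E3 - 1))
      = ∫ r in Set.Ioi (0 : ℝ), (r : ℂ) ^ 2 * h r := by
    simp only [Measure.volumeIoiPow, ENNReal.ofReal, finrank_euclideanSpace, Fintype.card_fin]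
    rw [integral_withDensity_eq_integral_smul,
      integral_subtype_comap measurableSet_Ioi fun a => Real.toNNReal (a ^ (3 - 1)) • h a]
    · refine setIntegral_congr_fun measurableSet_Ioi fun x hx => ?_
      have hx0 : (0 : ℝ) ≤ x := le_of_lt hx
      simp only [NNReal.smul_def, Real.coe_toNNReal _ (pow_nonneg hx0 _), Complex.real_smul]
      norm_num
    · exact (measurable_subtype_coe.pow_const _).real_toNNReal
  rw [h1, h3, integral_prod_mul (fun θ : sphere (0 : E3) 1 => G θ)
    (fun r : Set.Ioi (0 : ℝ) => h r), h4]

/-- The radial profile of the cutoff density has total mass one. -/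
lemma integral_cutoff_profile (hR : 0 < R) :
    ∫ r in Set.Ioi (0 : ℝ), deriv Real.smoothTransition (2 - r ^ 2 / R ^ 2) * (2 * r / R ^ 2) = 1 := by
  have hd : ∀ r : ℝ, HasDerivAt (fun r : ℝ => -Real.smoothTransition (2 - r ^ 2 / R ^ 2))
      (deriv Real.smoothTransition (2 - r ^ 2 / R ^ 2) * (2 * r / R ^ 2)) r := by
    intro r
    have h1 : HasDerivAt (fun r : ℝ => 2 - r ^ 2 / R ^ 2) (-(2 * r / R ^ 2)) r := by
      simpa using (((hasDerivAt_id r).pow 2).div_const (R ^ 2)).const_sub 2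
    have h2 := (differentiable_smoothTransition (2 - r ^ 2 / R ^ 2)).hasDerivAt.comp r h1
    refine h2.neg.congr_deriv ?_
    ring
  have hc : Continuous fun r : ℝ =>
      deriv Real.smoothTransition (2 - r ^ 2 / R ^ 2) * (2 * r / R ^ 2) :=
    (continuous_deriv_smoothTransition.comp (by fun_prop)).mul (by fun_prop)
  have hs : HasCompactSupport fun r : ℝ =>
      deriv Real.smoothTransition (2 - r ^ 2 / R ^ 2) * (2 * r / R ^ 2) := by
    refine HasCompactSupport.intro (isCompact_closedBall (0 : ℝ) (2 * R)) fun r hr => ?_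
    rw [mem_closedBall_zero_iff, not_le, Real.norm_eq_abs] at hr
    rw [deriv_smoothTransition_of_neg, zero_mul]
    have : 2 < r ^ 2 / R ^ 2 := by
      rw [lt_div_iff₀ (by positivity), ← sq_abs r]
      nlinarith
    linarith
  have hlim : Tendsto (fun r : ℝ => -Real.smoothTransition (2 - r ^ 2 / R ^ 2)) atTop (𝓝 0) := by
    refine tendsto_const_nhds.congr' ?_
    filter_upwards [eventually_ge_atTop (2 * R)] with r hr
    rw [Real.smoothTransition.zero_of_nonpos, neg_zero]
    have : 2 ≤ r ^ 2 / R ^ 2 := by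
      rw [le_div_iff₀ (by positivity)]
      nlinarith
    linarith
  rw [integral_Ioi_of_hasDerivAt_of_tendsto' (fun r _ => hd r)
    (hc.integrable_of_hasCompactSupport hs).integrableOn hlim]
  simp [Real.smoothTransition.one_of_one_le]

lemma integral_cutoffDensity_mul (hR : 0 < R) (G : E3 → ℂ) :
    ∫ y, (cutoffDensity R y : ℂ) * (G (‖y‖⁻¹ • y) / ‖y‖)
      = ∫ θ : sphere (0 : E3) 1, G θ ∂(volume : Measure E3).toSphere := by
  have h1 : ∀ y : E3, (cutoffDensity R y : ℂ) * (G (‖y‖⁻¹ • y) / ‖y‖)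
      = ((deriv Real.smoothTransition (2 - ‖y‖ ^ 2 / R ^ 2) * (2 / R ^ 2) / ‖y‖ : ℝ) : ℂ)
        * G (‖y‖⁻¹ • y) := by
    intro y
    rw [cutoffDensity]
    push_cast
    ring
  simp only [h1]
  rw [integral_polar (fun r => ((deriv Real.smoothTransition (2 - r ^ 2 / R ^ 2) * (2 / R ^ 2) / r
    : ℝ) : ℂ)) G]
  have h2 : ∫ r in Set.Ioi (0 : ℝ), (r : ℂ) ^ 2 *
      ((deriv Real.smoothTransition (2 - r ^ 2 / R ^ 2) * (2 / R ^ 2) / r : ℝ) : ℂ)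
      = ∫ r in Set.Ioi (0 : ℝ),
        ((deriv Real.smoothTransition (2 - r ^ 2 / R ^ 2) * (2 * r / R ^ 2) : ℝ) : ℂ) := by
    refine setIntegral_congr_fun measurableSet_Ioi fun r hr => ?_
    have hr0 : (r : ℂ) ≠ 0 := Complex.ofReal_ne_zero.2 (ne_of_gt hr)
    push_cast
    field_simp
  have h3 : ∫ r in Set.Ioi (0 : ℝ),
        ((deriv Real.smoothTransition (2 - r ^ 2 / R ^ 2) * (2 * r / R ^ 2) : ℝ) : ℂ)
      = ((1 : ℝ) : ℂ) := by
    rw [← integral_cutoff_profile hR]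
    exact integral_ofReal
  rw [h2, h3, Complex.ofReal_one, mul_one]

lemma integrable_cutoffDensity_mul (hR : 0 < R) {Z : E3 → ℂ} (hZ : ContinuousOn Z {y | R ≤ ‖y‖}) :
    Integrable fun y => (cutoffDensity R y : ℂ) * Z y := by
  have hK : IsCompact ({y : E3 | R ≤ ‖y‖} ∩ closedBall 0 (2 * R)) :=
    (isCompact_closedBall 0 (2 * R)).inter_left (isClosed_le continuous_const continuous_norm)
  refine (integrableOn_iff_integrable_of_support_subset
    (s := {y : E3 | R ≤ ‖y‖} ∩ closedBall 0 (2 * R)) fun y hy => ?_).1 ?_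
  · have h1 := mem_of_cutoffDensity_ne_zero hR (y := y) fun h0 => hy (by simp [h0])
    exact ⟨h1.1, mem_closedBall_zero_iff.2 h1.2⟩
  · refine ContinuousOn.integrableOn_compact hK ?_
    exact ((Complex.continuous_ofReal.comp (continuous_cutoffDensity R)).continuousOn).mul
      (hZ.mono Set.inter_subset_left)

/-- The radial flux density of two outgoing waves approaches the product of the far fields. -/
lemma HasOutgoingAsymptotics.flux_bound (hk : 0 < k)
    (h : HasOutgoingAsymptotics k M r₀ u g) (h' : HasOutgoingAsymptotics k M r₀ v g')
    {x : E3} (hx : r₀ ≤ ‖x‖) :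
    ‖u x * starRingEnd ℂ (fderiv ℝ v x x)
      - -(Complex.I / k) * (g (‖x‖⁻¹ • x) * starRingEnd ℂ (g' (‖x‖⁻¹ • x)) / ‖x‖)‖
      ≤ (3 * k + 2) * M ^ 2 / ‖x‖ ^ 2 := by
  have hM := h.pos
  have hr1 : 1 ≤ ‖x‖ := h.one_le.trans hx
  set r := ‖x‖ with hr
  have hr0 : 0 < r := by linarith
  have hrC : (r : ℂ) ≠ 0 := Complex.ofReal_ne_zero.2 hr0.ne'
  have hkC : (k : ℂ) ≠ 0 := Complex.ofReal_ne_zero.2 hk.ne'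
  set θ := r⁻¹ • x with hθ
  set H := sphericalHankelZero (k * r) with hH
  set e := u x - g θ * H with he
  set e' := v x - g' θ * H with he'
  set q := fderiv ℝ v x x - (Complex.I * k * r - 1) * v x with hq
  have hun : ‖u x‖ ≤ M / r := h.decay x hx
  have hvn : ‖v x‖ ≤ M / r := h'.decay x hx
  have hen : ‖e‖ ≤ M / r ^ 2 := h.far x hx
  have hen' : ‖e'‖ ≤ M / r ^ 2 := h'.far x hx
  have hqn : ‖q‖ ≤ M / r ^ 2 := h'.radial x hx
  have hr2 : M / r ^ 2 ≤ M / r := by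
    gcongr
    nlinarith
  have hgn : ‖g θ * H‖ ≤ 2 * M / r := by
    have : g θ * H = u x - e := by rw [he]; ring
    rw [this]
    calc _ ≤ M / r + M / r := (norm_sub_le _ _).trans (add_le_add hun (hen.trans hr2))
      _ = _ := by ring
  have hHH : H * starRingEnd ℂ H = 1 / ((k : ℂ) * r) ^ 2 := by
    rw [Complex.mul_conj, Complex.normSq_eq_norm_sq, hH, norm_sphericalHankelZero hk hr0]
    push_cast
    ring
  -- leading term of `u v̄`
  set P := u x * starRingEnd ℂ (v x) - g θ * starRingEnd ℂ (g' θ) * (1 / ((k : ℂ) * r) ^ 2)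
    with hP
  have hPn : ‖P‖ ≤ 3 * M ^ 2 / r ^ 3 := by
    have h1 : P = g θ * H * starRingEnd ℂ e' + e * starRingEnd ℂ (v x) := by
      rw [hP, ← hHH, he, he', map_sub, map_mul]
      ring
    rw [h1]
    refine (norm_add_le _ _).trans ?_
    rw [norm_mul (g θ * H), norm_mul e, RCLike.norm_conj, RCLike.norm_conj]
    calc _ ≤ 2 * M / r * (M / r ^ 2) + M / r ^ 2 * (M / r) := by gcongr
      _ = _ := by field_simp; ring
  have hmain : u x * starRingEnd ℂ (fderiv ℝ v x x)
      - -(Complex.I / k) * (g θ * starRingEnd ℂ (g' θ) / r)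
      = -(Complex.I * k * r) * P - u x * starRingEnd ℂ (v x) + u x * starRingEnd ℂ q := by
    have h1 : fderiv ℝ v x x = (Complex.I * k * r - 1) * v x + q := by rw [hq]; ring
    rw [h1, hP]
    simp only [map_add, map_mul, map_sub, Complex.conj_I, Complex.conj_ofReal, map_one]
    field_simp
    ring
  rw [hmain]
  refine (norm_add_le _ _).trans ((add_le_add_left (norm_sub_le _ _) _).trans ?_)
  simp only [norm_mul, norm_neg, Complex.norm_I, Complex.norm_real, Real.norm_of_nonneg hk.le,
    Real.norm_of_nonneg hr0.le, RCLike.norm_conj, one_mul]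
  calc k * r * ‖P‖ + ‖u x‖ * ‖v x‖ + ‖u x‖ * ‖q‖
      ≤ k * r * (3 * M ^ 2 / r ^ 3) + M / r * (M / r) + M / r * (M / r) := by
        gcongr
        exact hqn.trans hr2
    _ = _ := by field_simp; ring

/-- The flux of two outgoing waves through large spheres, averaged with the cutoff density. -/
theorem HasOutgoingAsymptotics.tendsto_flux (hk : 0 < k)
    (h : HasOutgoingAsymptotics k M r₀ u g) (h' : HasOutgoingAsymptotics k M r₀ v g')
    (huc : ContinuousOn u {x | r₀ ≤ ‖x‖}) (hvc : ContinuousOn (fderiv ℝ v) {x | r₀ ≤ ‖x‖}) :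
    Tendsto (fun R => ∫ y, (cutoffDensity R y : ℂ) * (u y * starRingEnd ℂ (fderiv ℝ v y y))) atTop
      (𝓝 (-(Complex.I / k) * ∫ θ : sphere (0 : E3) 1, g θ * starRingEnd ℂ (g' θ)
        ∂(volume : Measure E3).toSphere)) := by
  obtain ⟨B, hB, hbound⟩ := exists_cutoffDensity_bound
  have hM := h.pos
  rw [tendsto_iff_norm_sub_tendsto_zero]
  have hlim : Tendsto (fun R : ℝ => B * ((3 * k + 2) * M ^ 2) / R) atTop (𝓝 0) :=
    tendsto_const_nhds.div_atTop tendsto_id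
  refine squeeze_zero' (Eventually.of_forall fun _ => norm_nonneg _) ?_ hlim
  filter_upwards [eventually_ge_atTop r₀] with R hR
  have hR0 : 0 < R := by linarith [h.one_le]
  set G : E3 → ℂ := fun θ => g θ * starRingEnd ℂ (g' θ) with hG
  have hGc : Continuous G := h.continuous.mul (Complex.continuous_conj.comp h'.continuous)
  have hi1 : Integrable fun y => (cutoffDensity R y : ℂ) *
      (u y * starRingEnd ℂ (fderiv ℝ v y y)) := by
    refine integrable_cutoffDensity_mul hR0 ?_
    have hsub : {y : E3 | R ≤ ‖y‖} ⊆ {y | r₀ ≤ ‖y‖} := fun y hy => hR.trans hy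
    exact (huc.mono hsub).mul (Complex.continuous_conj.comp_continuousOn
      ((hvc.mono hsub).clm_apply continuousOn_id))
  have hi2 : Integrable fun y : E3 => (cutoffDensity R y : ℂ) * (G (‖y‖⁻¹ • y) / ‖y‖) := by
    refine integrable_cutoffDensity_mul hR0 ?_
    have hne : ∀ y ∈ {y : E3 | R ≤ ‖y‖}, ‖y‖ ≠ 0 := fun y hy => (hR0.trans_le hy).ne'
    refine ContinuousOn.div (hGc.comp_continuousOn
      ((continuous_norm.continuousOn.inv₀ hne).smul continuousOn_id))
      (Complex.continuous_ofReal.comp continuous_norm).continuousOn fun y hy =>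
        Complex.ofReal_ne_zero.2 (hne y hy)
  have h1 : (∫ y, (cutoffDensity R y : ℂ) * (u y * starRingEnd ℂ (fderiv ℝ v y y)))
      - -(Complex.I / k) * ∫ θ : sphere (0 : E3) 1, g θ * starRingEnd ℂ (g' θ)
        ∂(volume : Measure E3).toSphere
      = ∫ y, (cutoffDensity R y : ℂ) * (u y * starRingEnd ℂ (fderiv ℝ v y y)
        - -(Complex.I / k) * (G (‖y‖⁻¹ • y) / ‖y‖)) := by
    rw [← integral_cutoffDensity_mul hR0 G, ← integral_const_mul, ← integral_sub hi1
      (hi2.const_mul _)]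
    refine integral_congr_ae (Eventually.of_forall fun y => ?_)
    dsimp only
    ring
  rw [h1]
  refine (hbound R ((3 * k + 2) * M ^ 2 / R ^ 2) _ hR0 fun y hy _ => ?_).trans (le_of_eq ?_)
  · refine (h.flux_bound hk h' (hR.trans hy)).trans ?_
    gcongr
  · field_simp

end FluxAtInfinity

/-! ### Geometry of the exterior region -/

section Exterior

open Metric InnerProductSpace
open scoped ContDiff

/-- The closure of a `C¹` domain is a set of unique differentiability, as it contains a cone with
apex at every boundary point. -/
lemma HasOutwardUnitNormal.uniqueDiffOn_closure {V : Set E3} {ν : E3 → E3}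
    (h : HasOutwardUnitNormal V ν) (hV : IsOpen V) : UniqueDiffOn ℝ (closure V) := by
  intro x hx
  by_cases hxV : x ∈ V
  · exact (hV.uniqueDiffWithinAt hxV).mono subset_closure
  have hxf : x ∈ frontier V := by rw [hV.frontier_eq]; exact ⟨hx, hxV⟩
  obtain ⟨δ, φ, hf⟩ := h.exists_isFlatAt hxf (ε := 1 / 2) (by norm_num) (by norm_num)
  have hd := hf.pos
  set K : Set E3 := ball x δ ∩ {y | 1 / 2 * ‖y - x‖ + ⟪ν x, y - x⟫_ℝ < 0} with hK
  have hKV : K ⊆ closure V := by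
    rintro y ⟨hy, hy'⟩
    refine subset_closure ((hf.mem_iff y hy).2 ?_)
    rw [← (hf.frontier_iff hV (mem_ball_self hd)).1 hxf]
    refine hf.lt_of_inner hy (mem_ball_self hd) ?_
    rw [Set.mem_ofPred_eq] at hy'
    rw [norm_sub_rev, ← neg_sub y x, inner_neg_right]
    linarith
  have hKo : IsOpen K := isOpen_ball.inter (isOpen_lt (by fun_prop) continuous_const)
  have hKc : Convex ℝ K := by
    refine (convex_ball x δ).inter ?_
    have h1 : ConvexOn ℝ Set.univ fun y : E3 => 1 / 2 * ‖y - x‖ + ⟪ν x, y - x⟫_ℝ := by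
      refine ⟨convex_univ, fun y _ z _ a b ha hb hab => ?_⟩
      have h2 : a • y + b • z - x = a • (y - x) + b • (z - x) := by
        have : x = a • x + b • x := by rw [← add_smul, hab, one_smul]
        nth_rewrite 1 [this]
        module
      have h3 : ‖a • (y - x) + b • (z - x)‖ ≤ a * ‖y - x‖ + b * ‖z - x‖ := by
        refine (norm_add_le _ _).trans ?_
        rw [norm_smul, norm_smul, Real.norm_of_nonneg ha, Real.norm_of_nonneg hb]
      dsimp only
      rw [h2, inner_add_right, inner_smul_right, inner_smul_right, smul_eq_mul, smul_eq_mul]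
      nlinarith
    simpa using h1.convex_lt 0
  have hlim : Tendsto (fun t : ℝ => x - t • ν x) (𝓝[>] 0) (𝓝 x) := by
    have : Continuous fun t : ℝ => x - t • ν x := by fun_prop
    simpa using (this.tendsto 0).mono_left nhdsWithin_le_nhds
  have hev : ∀ᶠ t in 𝓝[>] (0 : ℝ), x - t • ν x ∈ K := by
    filter_upwards [hlim (ball_mem_nhds x hd), self_mem_nhdsWithin] with t ht1 ht2
    refine ⟨ht1, ?_⟩
    have ht : 0 < t := ht2
    rw [Set.mem_ofPred_eq, sub_sub_cancel_left, norm_neg, norm_smul, inner_neg_right,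
      inner_smul_right, real_inner_self_eq_norm_sq, hf.norm_normal, Real.norm_of_nonneg ht.le]
    linarith
  refine (uniqueDiffWithinAt_convex hKc ?_ (mem_closure_of_tendsto hlim hev)).mono hKV
  rw [hKo.interior_eq]
  obtain ⟨t, ht⟩ := hev.exists
  exact ⟨_, ht⟩

namespace Cluster

variable {N : ℕ} (C : Cluster N)

lemma mem_V_zero_iff {x : E3} : x ∈ C.V 0 ↔ ∀ n ≠ 0, x ∉ closure (C.V n) := by
  rw [C.V_zero, (Set.toFinite _).closure_biUnion]
  simp

lemma isOpen_region (n : Fin (N + 1)) : IsOpen (C.V n) := by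
  by_cases hn : n = 0
  · rw [hn, C.V_zero]
    exact isClosed_closure.isOpen_compl
  · exact C.isOpen_V n hn

lemma eq_of_mem_frontier {m n : Fin (N + 1)} (hm : m ≠ 0) (hn : n ≠ 0) {x : E3}
    (hxm : x ∈ closure (C.V m)) (hxn : x ∈ closure (C.V n)) : m = n := by
  by_contra hmn
  exact Set.disjoint_left.1 (C.disjoint_V m hm n hn hmn) hxm hxn

lemma exists_mem_frontier_of_mem_frontier_zero {x : E3} (hx : x ∈ frontier (C.V 0)) :
    ∃ n ≠ 0, x ∈ frontier (C.V n) := by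
  rw [(C.isOpen_region 0).frontier_eq, Set.mem_sdiff, C.mem_V_zero_iff] at hx
  push Not at hx
  obtain ⟨hx0, n, hn, hxn⟩ := hx
  refine ⟨n, hn, ?_⟩
  rw [(C.isOpen_region n).frontier_eq]
  refine ⟨hxn, fun hxV => ?_⟩
  obtain ⟨y, hy, hy0⟩ := mem_closure_iff_nhds.1 hx0 _ ((C.isOpen_region n).mem_nhds hxV)
  exact C.mem_V_zero_iff.1 hy0 n hn (subset_closure hy)

/-- The unit normal on the boundary of the exterior region, pointing out of the exterior region and
into the scatterers. -/
noncomputable def exteriorNormal (x : E3) : E3 :=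
  -∑ n : Fin (N + 1) with n ≠ 0, (frontier (C.V n)).indicator (C.ν n) x

lemma exteriorNormal_eq {n : Fin (N + 1)} (hn : n ≠ 0) {x : E3} (hx : x ∈ frontier (C.V n)) :
    C.exteriorNormal x = -C.ν n x := by
  rw [exteriorNormal, Finset.sum_eq_single n, Set.indicator_of_mem hx]
  · intro m hm hmn
    rw [Set.indicator_of_notMem]
    intro hxm
    exact hmn (C.eq_of_mem_frontier (Finset.mem_filter.1 hm).2 hn hxm.1 hx.1)
  · intro h
    simp [hn] at h

/-- Near a boundary point of a scatterer, the exterior region is the complement of the closure of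
this scatterer: it is the set `{φ > 0}` if the scatterer is `{φ < 0}`. -/
lemma exists_exterior_function {n : Fin (N + 1)} (hn : n ≠ 0) {x : E3}
    (hx : x ∈ frontier (C.V n)) :
    ∃ (U : Set E3) (φ : E3 → ℝ), IsOpen U ∧ x ∈ U ∧ ContDiffOn ℝ 1 φ U ∧
      (∀ y ∈ U, gradient φ y ≠ 0) ∧ (∀ y ∈ U, y ∈ C.V 0 ↔ 0 < φ y) ∧
      (∀ y ∈ U, y ∈ frontier (C.V n) → φ y = 0) ∧
      (∀ m ≠ 0, ∀ y ∈ U, y ∈ frontier (C.V m) → m = n) ∧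
      ∀ y ∈ frontier (C.V n) ∩ U, C.ν n y = ‖gradient φ y‖⁻¹ • gradient φ y := by
  obtain ⟨U, φ, hU, hxU, hφ, hφ0, hVU, hν⟩ := C.normal_V n hn x hx
  set W : Set E3 := U ∩ (⋃ m ∈ {m : Fin (N + 1) | m ≠ 0 ∧ m ≠ n}, closure (C.V m))ᶜ with hW
  have hWo : IsOpen W :=
    hU.inter ((Set.toFinite _).isClosed_biUnion fun _ _ => isClosed_closure).isOpen_compl
  have hWm : ∀ y ∈ W, ∀ m ≠ 0, y ∈ closure (C.V m) → m = n := by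
    intro y hy m hm hym
    by_contra hmn
    exact hy.2 (Set.mem_biUnion (show m ∈ {m | m ≠ 0 ∧ m ≠ n} from ⟨hm, hmn⟩) hym)
  have hxW : x ∈ W := by
    refine ⟨hxU, ?_⟩
    simp only [Set.mem_compl_iff, Set.mem_iUnion, not_exists]
    intro m hm hxm
    exact hm.2 (C.eq_of_mem_frontier hm.1 hn hxm hx.1)
  have hmem : ∀ y ∈ U, y ∈ C.V n ↔ φ y < 0 := by
    intro y hy
    have : y ∈ C.V n ∩ U ↔ y ∈ {y ∈ U | φ y < 0} := by rw [hVU]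
    simpa [hy] using this
  have hcl : ∀ y ∈ U, y ∈ closure (C.V n) → φ y ≤ 0 := by
    intro y hy hyV
    by_contra! hpos
    have h1 : ∀ᶠ z in 𝓝 y, 0 < φ z :=
      (hφ.continuousOn.continuousAt (hU.mem_nhds hy)).eventually (lt_mem_nhds hpos)
    obtain ⟨z, ⟨hz1, hz2⟩, hz3⟩ :=
      mem_closure_iff_nhds.1 hyV _ (Filter.inter_mem h1 (hU.mem_nhds hy))
    have h2 := (hmem z hz2).1 hz3
    rw [Set.mem_ofPred_eq] at hz1
    linarith
  -- zeros of `φ` are not local minima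
  have hcl' : ∀ y ∈ U, φ y = 0 → y ∈ closure (C.V n) := by
    intro y hy hy0
    by_contra hyV
    have hmin : IsLocalMin φ y := by
      filter_upwards [hU.mem_nhds hy, isClosed_closure.isOpen_compl.mem_nhds hyV] with z hz1 hz2
      rw [hy0]
      by_contra! h
      exact hz2 (subset_closure ((hmem z hz1).2 h))
    exact hφ0 y hy (by rw [gradient, hmin.fderiv_eq_zero, map_zero])
  refine ⟨W, φ, hWo, hxW, hφ.mono Set.inter_subset_left, fun y hy => hφ0 y hy.1, ?_, ?_, ?_, ?_⟩
  · intro y hy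
    rw [C.mem_V_zero_iff]
    constructor
    · intro h
      by_contra! hle
      rcases hle.lt_or_eq with h1 | h1
      · exact h n hn (subset_closure ((hmem y hy.1).2 h1))
      · exact h n hn (hcl' y hy.1 h1)
    · intro h m hm hym
      rw [hWm y hy m hm hym] at hym
      linarith [hcl y hy.1 hym]
  · intro y hy hyf
    refine le_antisymm (hcl y hy.1 hyf.1) ?_
    by_contra! h
    rw [(C.isOpen_region n).frontier_eq] at hyf
    exact hyf.2 ((hmem y hy.1).2 h)
  · intro m hm y hy hyf
    exact hWm y hy m hm hyf.1
  · intro y hy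
    exact hν y ⟨hy.1, hy.2.1⟩

lemma mem_frontier_zero {n : Fin (N + 1)} (hn : n ≠ 0) {x : E3} (hx : x ∈ frontier (C.V n)) :
    x ∈ frontier (C.V 0) := by
  obtain ⟨U, φ, hU, hxU, -, hφ0, hV0, hf, -⟩ := C.exists_exterior_function hn hx
  rw [(C.isOpen_region 0).frontier_eq]
  refine ⟨?_, fun h => C.mem_V_zero_iff.1 h n hn hx.1⟩
  by_contra hxV
  have hmax : IsLocalMax φ x := by
    filter_upwards [hU.mem_nhds hxU, isClosed_closure.isOpen_compl.mem_nhds hxV] with z hz1 hz2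
    rw [hf x hxU hx]
    by_contra! h
    exact hz2 (subset_closure ((hV0 z hz1).2 h))
  exact hφ0 x hxU (by rw [gradient, hmax.fderiv_eq_zero, map_zero])

lemma frontier_zero : frontier (C.V 0) = ⋃ n ∈ ({n | n ≠ 0} : Finset (Fin (N + 1))),
    frontier (C.V n) := by
  ext x
  simp only [Set.mem_iUnion, Finset.mem_filter, Finset.mem_univ, true_and, exists_prop]
  exact ⟨C.exists_mem_frontier_of_mem_frontier_zero, fun ⟨n, hn, hx⟩ => C.mem_frontier_zero hn hx⟩

lemma normal_V_zero : HasOutwardUnitNormal (C.V 0) C.exteriorNormal := by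
  intro x hx
  obtain ⟨n, hn, hxn⟩ := C.exists_mem_frontier_of_mem_frontier_zero hx
  obtain ⟨U, φ, hU, hxU, hφ, hφ0, hV0, -, hm, hν⟩ := C.exists_exterior_function hn hxn
  have hgrad : ∀ y, gradient (fun y => -φ y) y = -gradient φ y := by
    intro y
    rw [gradient, fderiv_fun_neg, map_neg, gradient]
  refine ⟨U, fun y => -φ y, hU, hxU, hφ.neg, fun y hy => ?_, ?_, ?_⟩
  · rw [hgrad]
    exact neg_ne_zero.2 (hφ0 y hy)
  · ext y
    constructor
    · rintro ⟨h1, h2⟩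
      exact ⟨h2, by simpa using (hV0 y h2).1 h1⟩
    · rintro ⟨h1, h2⟩
      exact ⟨(hV0 y h1).2 (by simpa using h2), h1⟩
  · rintro y ⟨hy1, hy2⟩
    obtain ⟨m, hm0, hym⟩ := C.exists_mem_frontier_of_mem_frontier_zero hy1
    have hmn := hm m hm0 y hy2 hym
    rw [hmn] at hym
    rw [C.exteriorNormal_eq hn hym, hgrad, norm_neg, hν y ⟨hym, hy2⟩, smul_neg]

lemma hasOutwardUnitNormal_region (n : Fin (N + 1)) :
    HasOutwardUnitNormal (C.V n) (if n = 0 then C.exteriorNormal else C.ν n) := by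
  by_cases hn : n = 0
  · rw [if_pos hn, hn]
    exact C.normal_V_zero
  · rw [if_neg hn]
    exact C.normal_V n hn

lemma uniqueDiffOn_closure (n : Fin (N + 1)) : UniqueDiffOn ℝ (closure (C.V n)) :=
  (C.hasOutwardUnitNormal_region n).uniqueDiffOn_closure (C.isOpen_region n)

/-- Far away there is only the exterior region. -/
lemma exists_radius : ∃ R₀ : ℝ, 0 < R₀ ∧ ∀ x, x ∉ C.V 0 → ‖x‖ < R₀ := by
  have hb : Bornology.IsBounded (closure (⋃ n ∈ {n : Fin (N + 1) | n ≠ 0}, C.V n)) :=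
    ((Bornology.isBounded_biUnion (Set.toFinite _)).2 fun n hn => C.isBounded_V n hn).closure
  obtain ⟨R, hR, hsub⟩ := hb.subset_ball_lt 0 0
  refine ⟨R, hR, fun x hx => ?_⟩
  rw [C.V_zero, Set.notMem_compl_iff] at hx
  exact mem_ball_zero_iff.1 (hsub hx)

end Cluster

end Exterior

/-! ### Green's identity for Helmholtz solutions -/

section Green

open Metric InnerProductSpace
open scoped ContDiff

variable {V : Set E3} {ν : E3 → E3} {u v : E3 → ℂ} {κ : ℂ} {x : E3}

lemma partialDeriv_eq_pderiv (hV : IsOpen V) (hx : x ∈ V) (i : Fin 3) :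
    partialDeriv V u i x = pderiv i u x := by
  rw [partialDeriv, fderivWithin_of_mem_nhds (mem_of_superset (hV.mem_nhds hx) subset_closure)]

lemma dirDeriv_eq_fderiv (hV : IsOpen V) (hx : x ∈ V) (w : E3) :
    dirDeriv V u w x = fderiv ℝ u x w := by
  rw [dirDeriv, fderivWithin_of_mem_nhds (mem_of_superset (hV.mem_nhds hx) subset_closure)]

lemma dirDeriv_eq_sum (w : E3) : dirDeriv V u w x = ∑ i, (w i : ℂ) * partialDeriv V u i x := by
  have h1 : w = ∑ i, w i • (EuclideanSpace.single i (1 : ℝ) : E3) := by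
    ext j
    simp [Finset.sum_apply, Pi.single_apply]
  rw [dirDeriv]
  conv_lhs => rw [h1]
  rw [map_sum]
  exact Finset.sum_congr rfl fun i _ => by rw [map_smul, Complex.real_smul, partialDeriv]

lemma partialDeriv_conjField (hU : UniqueDiffOn ℝ (closure V)) (hx : x ∈ closure V) (i : Fin 3) :
    partialDeriv V (conjField u) i x = starRingEnd ℂ (partialDeriv V u i x) := by
  have h1 : conjField u = Complex.conjCLE ∘ u := rfl
  rw [partialDeriv, h1, Complex.conjCLE.comp_fderivWithin (hU x hx)]
  rfl

lemma continuousOn_partialDeriv (hU : UniqueDiffOn ℝ (closure V))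
    (hu : ContDiffOn ℝ 1 u (closure V)) (i : Fin 3) :
    ContinuousOn (partialDeriv V u i) (closure V) :=
  (hu.continuousOn_fderivWithin hU le_rfl).clm_apply continuousOn_const

/-- The integrand `∇u · ∇v̄ - c u v̄` in Green's first identity. -/
noncomputable def greenDensity (V : Set E3) (c : ℂ) (u v : E3 → ℂ) (x : E3) : ℂ :=
  ∑ i, partialDeriv V u i x * starRingEnd ℂ (partialDeriv V v i x)
    - c * (u x * starRingEnd ℂ (v x))

/-- The vector field `u ∇v̄`. -/
noncomputable def greenField (V : Set E3) (u v : E3 → ℂ) (i : Fin 3) (x : E3) : ℂ :=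
  u x * starRingEnd ℂ (partialDeriv V v i x)

lemma continuousOn_greenDensity (hU : UniqueDiffOn ℝ (closure V)) (c : ℂ)
    (hu : ContDiffOn ℝ 1 u (closure V)) (hv : ContDiffOn ℝ 1 v (closure V)) :
    ContinuousOn (greenDensity V c u v) (closure V) := by
  refine (continuousOn_finsetSum _ fun i _ => (continuousOn_partialDeriv hU hu i).mul
    (Complex.continuous_conj.comp_continuousOn (continuousOn_partialDeriv hU hv i))).sub
    (continuousOn_const.mul (hu.continuousOn.mul
      (Complex.continuous_conj.comp_continuousOn hv.continuousOn)))

lemma continuousOn_greenField (hU : UniqueDiffOn ℝ (closure V))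
    (hu : ContDiffOn ℝ 1 u (closure V)) (hv : ContDiffOn ℝ 1 v (closure V)) (i : Fin 3) :
    ContinuousOn (greenField V u v i) (closure V) :=
  hu.continuousOn.mul
    (Complex.continuous_conj.comp_continuousOn (continuousOn_partialDeriv hU hv i))

lemma greenField_eventuallyEq (hV : IsOpen V) (hx : x ∈ V) (i : Fin 3) :
    greenField V u v i =ᶠ[𝓝 x] fun y => u y * starRingEnd ℂ (pderiv i v y) := by
  filter_upwards [hV.mem_nhds hx] with y hy
  rw [greenField, partialDeriv_eq_pderiv hV hy]

lemma contDiffAt_pderiv (hv : ContDiffAt ℝ 2 v x) (i : Fin 3) : ContDiffAt ℝ 1 (pderiv i v) x :=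
  (hv.fderiv_right (m := 1) (by norm_num)).clm_apply contDiffAt_const

lemma contDiffAt_conj {w : E3 → ℂ} {n : WithTop ℕ∞} (hw : ContDiffAt ℝ n w x) :
    ContDiffAt ℝ n (fun y => starRingEnd ℂ (w y)) x :=
  Complex.conjCLE.contDiff.contDiffAt.comp x hw

lemma contDiffOn_greenField (hV : IsOpen V) (hu : ContDiffOn ℝ 2 u V) (hv : ContDiffOn ℝ 2 v V)
    (i : Fin 3) : ContDiffOn ℝ 1 (greenField V u v i) V := by
  intro x hx
  have hx' := hV.mem_nhds hx
  have h1 : ContDiffAt ℝ 1 (fun y => u y * starRingEnd ℂ (pderiv i v y)) x :=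
    ((hu.contDiffAt hx').of_le (by norm_num)).mul
      (contDiffAt_conj (contDiffAt_pderiv (hv.contDiffAt hx') i))
  exact (h1.congr_of_eventuallyEq (greenField_eventuallyEq hV hx i)).contDiffWithinAt

lemma divField_greenField (hV : IsOpen V) (hu : ContDiffOn ℝ 2 u V)
    (hv : IsHelmholtzSolution κ v V) (hx : x ∈ V) :
    divField (greenField V u v) x = greenDensity V (starRingEnd ℂ (κ ^ 2)) u v x := by
  have hx' := hV.mem_nhds hx
  have hvx := hv.1.contDiffAt hx'
  rw [divField_congr (Y := fun i y => u y * starRingEnd ℂ (pderiv i v y))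
    (fun i => greenField_eventuallyEq hV hx i), divField, greenDensity]
  have h1 : ∀ i, pderiv i (fun y => u y * starRingEnd ℂ (pderiv i v y)) x
      = u x * starRingEnd ℂ (pderiv i (pderiv i v) x)
        + pderiv i u x * starRingEnd ℂ (pderiv i v x) := by
    intro i
    rw [pderiv_mul ((hu.contDiffAt hx').differentiableAt two_ne_zero)
      ((contDiffAt_conj (contDiffAt_pderiv hvx i)).differentiableAt one_ne_zero), pderiv_conj]
  have h2 : ∑ i, pderiv i (pderiv i v) x = -(κ ^ 2 * v x) := by
    have h3 := hv.2 x hx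
    rw [laplacian_eq_divField hvx] at h3
    exact eq_neg_of_add_eq_zero_left h3
  simp only [h1, partialDeriv_eq_pderiv hV hx]
  rw [Finset.sum_add_distrib, ← Finset.mul_sum, ← map_sum, h2, map_neg, map_mul]
  ring

lemma normalComp_greenField : normalComp ν (greenField V u v) x
    = u x * starRingEnd ℂ (dirDeriv V v (ν x) x) := by
  rw [normalComp, dirDeriv_eq_sum, map_sum, Finset.mul_sum]
  refine Finset.sum_congr rfl fun i _ => ?_
  rw [greenField, map_mul, Complex.conj_ofReal]
  ring

/-- Green's first identity on a bounded domain. -/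
theorem HasOutwardUnitNormal.green (h : HasOutwardUnitNormal V ν) (hV : IsOpen V)
    (hb : Bornology.IsBounded V) (hu1 : ContDiffOn ℝ 1 u (closure V)) (hu2 : ContDiffOn ℝ 2 u V)
    (hv1 : ContDiffOn ℝ 1 v (closure V)) (hv : IsHelmholtzSolution κ v V) :
    ∫ x in V, greenDensity V (starRingEnd ℂ (κ ^ 2)) u v x
      = ∫ x in frontier V, u x * starRingEnd ℂ (dirDeriv V v (ν x) x) ∂(μHE[2] : Measure E3) := by
  have hU := h.uniqueDiffOn_closure hV
  have hK : IsCompact (closure V) := hb.isCompact_closure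
  have h1 := setIntegral_congr_fun (μ := volume) hV.measurableSet
    (fun x hx => divField_greenField (u := u) hV hu2 hv hx)
  have h2 : IntegrableOn (divField (greenField V u v)) V := by
    refine (((continuousOn_greenDensity hU (starRingEnd ℂ (κ ^ 2)) hu1 hv1).integrableOn_compact
      hK).mono_set subset_closure).congr_fun (fun x hx => ?_) hV.measurableSet
    exact (divField_greenField hV hu2 hv hx).symm
  rw [← h1, h.divergence_theorem hV hK (fun i y hy hy' => absurd hy hy')
    (continuousOn_greenField hU hu1 hv1) (contDiffOn_greenField hV hu2 hv.1) h2]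
  exact integral_congr_ae (Eventually.of_forall fun x => normalComp_greenField)

/-- Green's first identity in an exterior domain, for outgoing waves. The integral converges
absolutely, and the flux at infinity is given by the far-field patterns. -/
theorem HasOutwardUnitNormal.green_exterior (h : HasOutwardUnitNormal V ν) (hV : IsOpen V)
    {R₀ : ℝ} (hR₀ : ∀ x, x ∉ V → ‖x‖ < R₀) {k M r₀ : ℝ} (hk : 0 < k) {g g' : E3 → ℂ}
    (hu1 : ContDiffOn ℝ 1 u (closure V)) (hu2 : ContDiffOn ℝ 2 u V)
    (hv1 : ContDiffOn ℝ 1 v (closure V)) (hv : IsHelmholtzSolution k v V)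
    (hua : HasOutgoingAsymptotics k M r₀ u g) (hva : HasOutgoingAsymptotics k M r₀ v g') :
    IntegrableOn (greenDensity V (k ^ 2) u v) V ∧
    ∫ x in V, greenDensity V (k ^ 2) u v x
      = (∫ x in frontier V, u x * starRingEnd ℂ (dirDeriv V v (ν x) x) ∂(μHE[2] : Measure E3))
        + -(Complex.I / k) * ∫ θ : sphere (0 : E3) 1, g θ * starRingEnd ℂ (g' θ)
          ∂(volume : Measure E3).toSphere := by
  have hU := h.uniqueDiffOn_closure hV
  have hkc : starRingEnd ℂ ((k : ℂ) ^ 2) = (k : ℂ) ^ 2 := by rw [map_pow, Complex.conj_ofReal]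
  set r₁ := max r₀ R₀ with hr₁
  have hr₁1 : 1 ≤ r₁ := hua.one_le.trans (le_max_left _ _)
  have hmem : ∀ x, r₁ ≤ ‖x‖ → x ∈ V := fun x hx => by
    by_contra h0
    linarith [hR₀ x h0, (le_max_right r₀ R₀).trans hx]
  have hua' := hua.mono le_rfl (le_max_left r₀ R₀)
  have hva' := hva.mono le_rfl (le_max_left r₀ R₀)
  have hgc := continuousOn_greenDensity hU ((k : ℂ) ^ 2) hu1 hv1
  -- the density is integrable near the boundary by continuity, and at infinity by its decay
  have hint : IntegrableOn (greenDensity V (k ^ 2) u v) V := by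
    obtain ⟨D, hD, hDb⟩ := hua'.exists_lagrangian_bound hk hva'
    have hfar : IntegrableOn (greenDensity V (k ^ 2) u v) {x | r₁ ≤ ‖x‖} := by
      have hmeas : MeasurableSet {x : E3 | r₁ ≤ ‖x‖} :=
        (isClosed_le continuous_const continuous_norm).measurableSet
      have hmaj : Integrable fun x : E3 => D * 16 * (1 + ‖x‖) ^ (-(4 : ℝ)) :=
        (integrable_one_add_norm (μ := (volume : Measure E3)) (r := 4) (by simp; norm_num)).const_mul
          _
      refine (hmaj.integrableOn (s := {x : E3 | r₁ ≤ ‖x‖})).mono' ?_ ?_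
      · exact (hgc.mono fun x hx => subset_closure (hmem x hx)).aestronglyMeasurable hmeas
      · refine (ae_restrict_iff' hmeas).2 (Eventually.of_forall fun x hx => ?_)
        have hx' : r₁ ≤ ‖x‖ := hx
        have hx1 : 1 ≤ ‖x‖ := hr₁1.trans hx'
        have h1 := hDb x hx'
        simp only [greenDensity, partialDeriv_eq_pderiv hV (hmem x hx')]
        refine h1.trans ?_
        rw [Real.rpow_neg (by positivity), show (4 : ℝ) = ((4 : ℕ) : ℝ) by norm_num,
          Real.rpow_natCast, ← div_eq_mul_inv, div_le_div_iff₀ (by positivity) (by positivity)]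
        have h2 : (1 + ‖x‖) ^ 4 ≤ (2 * ‖x‖) ^ 4 := by
          gcongr
          linarith
        calc D * (1 + ‖x‖) ^ 4 ≤ D * (2 * ‖x‖) ^ 4 := by gcongr
          _ = D * 16 * ‖x‖ ^ 4 := by ring
    have hnear : IntegrableOn (greenDensity V (k ^ 2) u v) (closure V ∩ closedBall 0 r₁) :=
      (hgc.mono Set.inter_subset_left).integrableOn_compact
        ((isCompact_closedBall 0 r₁).inter_left isClosed_closure)
    refine (hnear.union hfar).mono_set fun x hx => ?_
    rcases le_total ‖x‖ r₁ with h1 | h1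
    · exact Or.inl ⟨subset_closure hx, mem_closedBall_zero_iff.2 h1⟩
    · exact Or.inr h1
  refine ⟨hint, ?_⟩
  have hfd : ∀ x, r₁ ≤ ‖x‖ → ∀ w, dirDeriv V v w x = fderiv ℝ v x w := fun x hx w =>
    dirDeriv_eq_fderiv hV (hmem x hx) w
  have huc : ContinuousOn u {x | r₁ ≤ ‖x‖} :=
    hu1.continuousOn.mono fun x hx => subset_closure (hmem x hx)
  have hvc : ContinuousOn (fderiv ℝ v) {x | r₁ ≤ ‖x‖} :=
    (hv.1.continuousOn_fderiv_of_isOpen hV (by norm_num)).mono fun x hx => hmem x hx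
  have hflux := hua'.tendsto_flux hk hva' huc hvc
  have hlim : Tendsto (fun R => ∫ x in V, (cutoff R x : ℂ) * greenDensity V (k ^ 2) u v x) atTop
      (𝓝 (∫ x in V, greenDensity V (k ^ 2) u v x)) := by
    refine tendsto_integral_filter_of_dominated_convergence
      (fun x => ‖greenDensity V (k ^ 2) u v x‖) ?_ ?_ hint.norm ?_
    · refine Eventually.of_forall fun R => ?_
      exact (contDiff_cutoff_complex R (n := 1)).continuous.aestronglyMeasurable.mul
        hint.aestronglyMeasurable
    · refine Eventually.of_forall fun R => Eventually.of_forall fun x => ?_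
      rw [norm_mul, Complex.norm_real, Real.norm_of_nonneg (cutoff_nonneg R x)]
      exact mul_le_of_le_one_left (norm_nonneg _) (cutoff_le_one R x)
    · refine Eventually.of_forall fun x => ?_
      have h1 := (Complex.continuous_ofReal.tendsto _).comp (tendsto_cutoff x)
      simpa using h1.mul_const (greenDensity V (k ^ 2) u v x)
  -- the divergence theorem for the fields multiplied by cutoff functions
  have hcut : ∀ᶠ R in atTop, (∫ x in V, (cutoff R x : ℂ) * greenDensity V (k ^ 2) u v x)
      = (∫ x in frontier V, u x * starRingEnd ℂ (dirDeriv V v (ν x) x) ∂(μHE[2] : Measure E3))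
        + ∫ y, (cutoffDensity R y : ℂ) * (u y * starRingEnd ℂ (fderiv ℝ v y y)) := by
    filter_upwards [eventually_ge_atTop r₁] with R hR
    have hR0 : 0 < R := by linarith
    set X : Fin 3 → E3 → ℂ := fun i x => (cutoff R x : ℂ) * greenField V u v i x with hX
    have hcd := contDiff_cutoff_complex R (n := 1)
    have hdiv : ∀ x ∈ V, divField X x = (cutoff R x : ℂ) * greenDensity V (k ^ 2) u v x
        - (cutoffDensity R x : ℂ) * (u x * starRingEnd ℂ (fderiv ℝ v x x)) := by
      intro x hx
      have h1 : ∀ i, pderiv i (X i) x = (cutoff R x : ℂ) * pderiv i (greenField V u v i) x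
          - (cutoffDensity R x : ℂ) * ((x i : ℂ) * greenField V u v i x) := by
        intro i
        rw [hX, pderiv_mul (hcd.differentiable one_ne_zero x)
          (((contDiffOn_greenField hV hu2 hv.1 i).contDiffAt (hV.mem_nhds hx)).differentiableAt
            one_ne_zero), pderiv_cutoff]
        ring
      have h2 : ∑ i, (x i : ℂ) * greenField V u v i x = u x * starRingEnd ℂ (fderiv ℝ v x x) := by
        rw [← dirDeriv_eq_fderiv hV hx x]
        exact normalComp_greenField (ν := id)
      rw [divField]
      simp only [h1]
      rw [Finset.sum_sub_distrib, ← Finset.mul_sum, ← Finset.mul_sum, h2]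
      have h3 := divField_greenField (u := u) hV hu2 hv hx
      rw [hkc, divField] at h3
      rw [h3]
    have hi1 : IntegrableOn (fun x => (cutoff R x : ℂ) * greenDensity V (k ^ 2) u v x) V := by
      refine hint.norm.mono' (hcd.continuous.aestronglyMeasurable.mul hint.aestronglyMeasurable)
        (Eventually.of_forall fun x => ?_)
      rw [norm_mul, Complex.norm_real, Real.norm_of_nonneg (cutoff_nonneg R x)]
      exact mul_le_of_le_one_left (norm_nonneg _) (cutoff_le_one R x)
    have hi2 : Integrable fun y => (cutoffDensity R y : ℂ) *
        (u y * starRingEnd ℂ (fderiv ℝ v y y)) := by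
      refine integrable_cutoffDensity_mul hR0 ?_
      have hsub : {y : E3 | R ≤ ‖y‖} ⊆ {y | r₁ ≤ ‖y‖} := fun y hy => hR.trans hy
      exact (huc.mono hsub).mul (Complex.continuous_conj.comp_continuousOn
        ((hvc.mono hsub).clm_apply continuousOn_id))
    have hdint : IntegrableOn (divField X) V :=
      (hi1.sub hi2.integrableOn).congr_fun (fun x hx => (hdiv x hx).symm) hV.measurableSet
    have h4 := h.divergence_theorem hV (X := X) (isCompact_closedBall 0 (2 * R))
      (fun i y _ hy => by
        rw [mem_closedBall_zero_iff, not_le] at hy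
        simp [hX, cutoff_eq_zero hR0 hy.le])
      (fun i => hcd.continuous.continuousOn.mul (continuousOn_greenField hU hu1 hv1 i))
      (fun i => hcd.contDiffOn.mul (contDiffOn_greenField hV hu2 hv.1 i)) hdint
    rw [setIntegral_congr_fun hV.measurableSet hdiv, integral_sub hi1 hi2.integrableOn] at h4
    have h5 : ∫ y in V, (cutoffDensity R y : ℂ) * (u y * starRingEnd ℂ (fderiv ℝ v y y))
        = ∫ y, (cutoffDensity R y : ℂ) * (u y * starRingEnd ℂ (fderiv ℝ v y y)) := by
      refine setIntegral_eq_integral_of_forall_compl_eq_zero fun y hy => ?_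
      rw [cutoffDensity_of_lt hR0 ((hR₀ y hy).trans_le ((le_max_right _ _).trans hR))]
      simp
    have h6 : ∫ x in frontier V, normalComp ν X x ∂(μHE[2] : Measure E3)
        = ∫ x in frontier V, u x * starRingEnd ℂ (dirDeriv V v (ν x) x)
          ∂(μHE[2] : Measure E3) := by
      refine setIntegral_congr_fun isClosed_frontier.measurableSet fun x hx => ?_
      have hxV : x ∉ V := by
        rw [hV.frontier_eq] at hx
        exact hx.2
      have hx1 : cutoff R x = 1 :=
        cutoff_eq_one hR0 ((hR₀ x hxV).le.trans ((le_max_right _ _).trans hR))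
      rw [← normalComp_greenField]
      refine Finset.sum_congr rfl fun i _ => ?_
      simp only [hX, hx1, Complex.ofReal_one, one_mul]
    rw [h5, h6] at h4
    linear_combination h4
  exact tendsto_nhds_unique hlim
    ((tendsto_const_nhds.add hflux).congr' (hcut.mono fun R hR => hR.symm))

end Green

/-! ### The interaction densities of a cluster -/

section Materials

namespace Cluster

variable {N : ℕ} (C : Cluster N)

/-- The wavenumber of the lossless exterior region as a real number. -/
noncomputable def k₀ : ℝ := C.ω * √(C.γ 0 * C.ρ 0)

lemma k₀_pos : 0 < C.k₀ :=
  mul_pos C.ω_pos (Real.sqrt_pos.2 (mul_pos (C.γ_pos 0) (C.ρ_pos 0)))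

lemma β_zero : C.β 0 = C.ρ 0 := by simp [β, C.δ_zero]

lemma β_ne_zero (n : Fin (N + 1)) : C.β n ≠ 0 := by
  set t : ℝ := C.ω * C.γ n * C.δ n with ht
  have h1 : (1 + Complex.I * (t : ℂ)) ≠ 0 := by
    intro h
    have := congrArg Complex.re h
    simp at this
  have h2 : (1 + (t : ℂ) ^ 2) ≠ 0 := by
    have : (0 : ℝ) < 1 + t ^ 2 := by positivity
    exact_mod_cast this.ne'
  exact div_ne_zero (mul_ne_zero (Complex.ofReal_ne_zero.2 (C.ρ_pos n).ne') h1) h2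

lemma k_sq (n : Fin (N + 1)) : C.k n ^ 2 = C.ω ^ 2 * C.γ n * C.β n := by
  rw [k, mul_pow, Complex.sqrt]
  have h1 := Complex.cpow_nat_inv_pow (C.γ n * C.β n) (n := 2) two_ne_zero
  rw [Nat.cast_ofNat] at h1
  rw [h1]
  ring

lemma k_zero : C.k 0 = C.k₀ := by
  have h0 : 0 ≤ C.γ 0 * C.ρ 0 := (mul_pos (C.γ_pos 0) (C.ρ_pos 0)).le
  rw [k, k₀, C.β_zero, Complex.sqrt, Real.sqrt_eq_rpow, Complex.ofReal_mul, Complex.ofReal_cpow h0]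
  norm_num

lemma k₀_mul_ζ₀ : C.k₀ * C.ζ₀ = C.ω * C.ρ 0 := by
  have hγ := C.γ_pos 0
  have hρ := C.ρ_pos 0
  rw [k₀, ζ₀, mul_assoc, ← Real.sqrt_mul (by positivity)]
  have h1 : C.γ 0 * C.ρ 0 * (C.ρ 0 / C.γ 0) = C.ρ 0 ^ 2 := by field_simp
  rw [h1, Real.sqrt_sq hρ.le]

lemma ζ₀_pos : 0 < C.ζ₀ := Real.sqrt_pos.2 (div_pos (C.ρ_pos 0) (C.γ_pos 0))

lemma singularSet_eq_empty {n : Fin (N + 1)} (hn : n ≠ C.h) : C.singularSet n = ∅ := by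
  ext x
  simp [singularSet, hn]

end Cluster

end Materials

section Interaction

open Metric InnerProductSpace
open scoped ContDiff

namespace ClusterFields

variable {N : ℕ} {C : Cluster N} (F : ClusterFields C) {n : Fin (N + 1)} {x : E3}

lemma contDiffOn_closure' (hn : n ≠ C.h) (j : Fin N) :
    ContDiffOn ℝ 1 (F.u j n) (closure (C.V n)) := by
  have h := F.contDiffOn_closure j n
  rwa [C.singularSet_eq_empty hn, Set.sdiff_empty] at h

lemma helmholtz' (hn : n ≠ C.h) (j : Fin N) : IsHelmholtzSolution (C.k n) (F.u j n) (C.V n) := by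
  have h := F.helmholtz j n
  rwa [C.singularSet_eq_empty hn, Set.sdiff_empty] at h

/-- The fields in the exterior region have outgoing asymptotics, with common constants. -/
lemma exists_asymptotics : ∃ (g : Fin N → E3 → ℂ) (M r₀ : ℝ),
    ∀ j, HasOutgoingAsymptotics C.k₀ M r₀ (F.u j 0) (g j) := by
  obtain ⟨R₀, hR₀, hmem⟩ := C.exists_radius
  have hV : ∀ x : E3, R₀ < ‖x‖ → x ∈ C.V 0 := fun x hx => by
    by_contra h
    linarith [hmem x h]
  have h : ∀ j, ∃ g M r₀, HasOutgoingAsymptotics C.k₀ M r₀ (F.u j 0) g := by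
    intro j
    have h1 := F.helmholtz' C.h_ne_zero.symm j
    rw [C.k_zero] at h1
    have h2 := F.radiation j
    rw [C.k_zero] at h2
    exact h2.exists_asymptotics C.k₀_pos hR₀ (h1.1.mono hV) fun x hx => h1.2 x (hV x hx)
  choose g M r₀ h using h
  obtain ⟨M', hM'⟩ := Finite.exists_le M
  obtain ⟨r', hr'⟩ := Finite.exists_le r₀
  exact ⟨g, M', r', fun j => (h j).mono (hM' j) (hr' j)⟩

/-- The part of the energy flux through the boundary of `V n` that is due to the fields `u j 0` and
`u m 0` of the exterior region. -/
noncomputable def pairFlux (n : Fin (N + 1)) (j m : Fin N) : ℂ :=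
  ∫ x in frontier (C.V n), F.u j 0 x * starRingEnd ℂ (dirDeriv (C.V 0) (F.u m 0) (C.ν n x) x)
    ∂(μHE[2] : Measure E3)

/-- The contribution of two fields to the cross section. -/
noncomputable def pairCrossSection (j m : Fin N) : ℂ :=
  ∫ θ : sphere (0 : E3) 1, F.g j θ * starRingEnd ℂ (F.g m θ) ∂(volume : Measure E3).toSphere

lemma integrableOn_pairFlux (hn : n ≠ 0) (j m : Fin N) :
    IntegrableOn (fun x => F.u j 0 x * starRingEnd ℂ (dirDeriv (C.V 0) (F.u m 0) (C.ν n x) x))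
      (frontier (C.V n)) (μHE[2] : Measure E3) := by
  have hsub : frontier (C.V n) ⊆ closure (C.V 0) := fun x hx => (C.mem_frontier_zero hn hx).1
  have h0 := C.h_ne_zero.symm
  refine (C.normal_V n hn).integrableOn_frontier (C.isOpen_V n hn)
    (C.isBounded_V n hn).isCompact_closure ?_ fun y hy hy' => absurd hy.1 hy'
  refine ((F.contDiffOn_closure' h0 j).continuousOn.mono hsub).mul
    (Complex.continuous_conj.comp_continuousOn ?_)
  exact (((F.contDiffOn_closure' h0 m).continuousOn_fderivWithin (C.uniqueDiffOn_closure 0)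
    le_rfl).mono hsub).clm_apply (C.normal_V n hn).continuousOn

/-- Green's identity in a scatterer, with the boundary values expressed through the exterior
fields by the transmission conditions. -/
lemma green_scatterer (hn : n ≠ 0) (hnh : n ≠ C.h) (j m : Fin N) :
    ∫ x in C.V n, greenDensity (C.V n) (starRingEnd ℂ (C.k n ^ 2)) (F.u j n) (F.u m n) x
      = starRingEnd ℂ (C.β n) / C.ρ 0 * F.pairFlux n j m := by
  rw [(C.normal_V n hn).green (C.isOpen_V n hn) (C.isBounded_V n hn) (F.contDiffOn_closure' hnh j)
    (F.helmholtz' hnh j).1 (F.contDiffOn_closure' hnh m) (F.helmholtz' hnh m), pairFlux,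
    ← integral_const_mul]
  refine setIntegral_congr_fun isClosed_frontier.measurableSet fun x hx => ?_
  rw [← F.transmission j n hn x hx, ← F.transmission_deriv m n hn x hx, map_mul, map_div₀,
    Complex.conj_ofReal]
  ring

/-- Green's identity in the exterior region. -/
lemma green_exterior (j m : Fin N) :
    IntegrableOn (greenDensity (C.V 0) (C.k₀ ^ 2) (F.u j 0) (F.u m 0)) (C.V 0) ∧
    ∫ x in C.V 0, greenDensity (C.V 0) (C.k₀ ^ 2) (F.u j 0) (F.u m 0) x
      = -(∑ n : Fin (N + 1) with n ≠ 0, F.pairFlux n j m)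
        - Complex.I / C.k₀ * F.pairCrossSection j m := by
  obtain ⟨g, M, r₀, hg⟩ := F.exists_asymptotics
  obtain ⟨R₀, -, hR₀⟩ := C.exists_radius
  have h0 := C.h_ne_zero.symm
  have hH : ∀ j, IsHelmholtzSolution C.k₀ (F.u j 0) (C.V 0) := fun j => by
    rw [← C.k_zero]; exact F.helmholtz' h0 j
  obtain ⟨h1, h2⟩ := C.normal_V_zero.green_exterior (C.isOpen_region 0) hR₀ C.k₀_pos
    (F.contDiffOn_closure' h0 j) (hH j).1 (F.contDiffOn_closure' h0 m) (hH m) (hg j) (hg m)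
  refine ⟨h1, ?_⟩
  have h3 : ∀ θ : sphere (0 : E3) 1, ∀ i, F.g i θ = g i θ := fun θ i => by
    rw [ClusterFields.g, C.k_zero]
    exact (hg i).farFieldPattern_eq C.k₀_pos (mem_sphere_zero_iff_norm.1 θ.2)
  have h4 : ∀ n ≠ 0, ∀ x ∈ frontier (C.V n),
      F.u j 0 x * starRingEnd ℂ (dirDeriv (C.V 0) (F.u m 0) (C.exteriorNormal x) x)
      = -(F.u j 0 x * starRingEnd ℂ (dirDeriv (C.V 0) (F.u m 0) (C.ν n x) x)) := by
    intro n hn x hx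
    rw [C.exteriorNormal_eq hn hx, dirDeriv, map_neg, map_neg, mul_neg, dirDeriv]
  rw [h2, C.frontier_zero, integral_biUnion_finset]
  · have h5 : ∀ n ∈ ({n | n ≠ 0} : Finset (Fin (N + 1))), ∫ x in frontier (C.V n),
        F.u j 0 x * starRingEnd ℂ (dirDeriv (C.V 0) (F.u m 0) (C.exteriorNormal x) x)
          ∂(μHE[2] : Measure E3) = -F.pairFlux n j m := by
      intro n hn
      rw [setIntegral_congr_fun isClosed_frontier.measurableSet (h4 n (Finset.mem_filter.1 hn).2),
        integral_neg, pairFlux]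
    rw [Finset.sum_congr rfl h5, Finset.sum_neg_distrib, pairCrossSection]
    simp only [h3]
    ring
  · exact fun n _ => isClosed_frontier.measurableSet
  · intro a ha b hb hab
    simp only [Finset.coe_filter, Finset.mem_univ, true_and, Set.mem_ofPred_eq] at ha hb
    exact (C.disjoint_V a ha b hb hab).mono frontier_subset_closure frontier_subset_closure
  · intro n hn
    have hn0 := (Finset.mem_filter.1 hn).2
    exact (F.integrableOn_pairFlux hn0 j m).neg.congr_fun (fun x hx => (h4 n hn0 x hx).symm)
      isClosed_frontier.measurableSet

/-- By the transmission conditions, the normal component of the interaction intensity is continuous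
across the boundary of each scatterer. -/
lemma normalInteractionIntensity_eq (hn : n ≠ 0) (hx : x ∈ frontier (C.V n)) :
    F.normalInteractionIntensity n x = Complex.I / (C.ω * C.ρ 0) * ∑ p ∈ pairs N,
      (F.u p.1 0 x * starRingEnd ℂ (dirDeriv (C.V 0) (F.u p.2 0) (C.ν n x) x)
        + F.u p.2 0 x * starRingEnd ℂ (dirDeriv (C.V 0) (F.u p.1 0) (C.ν n x) x)) := by
  have hβ : starRingEnd ℂ (C.β n) ≠ 0 := (map_ne_zero _).2 (C.β_ne_zero n)
  have hρ : (C.ρ 0 : ℂ) ≠ 0 := Complex.ofReal_ne_zero.2 (C.ρ_pos 0).ne'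
  have hω : (C.ω : ℂ) ≠ 0 := Complex.ofReal_ne_zero.2 C.ω_pos.ne'
  have h1 : ∀ a b : Fin N, ∑ i, (C.ν n x i : ℂ) *
      (F.u a n x * partialDeriv (C.V n) (conjField (F.u b n)) i x)
      = starRingEnd ℂ (C.β n) / C.ρ 0 *
        (F.u a 0 x * starRingEnd ℂ (dirDeriv (C.V 0) (F.u b 0) (C.ν n x) x)) := by
    intro a b
    have h2 : ∀ i, (C.ν n x i : ℂ) *
        (F.u a n x * partialDeriv (C.V n) (conjField (F.u b n)) i x)
        = F.u a n x * starRingEnd ℂ ((C.ν n x i : ℂ) * partialDeriv (C.V n) (F.u b n) i x) := by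
      intro i
      rw [partialDeriv_conjField (C.uniqueDiffOn_closure n) hx.1, map_mul, Complex.conj_ofReal]
      ring
    simp only [h2]
    rw [← Finset.mul_sum, ← map_sum, ← dirDeriv_eq_sum, ← F.transmission a n hn x hx,
      ← F.transmission_deriv b n hn x hx, map_mul, map_div₀, Complex.conj_ofReal]
    ring
  rw [normalInteractionIntensity]
  simp only [interactionIntensity]
  have h3 : ∀ i, (C.ν n x i : ℂ) * (Complex.I / (C.ω * starRingEnd ℂ (C.β n)) * ∑ p ∈ pairs N,
      (F.u p.1 n x * partialDeriv (C.V n) (conjField (F.u p.2 n)) i x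
        + F.u p.2 n x * partialDeriv (C.V n) (conjField (F.u p.1 n)) i x))
      = Complex.I / (C.ω * starRingEnd ℂ (C.β n)) * ∑ p ∈ pairs N,
      ((C.ν n x i : ℂ) * (F.u p.1 n x * partialDeriv (C.V n) (conjField (F.u p.2 n)) i x)
        + (C.ν n x i : ℂ) * (F.u p.2 n x * partialDeriv (C.V n) (conjField (F.u p.1 n)) i x)) := by
    intro i
    rw [mul_left_comm, Finset.mul_sum]
    simp only [mul_add]
  simp only [h3]
  rw [← Finset.mul_sum, Finset.sum_comm]
  simp only [Finset.sum_add_distrib, h1]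
  simp only [← Finset.mul_sum]
  field_simp

lemma integrableOn_normalInteractionIntensity (hn : n ≠ 0) :
    IntegrableOn (F.normalInteractionIntensity n) (frontier (C.V n)) (μHE[2] : Measure E3) := by
  refine IntegrableOn.congr_fun ?_ (fun x hx => (F.normalInteractionIntensity_eq hn hx).symm)
    isClosed_frontier.measurableSet
  have h1 : ∀ p ∈ pairs N, Integrable (fun x =>
      F.u p.1 0 x * starRingEnd ℂ (dirDeriv (C.V 0) (F.u p.2 0) (C.ν n x) x)
        + F.u p.2 0 x * starRingEnd ℂ (dirDeriv (C.V 0) (F.u p.1 0) (C.ν n x) x))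
      ((μHE[2] : Measure E3).restrict (frontier (C.V n))) := fun p _ =>
    (F.integrableOn_pairFlux hn p.1 p.2).add (F.integrableOn_pairFlux hn p.2 p.1)
  exact (integrable_finsetSum _ h1).const_mul _

lemma interactionFlux_eq (hn : n ≠ 0) : F.interactionFlux n = Complex.I / (C.ω * C.ρ 0) *
    ∑ p ∈ pairs N, (F.pairFlux n p.1 p.2 + F.pairFlux n p.2 p.1) := by
  rw [interactionFlux, setIntegral_congr_fun isClosed_frontier.measurableSet
    (fun x hx => F.normalInteractionIntensity_eq hn hx), integral_const_mul, integral_finsetSum]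
  · congr 1
    exact Finset.sum_congr rfl fun p _ => integral_add (F.integrableOn_pairFlux hn p.1 p.2)
      (F.integrableOn_pairFlux hn p.2 p.1)
  · exact fun p _ => (F.integrableOn_pairFlux hn p.1 p.2).add (F.integrableOn_pairFlux hn p.2 p.1)

lemma interactionKinetic_eq (hx : x ∈ closure (C.V n)) : F.interactionKinetic n x
    = C.ρ n / (2 * C.ω ^ 2 * ‖C.β n‖ ^ 2) * ∑ p ∈ pairs N,
      (greenDensity (C.V n) 0 (F.u p.1 n) (F.u p.2 n) x
        + greenDensity (C.V n) 0 (F.u p.2 n) (F.u p.1 n) x) := by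
  simp only [interactionKinetic, greenDensity,
    partialDeriv_conjField (C.uniqueDiffOn_closure n) hx, zero_mul, sub_zero,
    Finset.sum_add_distrib]

lemma greenDensity_eq_sub (V : Set E3) (c : ℂ) (u v : E3 → ℂ) (x : E3) :
    greenDensity V c u v x = greenDensity V 0 u v x - c * (u x * starRingEnd ℂ (v x)) := by
  simp [greenDensity]

/-- The symmetrized Green densities combine to the interaction Lagrangian density, up to a multiple
of the kinetic energy density that vanishes in a medium without losses. -/
lemma lagrangian_add_kinetic_eq (hx : x ∈ closure (C.V n)) :
    2 * C.ω ^ 2 * (F.interactionLagrangian n x + (C.β n / C.ρ n - 1) * F.interactionKinetic n x)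
      = (starRingEnd ℂ (C.β n))⁻¹ * ∑ p ∈ pairs N,
      (greenDensity (C.V n) (starRingEnd ℂ (C.k n ^ 2)) (F.u p.1 n) (F.u p.2 n) x
        + greenDensity (C.V n) (starRingEnd ℂ (C.k n ^ 2)) (F.u p.2 n) (F.u p.1 n) x) := by
  have hβ := C.β_ne_zero n
  have hβ' : starRingEnd ℂ (C.β n) ≠ 0 := (map_ne_zero _).2 hβ
  have hρ : (C.ρ n : ℂ) ≠ 0 := Complex.ofReal_ne_zero.2 (C.ρ_pos n).ne'
  have hω : (C.ω : ℂ) ≠ 0 := Complex.ofReal_ne_zero.2 C.ω_pos.ne'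
  have hn : ((‖C.β n‖ : ℂ)) ^ 2 = C.β n * starRingEnd ℂ (C.β n) := (Complex.mul_conj' _).symm
  have hk : starRingEnd ℂ (C.k n ^ 2) = C.ω ^ 2 * C.γ n * starRingEnd ℂ (C.β n) := by
    rw [C.k_sq]
    simp
  rw [hk]
  simp only [greenDensity_eq_sub _ (_ * _ * _)]
  rw [interactionLagrangian, F.interactionKinetic_eq hx, interactionPotential, hn]
  set S := ∑ p ∈ pairs N, (greenDensity (C.V n) 0 (F.u p.1 n) (F.u p.2 n) x
        + greenDensity (C.V n) 0 (F.u p.2 n) (F.u p.1 n) x) with hS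
  set T := ∑ p ∈ pairs N, (F.u p.1 n x * starRingEnd ℂ (F.u p.2 n x)
        + F.u p.2 n x * starRingEnd ℂ (F.u p.1 n x)) with hT
  have h1 : ∑ p ∈ pairs N, (greenDensity (C.V n) 0 (F.u p.1 n) (F.u p.2 n) x
        - C.ω ^ 2 * C.γ n * starRingEnd ℂ (C.β n) * (F.u p.1 n x * starRingEnd ℂ (F.u p.2 n x))
        + (greenDensity (C.V n) 0 (F.u p.2 n) (F.u p.1 n) x
        - C.ω ^ 2 * C.γ n * starRingEnd ℂ (C.β n) * (F.u p.2 n x * starRingEnd ℂ (F.u p.1 n x))))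
      = S - C.ω ^ 2 * C.γ n * starRingEnd ℂ (C.β n) * T := by
    rw [hS, hT, Finset.mul_sum, ← Finset.sum_sub_distrib]
    exact Finset.sum_congr rfl fun p _ => by ring
  rw [h1]
  field_simp
  ring

end ClusterFields

end Interaction

/-! ### The energy balance -/

section Balance

open Metric InnerProductSpace
open scoped ContDiff

namespace ClusterFields

variable {N : ℕ} {C : Cluster N} (F : ClusterFields C) {n : Fin (N + 1)} {x : E3}

lemma continuousOn_interactionKinetic (hn : n ≠ C.h) :
    ContinuousOn (F.interactionKinetic n) (closure (C.V n)) := by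
  have h1 : ∀ j m, ContinuousOn (greenDensity (C.V n) 0 (F.u j n) (F.u m n)) (closure (C.V n)) :=
    fun j m => continuousOn_greenDensity (C.uniqueDiffOn_closure n) 0 (F.contDiffOn_closure' hn j)
      (F.contDiffOn_closure' hn m)
  refine ContinuousOn.congr ?_ fun x hx => F.interactionKinetic_eq hx
  exact continuousOn_const.mul (continuousOn_finsetSum _ fun p _ =>
    (h1 p.1 p.2).add (h1 p.2 p.1))

lemma continuousOn_interactionPotential (hn : n ≠ C.h) :
    ContinuousOn (F.interactionPotential n) (closure (C.V n)) := by
  have h1 : ∀ j m, ContinuousOn (fun x => F.u j n x * starRingEnd ℂ (F.u m n x))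
      (closure (C.V n)) := fun j m =>
    (F.contDiffOn_closure' hn j).continuousOn.mul
      (Complex.continuous_conj.comp_continuousOn (F.contDiffOn_closure' hn m).continuousOn)
  exact continuousOn_const.mul (continuousOn_finsetSum _ fun p _ =>
    (h1 p.1 p.2).add (h1 p.2 p.1))

lemma integrableOn_interactionKinetic (hn0 : n ≠ 0) (hn : n ≠ C.h) :
    IntegrableOn (F.interactionKinetic n) (C.V n) :=
  ((F.continuousOn_interactionKinetic hn).integrableOn_compact
    (C.isBounded_V n hn0).isCompact_closure).mono_set subset_closure

/-- In the exterior region, the Lagrangian density is a multiple of the Green densities. -/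
lemma lagrangian_zero_eq (hx : x ∈ C.V 0) : 2 * C.ω ^ 2 * F.interactionLagrangian 0 x
    = (C.ρ 0 : ℂ)⁻¹ * ∑ p ∈ pairs N,
      (greenDensity (C.V 0) (C.k₀ ^ 2) (F.u p.1 0) (F.u p.2 0) x
        + greenDensity (C.V 0) (C.k₀ ^ 2) (F.u p.2 0) (F.u p.1 0) x) := by
  have hρ : (C.ρ 0 : ℂ) ≠ 0 := Complex.ofReal_ne_zero.2 (C.ρ_pos 0).ne'
  have h1 := F.lagrangian_add_kinetic_eq (subset_closure hx)
  rwa [C.β_zero, div_self hρ, sub_self, zero_mul, add_zero, C.k_zero, map_pow,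
    Complex.conj_ofReal, Complex.conj_ofReal] at h1

lemma integrableOn_interactionLagrangian (hn : n ≠ C.h) :
    IntegrableOn (F.interactionLagrangian n) (C.V n) := by
  by_cases hn0 : n = 0
  · subst hn0
    have hω : (C.ω : ℂ) ≠ 0 := Complex.ofReal_ne_zero.2 C.ω_pos.ne'
    have h1 : ∀ p ∈ pairs N, Integrable (fun x =>
        greenDensity (C.V 0) (C.k₀ ^ 2) (F.u p.1 0) (F.u p.2 0) x
          + greenDensity (C.V 0) (C.k₀ ^ 2) (F.u p.2 0) (F.u p.1 0) x)
        (volume.restrict (C.V 0)) := fun p _ =>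
      (F.green_exterior p.1 p.2).1.add (F.green_exterior p.2 p.1).1
    refine IntegrableOn.congr_fun (((integrable_finsetSum _ h1).const_mul (C.ρ 0 : ℂ)⁻¹).const_mul
      (2 * (C.ω : ℂ) ^ 2)⁻¹) (fun x hx => ?_) (C.isOpen_region 0).measurableSet
    rw [← F.lagrangian_zero_eq hx]
    field_simp
  · exact (((F.continuousOn_interactionKinetic hn).sub
      (F.continuousOn_interactionPotential hn)).integrableOn_compact
      (C.isBounded_V n hn0).isCompact_closure).mono_set subset_closure

lemma conj_interactionKinetic (hx : x ∈ closure (C.V n)) :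
    starRingEnd ℂ (F.interactionKinetic n x) = F.interactionKinetic n x := by
  rw [F.interactionKinetic_eq hx]
  simp only [map_mul, map_div₀, map_sum, map_add, map_pow, Complex.conj_ofReal, greenDensity,
    zero_mul, sub_zero, Complex.conj_conj, map_ofNat]
  congr 1
  refine Finset.sum_congr rfl fun p _ => ?_
  rw [add_comm]
  congr 1 <;> exact Finset.sum_congr rfl fun i _ => mul_comm _ _

lemma conj_interactionPotential (x : E3) :
    starRingEnd ℂ (F.interactionPotential n x) = F.interactionPotential n x := by
  rw [interactionPotential]
  simp only [map_mul, map_div₀, map_sum, map_add, Complex.conj_ofReal, Complex.conj_conj,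
    map_ofNat]
  congr 1
  refine Finset.sum_congr rfl fun p _ => ?_
  ring

lemma conj_integral_interactionKinetic : starRingEnd ℂ (∫ x in C.V n, F.interactionKinetic n x)
    = ∫ x in C.V n, F.interactionKinetic n x := by
  rw [← integral_conj]
  exact setIntegral_congr_fun (C.isOpen_region n).measurableSet fun x hx =>
    F.conj_interactionKinetic (subset_closure hx)

lemma conj_integral_interactionLagrangian :
    starRingEnd ℂ (∫ x in C.V n, F.interactionLagrangian n x)
      = ∫ x in C.V n, F.interactionLagrangian n x := by
  rw [← integral_conj]
  refine setIntegral_congr_fun (C.isOpen_region n).measurableSet fun x hx => ?_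
  rw [interactionLagrangian, map_sub, F.conj_interactionKinetic (subset_closure hx),
    F.conj_interactionPotential]

/-- The energy balance of a scatterer without source. -/
lemma balance_scatterer (hn0 : n ≠ 0) (hn : n ≠ C.h) :
    2 * C.ω ^ 2 * ((∫ x in C.V n, F.interactionLagrangian n x)
        + (C.β n / C.ρ n - 1) * ∫ x in C.V n, F.interactionKinetic n x)
      = (C.ρ 0 : ℂ)⁻¹ * ∑ p ∈ pairs N, (F.pairFlux n p.1 p.2 + F.pairFlux n p.2 p.1) := by
  have hβ' : starRingEnd ℂ (C.β n) ≠ 0 := (map_ne_zero _).2 (C.β_ne_zero n)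
  have hK := F.integrableOn_interactionKinetic hn0 hn
  have hL := F.integrableOn_interactionLagrangian hn
  have hG : ∀ j m, IntegrableOn (greenDensity (C.V n) (starRingEnd ℂ (C.k n ^ 2)) (F.u j n)
      (F.u m n)) (C.V n) := fun j m =>
    ((continuousOn_greenDensity (C.uniqueDiffOn_closure n) _ (F.contDiffOn_closure' hn j)
      (F.contDiffOn_closure' hn m)).integrableOn_compact
      (C.isBounded_V n hn0).isCompact_closure).mono_set subset_closure
  have h1 := setIntegral_congr_fun (μ := volume) (C.isOpen_region n).measurableSet
    fun x hx => F.lagrangian_add_kinetic_eq (n := n) (subset_closure hx)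
  rw [integral_const_mul, integral_add hL (hK.const_mul _), integral_const_mul,
    integral_const_mul, integral_finsetSum] at h1
  · rw [h1, Finset.mul_sum, Finset.mul_sum]
    refine Finset.sum_congr rfl fun p _ => ?_
    rw [integral_add (hG _ _) (hG _ _), F.green_scatterer hn0 hn, F.green_scatterer hn0 hn]
    field_simp
  · exact fun p _ => (hG _ _).add (hG _ _)

/-- The energy balance of the exterior region. -/
lemma balance_exterior :
    2 * C.ω ^ 2 * ∫ x in C.V 0, F.interactionLagrangian 0 x
      = -(∑ n : Fin (N + 1) with n ≠ 0,
          (C.ρ 0 : ℂ)⁻¹ * ∑ p ∈ pairs N, (F.pairFlux n p.1 p.2 + F.pairFlux n p.2 p.1))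
        - Complex.I / (C.k₀ * C.ρ 0) * ∑ p ∈ pairs N,
          (F.pairCrossSection p.1 p.2 + F.pairCrossSection p.2 p.1) := by
  have h1 := setIntegral_congr_fun (μ := volume) (C.isOpen_region 0).measurableSet
    fun x hx => F.lagrangian_zero_eq hx
  have hG := fun j m => (F.green_exterior j m).1
  rw [integral_const_mul, integral_const_mul, integral_finsetSum] at h1
  · have h2 : ∀ p ∈ pairs N, ∫ x in C.V 0,
        (greenDensity (C.V 0) (C.k₀ ^ 2) (F.u p.1 0) (F.u p.2 0) x
          + greenDensity (C.V 0) (C.k₀ ^ 2) (F.u p.2 0) (F.u p.1 0) x)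
        = -(∑ n : Fin (N + 1) with n ≠ 0, (F.pairFlux n p.1 p.2 + F.pairFlux n p.2 p.1))
          - Complex.I / C.k₀ * (F.pairCrossSection p.1 p.2 + F.pairCrossSection p.2 p.1) := by
      intro p _
      rw [integral_add (hG _ _) (hG _ _), (F.green_exterior _ _).2, (F.green_exterior _ _).2,
        Finset.sum_add_distrib]
      ring
    rw [h1, Finset.sum_congr rfl h2, Finset.sum_sub_distrib, Finset.sum_neg_distrib,
      Finset.sum_comm, ← Finset.mul_sum, ← Finset.mul_sum]
    ring
  · exact fun p _ => (hG _ _).add (hG _ _)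

lemma sum_ne_eq_sum_pairs (f : Fin N → Fin N → ℂ) :
    ∑ p : Fin N × Fin N with p.1 ≠ p.2, f p.1 p.2 = ∑ p ∈ pairs N, (f p.1 p.2 + f p.2 p.1) := by
  have h1 : (Finset.univ.filter fun p : Fin N × Fin N => p.1 ≠ p.2)
      = pairs N ∪ Finset.univ.filter fun p => p.2 < p.1 := by
    ext p
    simp only [pairs, Finset.mem_union, Finset.mem_filter, Finset.mem_univ, true_and]
    exact ne_iff_lt_or_gt
  have h2 : ∑ p : Fin N × Fin N with p.2 < p.1, f p.1 p.2 = ∑ p ∈ pairs N, f p.2 p.1 :=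
    Finset.sum_equiv (Equiv.prodComm _ _) (by simp [pairs]) (by simp)
  rw [h1, Finset.sum_union, h2, Finset.sum_add_distrib]
  refine Finset.disjoint_left.2 fun p hp hp' => ?_
  simp only [pairs, Finset.mem_filter, Finset.mem_univ, true_and] at hp hp'
  exact lt_asymm hp hp'

lemma σc_div_ζ₀ : F.σc / C.ζ₀ = 1 / (C.ω * C.k₀ * C.ρ 0) * ∑ p ∈ pairs N,
    (F.pairCrossSection p.1 p.2 + F.pairCrossSection p.2 p.1) := by
  have h1 : (C.k₀ : ℂ) * C.ζ₀ = C.ω * C.ρ 0 := by exact_mod_cast C.k₀_mul_ζ₀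
  have hk : (C.k₀ : ℂ) ≠ 0 := Complex.ofReal_ne_zero.2 C.k₀_pos.ne'
  have hζ : (C.ζ₀ : ℂ) ≠ 0 := Complex.ofReal_ne_zero.2 C.ζ₀_pos.ne'
  rw [σc, C.k_zero]
  have h2 := sum_ne_eq_sum_pairs F.pairCrossSection
  simp only [pairCrossSection] at h2 ⊢
  rw [h2, show (C.ω : ℂ) * C.k₀ * C.ρ 0 = C.k₀ * (C.k₀ * C.ζ₀) by rw [h1]; ring]
  field_simp

lemma conj_σc : starRingEnd ℂ F.σc = F.σc := by
  rw [σc, C.k_zero]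
  have h2 := sum_ne_eq_sum_pairs F.pairCrossSection
  have h3 : ∀ j m, starRingEnd ℂ (F.pairCrossSection j m) = F.pairCrossSection m j := by
    intro j m
    rw [pairCrossSection, ← integral_conj, pairCrossSection]
    refine integral_congr_ae (Eventually.of_forall fun θ => ?_)
    simp [mul_comm]
  change starRingEnd ℂ (1 / (C.k₀ : ℂ) ^ 2 * ∑ p : Fin N × Fin N with p.1 ≠ p.2,
    F.pairCrossSection p.1 p.2) = 1 / (C.k₀ : ℂ) ^ 2 * ∑ p : Fin N × Fin N with p.1 ≠ p.2,
    F.pairCrossSection p.1 p.2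
  rw [h2]
  simp only [map_mul, map_div₀, map_sum, map_add, map_pow, Complex.conj_ofReal, map_one, h3]
  congr 1
  exact Finset.sum_congr rfl fun p _ => add_comm _ _

/-- The complex energy balance of the cluster, whose real and imaginary parts are the theorem. -/
lemma balance : F.σc / C.ζ₀ = F.interactionFlux C.h
    + 2 * Complex.I * C.ω *
      (∑ n : Fin (N + 1) with n ≠ C.h, ∫ x in C.V n, F.interactionLagrangian n x)
    + 2 * Complex.I * C.ω * ∑ n : Fin (N + 1) with n ≠ 0 ∧ n ≠ C.h,
      (C.β n / C.ρ n - 1) * ∫ x in C.V n, F.interactionKinetic n x := by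
  have hρ : (C.ρ 0 : ℂ) ≠ 0 := Complex.ofReal_ne_zero.2 (C.ρ_pos 0).ne'
  have hω : (C.ω : ℂ) ≠ 0 := Complex.ofReal_ne_zero.2 C.ω_pos.ne'
  have hk : (C.k₀ : ℂ) ≠ 0 := Complex.ofReal_ne_zero.2 C.k₀_pos.ne'
  set S := fun n => ∑ p ∈ pairs N, (F.pairFlux n p.1 p.2 + F.pairFlux n p.2 p.1) with hS
  set L := fun n => ∫ x in C.V n, F.interactionLagrangian n x with hL
  set K := fun n => (C.β n / C.ρ n - 1) * ∫ x in C.V n, F.interactionKinetic n x with hK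
  set G := ∑ p ∈ pairs N, (F.pairCrossSection p.1 p.2 + F.pairCrossSection p.2 p.1) with hG
  have hext : 2 * C.ω ^ 2 * L 0 = -(∑ n : Fin (N + 1) with n ≠ 0, (C.ρ 0 : ℂ)⁻¹ * S n)
      - Complex.I / (C.k₀ * C.ρ 0) * G := F.balance_exterior
  have hsc : ∀ n : Fin (N + 1), n ≠ 0 ∧ n ≠ C.h →
      (C.ρ 0 : ℂ)⁻¹ * S n = 2 * C.ω ^ 2 * (L n + K n) := fun n hn =>
    (F.balance_scatterer hn.1 hn.2).symm
  have hfilter : (Finset.univ.filter fun n : Fin (N + 1) => n ≠ 0)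
      = insert C.h (Finset.univ.filter fun n => n ≠ 0 ∧ n ≠ C.h) := by
    ext n
    simp only [Finset.mem_filter, Finset.mem_univ, true_and, Finset.mem_insert]
    constructor
    · intro h
      by_cases h' : n = C.h
      · exact Or.inl h'
      · exact Or.inr ⟨h, h'⟩
    · rintro (h | h)
      · rw [h]; exact C.h_ne_zero
      · exact h.1
  have hfilter' : (Finset.univ.filter fun n : Fin (N + 1) => n ≠ C.h)
      = insert 0 (Finset.univ.filter fun n => n ≠ 0 ∧ n ≠ C.h) := by
    ext n
    simp only [Finset.mem_filter, Finset.mem_univ, true_and, Finset.mem_insert]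
    constructor
    · intro h
      by_cases h' : n = 0
      · exact Or.inl h'
      · exact Or.inr ⟨h', h⟩
    · rintro (h | h)
      · rw [h]; exact C.h_ne_zero.symm
      · exact h.2
  rw [hfilter, Finset.sum_insert (by simp), Finset.sum_congr rfl fun n hn =>
    hsc n (Finset.mem_filter.1 hn).2, ← Finset.mul_sum, Finset.sum_add_distrib] at hext
  rw [F.σc_div_ζ₀, F.interactionFlux_eq C.h_ne_zero, hfilter', Finset.sum_insert (by simp)]
  change 1 / (C.ω * C.k₀ * C.ρ 0) * G = Complex.I / (C.ω * C.ρ 0) * S C.h + _ + _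
  set SL := ∑ n : Fin (N + 1) with n ≠ 0 ∧ n ≠ C.h, L n
  set SK := ∑ n : Fin (N + 1) with n ≠ 0 ∧ n ≠ C.h, K n
  have h1 : G / (C.k₀ * C.ρ 0) = Complex.I * ((C.ρ 0 : ℂ)⁻¹ * S C.h
      + 2 * C.ω ^ 2 * (SL + SK) + 2 * C.ω ^ 2 * L 0) := by
    rw [hext]
    linear_combination (G / (C.k₀ * C.ρ 0)) * Complex.I_sq
  have h2 : 1 / (C.ω * C.k₀ * C.ρ 0) * G = (G / (C.k₀ * C.ρ 0)) / C.ω := by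
    field_simp
  rw [h2, h1]
  field_simp
  ring

end ClusterFields

end Balance

theorem theorem2 {N : ℕ} (C : Cluster N) (F : ClusterFields C) :
    -- the far-field patterns exist and all the integrals converge absolutely
    ((∀ j, IsFarFieldPattern (C.k 0) (F.u j 0) (F.g j)) ∧
      (∀ k m, Integrable (fun θ : Metric.sphere (0 : E3) 1 => F.g k θ * starRingEnd ℂ (F.g m θ))
        (volume : Measure E3).toSphere) ∧
      IntegrableOn (F.normalInteractionIntensity C.h) (frontier (C.V C.h)) (μHE[2] : Measure E3) ∧
      (∀ n ≠ C.h, IntegrableOn (F.interactionLagrangian n) (C.V n)) ∧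
      (∀ n ≠ 0, n ≠ C.h → IntegrableOn (F.interactionKinetic n) (C.V n))) ∧
    -- the cluster interaction cross section
    F.σc / C.ζ₀ = ((F.interactionFlux C.h).re : ℂ)
      - 2 * C.ω * ∑ n : Fin (N + 1) with n ≠ 0 ∧ n ≠ C.h,
          ∫ x in C.V n, ((C.β n / C.ρ n - 1).im : ℂ) * F.interactionKinetic n x ∧
    -- the interaction Lagrangian densities
    ∑ n : Fin (N + 1) with n ≠ C.h, ∫ x in C.V n, F.interactionLagrangian n x
      = - (1 / (2 * C.ω)) * ((F.interactionFlux C.h).im : ℂ)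
        - ∑ n : Fin (N + 1) with n ≠ 0 ∧ n ≠ C.h,
          ∫ x in C.V n, ((C.β n / C.ρ n - 1).re : ℂ) * F.interactionKinetic n x := by
  obtain ⟨g, M, r₀, hg⟩ := F.exists_asymptotics
  have hgF : ∀ j, ∀ θ : Metric.sphere (0 : E3) 1, F.g j θ = g j θ := fun j θ => by
    rw [ClusterFields.g, C.k_zero]
    exact (hg j).farFieldPattern_eq C.k₀_pos (mem_sphere_zero_iff_norm.1 θ.2)
  refine ⟨⟨fun j => ?_, fun k m => ?_, F.integrableOn_normalInteractionIntensity C.h_ne_zero,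
    fun n hn => F.integrableOn_interactionLagrangian hn,
    fun n hn hn' => F.integrableOn_interactionKinetic hn hn'⟩, ?_⟩
  · rw [ClusterFields.g, C.k_zero]
    exact (hg j).isFarFieldPattern C.k₀_pos
  · simp only [hgF]
    have hc : Continuous fun θ : Metric.sphere (0 : E3) 1 => g k θ * starRingEnd ℂ (g m θ) :=
      ((hg k).continuous.comp continuous_subtype_val).mul
        (Complex.continuous_conj.comp ((hg m).continuous.comp continuous_subtype_val))
    exact hc.integrable_of_hasCompactSupport (HasCompactSupport.of_compactSpace _)
  -- the complex balance and its conjugate; all the integrals over the regions are real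
  have hω : (C.ω : ℂ) ≠ 0 := Complex.ofReal_ne_zero.2 C.ω_pos.ne'
  have h1 := F.balance
  have h2 := congrArg (starRingEnd ℂ) h1
  simp only [map_add, map_mul, map_div₀, map_sum, map_ofNat, Complex.conj_I, Complex.conj_ofReal,
    F.conj_σc, F.conj_integral_interactionLagrangian, F.conj_integral_interactionKinetic] at h2
  have hre : ∀ n : Fin (N + 1), ((C.β n / C.ρ n - 1).re : ℂ) * ∫ x in C.V n, F.interactionKinetic n x
      = ((C.β n / C.ρ n - 1) * (∫ x in C.V n, F.interactionKinetic n x)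
        + starRingEnd ℂ (C.β n / C.ρ n - 1) * ∫ x in C.V n, F.interactionKinetic n x) / 2 := by
    intro n
    rw [Complex.re_eq_add_conj]
    ring
  have him : ∀ n : Fin (N + 1), ((C.β n / C.ρ n - 1).im : ℂ) * ∫ x in C.V n, F.interactionKinetic n x
      = ((C.β n / C.ρ n - 1) * (∫ x in C.V n, F.interactionKinetic n x)
        - starRingEnd ℂ (C.β n / C.ρ n - 1) * ∫ x in C.V n, F.interactionKinetic n x)
          / (2 * Complex.I) := by
    intro n
    rw [Complex.im_eq_sub_conj]
    ring
  simp only [integral_const_mul, hre, him, ← Finset.sum_div, Finset.sum_add_distrib,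
    Finset.sum_sub_distrib]
  rw [Complex.re_eq_add_conj, Complex.im_eq_sub_conj]
  have hI : Complex.I ≠ 0 := Complex.I_ne_zero
  set A := ∑ n : Fin (N + 1) with n ≠ 0 ∧ n ≠ C.h,
    (C.β n / C.ρ n - 1) * ∫ x in C.V n, F.interactionKinetic n x
  set B := ∑ n : Fin (N + 1) with n ≠ 0 ∧ n ≠ C.h,
    starRingEnd ℂ (C.β n / C.ρ n - 1) * ∫ x in C.V n, F.interactionKinetic n x
  constructor
  · field_simp
    linear_combination Complex.I * h1 + Complex.I * h2 + 2 * C.ω * (A - B) * Complex.I_sq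
  · field_simp
    linear_combination h2 - h1
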